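/- Let $M$ be a connected (Hausdorff, second countable, finite-dimensional) smooth manifold, $\nabla$ a smooth connection on $M$ (not necessarily torsion-free), and $W\subseteq T^*M\otimes T^*M$ the bundle of symmetric bilinear forms with the connection induced by $\nabla$ and its curvature tensor $R$. For $V\subseteq W$ let $\mathcal S(V)$ be the set of values of smooth local sections of $W$ lying in $V$. For $W'\subseteq W$ let $\ker\alpha_{W'}$ be the set of those $w\in W'$, over a point $x$, for which there is a smooth local section $h$ of $W$ with values in $W'$, defined near $x$, such that $h(x)=w$ and $\nabla_vh\in W'_x$ for all $v\in T_xM$. Put $V^{(0)}=\{w\in W: R(\cdot,\cdot)(w)=0\}$, $W^{(i)}=\mathcal S(V^{(i)})$, $V^{(i+1)}=\ker\alpha_{W^{(i)}}$, and let $\widetilde W=\bigcap_iW^{(i)}$ be the terminal member of the decreasing sequence $W^{(0)}\supseteq W^{(1)}\supseteq\cdots$. Assume that $\nabla$ is regular: $\widetilde W$ is a smooth vector bundle over $M$, of rank $n$ say. Let $\mathcal G_k$ be the constant sheaf of sections in $GL(k,\mathbb R)$ (locally constant maps) and $H^1(M,\mathcal G_k)$ the direct limit over open covers of the sets of Čech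 1-cocycles modulo $a\sim a'\iff a'_{\alpha\beta}=b_\alpha^{-1}a_{\alpha\beta}b_\beta$. For $k\le n$ let $\iota(A)=\mathrm{diag}(I_{n-k},A)$, $\iota:GL(k,\mathbb R)\to GL(n,\mathbb R)$, and let $H^1_k\subseteq H^1(M,\mathcal G_n)$ be the image of $H^1(M,\mathcal G_k)$ under the induced map. The rank of $\sigma\in H^1(M,\mathcal G_n)$ is $n-k$, with $k$ the least non-negative integer such that $\sigma\in H^1_k$. An open cover $\{U_\alpha\}$ of $M$ with bases $(h_{\alpha1},\dots,h_{\alpha n})$ of parallel sections of $\widetilde W$ over $U_\alpha$ determines a 1-cocycle $t$ with values in $\mathcal G_n$ by $h_{\alpha i}=\sum_j(t_{\alpha\beta})_{ij}h_{\beta j}$ on $U_\alpha\cap U_\beta$. Then there is $\tau\in H^1(M,\mathcal G_n)$, the class of $(\widetilde W,\nabla)$, such that $[t]=\tau$ for every such choice of cover and bases. Let $m$ be the rank of $\tau$. There are choices of cover and bases for which $t=\iota(a)$ with $a$ a cochain with values in $\mathcal G_{n-m}$; for every such choice let $W_\nabla\subseteq\widetilde W$ be the subbundle spanned by the $h_{\alpha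 i}$ with $1\le i\le m$. For every such choice, $\nabla$ is metric (there is a parallel smooth Riemannian metric on $M$) if and only if $W_\nabla$ contains a positive-definite bilinear form (in its fibre over some point of $M$). -/

import Mathlib

open Bundle Set TopologicalSpace
open scoped Manifold ContDiff Topology

set_option synthInstance.maxHeartbeats 200000

noncomputable section

/-! ### Bilinear forms on the tangent bundle and their covariant derivative -/

section Connection

variable {E : Type*} [NormedAddCommGroup E] [NormedSpace ℝ E]
  {M : Type*} [TopologicalSpace M] [ChartedSpace E M]

/-- The fibre at `x` of `T*M ⊗ T*M`: bilinear forms on the tangent space at `x`. -/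
abbrev BilinAt (E : Type*) [NormedAddCommGroup E] [NormedSpace ℝ E]
    {M : Type*} [TopologicalSpace M] [ChartedSpace E M] (x : M) : Type _ :=
  TangentSpace 𝓘(ℝ, E) x →L[ℝ] TangentSpace 𝓘(ℝ, E) x →L[ℝ] ℝ

/-- A form is symmetric: it lies in the fibre of the bundle `W` of symmetric forms. -/
def IsSymmForm {x : M} (w : BilinAt E x) : Prop := ∀ v v', w v v' = w v' v

/-- A form is positive definite. -/
def IsPosDefForm {x : M} (w : BilinAt E x) : Prop := ∀ v, v ≠ 0 → 0 < w v v

variable [IsManifold 𝓘(ℝ, E) ∞ M]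

/-- A field of bilinear forms, as a map into the total space of `T*M ⊗ T*M`. -/
def formMap (h : Π x : M, BilinAt E x) (x : M) :
    TotalSpace (E →L[ℝ] E →L[ℝ] ℝ) (fun x : M ↦ BilinAt E x) :=
  TotalSpace.mk' (E →L[ℝ] E →L[ℝ] ℝ) x (h x)

/-- The field of forms `h` is smooth on `U`. -/
def SmoothFormOn (h : Π x : M, BilinAt E x) (U : Set M) : Prop :=
  ContMDiffOn 𝓘(ℝ, E) (𝓘(ℝ, E).prod 𝓘(ℝ, E →L[ℝ] E →L[ℝ] ℝ)) ∞ (formMap h) U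

/-- The field of forms `h` is differentiable at `x`. -/
def DiffFormAt (h : Π x : M, BilinAt E x) (x : M) : Prop :=
  MDifferentiableAt 𝓘(ℝ, E) (𝓘(ℝ, E).prod 𝓘(ℝ, E →L[ℝ] E →L[ℝ] ℝ)) (formMap h) x

/-! ### Subsets of the bundle of forms -/

/-- A subset of `T*M ⊗ T*M`, given by its fibres. -/
abbrev FormSubset (E M : Type*) [NormedAddCommGroup E] [NormedSpace ℝ E]
    [TopologicalSpace M] [ChartedSpace E M] : Type _ := Π x : M, Set (BilinAt E x)

/-- `h` is, on the open set `U`, a smooth local section with values in `V`. -/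
structure IsLocalSection (V : FormSubset E M) (U : Set M) (h : Π x : M, BilinAt E x) : Prop where
  isOpen : IsOpen U
  smooth : SmoothFormOn h U
  mem : ∀ x ∈ U, h x ∈ V x

/-- The bundle `W` of symmetric forms. -/
def symmForms : FormSubset E M := fun _ ↦ {w | IsSymmForm w}

/-- `𝒮(V)`: the elements of `V` through which there passes a smooth local section of `V`. -/
def sectionHull (V : FormSubset E M) : FormSubset E M := fun x ↦
  {w | ∃ (U : Set M) (h : Π x : M, BilinAt E x), x ∈ U ∧ IsLocalSection V U h ∧ h x = w}

/-- The forms `h 0 x, …, h (n-1) x` are a basis of the fibre `V x`. -/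
def IsFibreBasis (V : FormSubset E M) {n : ℕ} (h : Fin n → Π x : M, BilinAt E x) (x : M) : Prop :=
  LinearIndependent ℝ (fun i ↦ h i x) ∧
    (Submodule.span ℝ (range fun i ↦ h i x) : Set (BilinAt E x)) = V x

/-- `V` is a smooth vector bundle of rank `n` over `M`: it has smooth local frames of length `n`. -/
def IsVectorBundleOfRank (V : FormSubset E M) (n : ℕ) : Prop :=
  ∀ x : M, ∃ (U : Set M) (h : Fin n → Π x : M, BilinAt E x), x ∈ U ∧
    (∀ i, IsLocalSection V U (h i)) ∧ ∀ y ∈ U, IsFibreBasis V h y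

/-! ### The induced connection -/

/-- The expression `v (h(Y, Z)) - h(∇_v Y, Z) - h(Y, ∇_v Z)`. -/
def covAux (cov : CovariantDerivative 𝓘(ℝ, E) E (TangentSpace 𝓘(ℝ, E) : M → Type _))
    (h : Π x : M, BilinAt E x) (x : M) (v : TangentSpace 𝓘(ℝ, E) x)
    (Y Z : Π x : M, TangentSpace 𝓘(ℝ, E) x) : ℝ :=
  d% (fun p ↦ h p (Y p) (Z p)) x v - h x (cov Y x v) (Z x) - h x (Y x) (cov Z x v)

theorem DiffFormAt.apply {h : Π x : M, BilinAt E x} {x : M} (hh : DiffFormAt h x)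
    {Y Z : Π x : M, TangentSpace 𝓘(ℝ, E) x} (hY : MDiffAt (T% Y) x) (hZ : MDiffAt (T% Z) x) :
    MDiffAt (fun p ↦ h p (Y p) (Z p)) x := by
  have : MDifferentiableAt 𝓘(ℝ, E) (𝓘(ℝ, E).prod 𝓘(ℝ))
      (fun m ↦ TotalSpace.mk' ℝ (E := Bundle.Trivial M ℝ) m (h m (Y m) (Z m))) x := by
    apply MDifferentiableAt.clm_bundle_apply₂ (F₁ := E) (F₂ := E)
    · exact hh
    · exact hY
    · exact hZ
  simp only [mdifferentiableAt_totalSpace] at this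
  exact this.2

theorem covAux_tensorial₁ (cov : CovariantDerivative 𝓘(ℝ, E) E (TangentSpace 𝓘(ℝ, E) : M → Type _))
    {h : Π x : M, BilinAt E x} {x : M} (hh : DiffFormAt h x) (v : TangentSpace 𝓘(ℝ, E) x)
    (Z : Π x : M, TangentSpace 𝓘(ℝ, E) x) (hZ : MDiffAt (T% Z) x) :
    TensorialAt 𝓘(ℝ, E) E (covAux cov h x v · Z) x where
  smul {f Y} hf hY := by
    have := mvfderiv_fun_mul hf (hh.apply hY hZ)
    simp [covAux, this, cov.isCovariantDerivativeOn.leibniz hY hf]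
    ring
  add {Y Y'} hY hY' := by
    have := mvfderiv_fun_add (hh.apply hY hZ) (hh.apply hY' hZ)
    simp [covAux, this, cov.isCovariantDerivativeOn.add hY hY']
    ring

theorem covAux_tensorial₂ (cov : CovariantDerivative 𝓘(ℝ, E) E (TangentSpace 𝓘(ℝ, E) : M → Type _))
    {h : Π x : M, BilinAt E x} {x : M} (hh : DiffFormAt h x) (v : TangentSpace 𝓘(ℝ, E) x)
    (Y : Π x : M, TangentSpace 𝓘(ℝ, E) x) (hY : MDiffAt (T% Y) x) :
    TensorialAt 𝓘(ℝ, E) E (covAux cov h x v Y) x where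
  smul {f Z} hf hZ := by
    have := mvfderiv_fun_mul hf (hh.apply hY hZ)
    simp [covAux, this, cov.isCovariantDerivativeOn.leibniz hZ hf]
    ring
  add {Z Z'} hZ hZ' := by
    have := mvfderiv_fun_add (hh.apply hY hZ) (hh.apply hY hZ')
    simp [covAux, this, cov.isCovariantDerivativeOn.add hZ hZ']
    ring

variable [FiniteDimensional ℝ E]

open Classical in
/-- The covariant derivative `∇_v h` at `x` of a field of bilinear forms `h`, for the connection
induced on `T*M ⊗ T*M` by a connection on `M`: the bilinear form with
`(∇_v h)(Y, Z) = v (h(Y, Z)) - h(∇_v Y, Z) - h(Y, ∇_v Z)`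
(and `0` if `h` is not differentiable at `x`). -/
def covForm (cov : CovariantDerivative 𝓘(ℝ, E) E (TangentSpace 𝓘(ℝ, E) : M → Type _))
    (h : Π x : M, BilinAt E x) (x : M) (v : TangentSpace 𝓘(ℝ, E) x) : BilinAt E x :=
  if hh : DiffFormAt h x then
    TensorialAt.mkHom₂ (I := 𝓘(ℝ, E)) (F := E) (F' := E) (covAux cov h x v) x
      (covAux_tensorial₁ cov hh v) (covAux_tensorial₂ cov hh v)
  else 0

theorem covForm_apply (cov : CovariantDerivative 𝓘(ℝ, E) E (TangentSpace 𝓘(ℝ, E) : M → Type _))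
    {h : Π x : M, BilinAt E x} {x : M} (hh : DiffFormAt h x) (v : TangentSpace 𝓘(ℝ, E) x)
    {Y Z : Π x : M, TangentSpace 𝓘(ℝ, E) x} (hY : MDiffAt (T% Y) x) (hZ : MDiffAt (T% Z) x) :
    covForm cov h x v (Y x) (Z x) =
      d% (fun p ↦ h p (Y p) (Z p)) x v - h x (cov Y x v) (Z x) - h x (Y x) (cov Z x v) := by
  rw [covForm, dif_pos hh]
  exact TensorialAt.mkHom₂_apply _ _ hY hZ

/-- `R(X, Y) h = ∇_X ∇_Y h - ∇_Y ∇_X h - ∇_{[X, Y]} h` at the point `x`. -/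
def curvForm (cov : CovariantDerivative 𝓘(ℝ, E) E (TangentSpace 𝓘(ℝ, E) : M → Type _))
    (X Y : Π x : M, TangentSpace 𝓘(ℝ, E) x) (h : Π x : M, BilinAt E x) (x : M) : BilinAt E x :=
  covForm cov (fun p ↦ covForm cov h p (Y p)) x (X x)
    - covForm cov (fun p ↦ covForm cov h p (X p)) x (Y x)
    - covForm cov h x (VectorField.mlieBracket 𝓘(ℝ, E) X Y x)

/-! ### The derived flag and the maximal flat subset -/

/-- `V⁽⁰⁾ = {w ∈ W | R(·,·)(w) = 0}`, with the curvature tensor of the induced connection evaluated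
on arbitrary smooth local extensions of the arguments. -/
def flatForms (cov : CovariantDerivative 𝓘(ℝ, E) E (TangentSpace 𝓘(ℝ, E) : M → Type _)) :
    FormSubset E M := fun x ↦
  {w | IsSymmForm w ∧ ∀ (U : Set M) (X Y : Π x : M, TangentSpace 𝓘(ℝ, E) x)
    (h : Π x : M, BilinAt E x), x ∈ U → CMDiff[U] ∞ (T% X) → CMDiff[U] ∞ (T% Y) →
    IsLocalSection symmForms U h → h x = w → curvForm cov X Y h x = 0}

/-- The kernel of the second fundamental form `α : W' → (W/W') ⊗ T*M`, `α(h(x)) = ∇h(x) mod W'` for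
smooth local sections `h` of `W'`. -/
def kerSecondFund (cov : CovariantDerivative 𝓘(ℝ, E) E (TangentSpace 𝓘(ℝ, E) : M → Type _))
    (W' : FormSubset E M) : FormSubset E M := fun x ↦
  {w | ∃ (U : Set M) (h : Π x : M, BilinAt E x), x ∈ U ∧ IsLocalSection W' U h ∧ h x = w ∧
    ∀ v, covForm cov h x v ∈ W' x}

/-- The derived flag `W⁽⁰⁾ = 𝒮(V⁽⁰⁾)`, `W⁽ⁱ⁺¹⁾ = 𝒮(ker α_{W⁽ⁱ⁾})`. -/
def derivedFlag (cov : CovariantDerivative 𝓘(ℝ, E) E (TangentSpace 𝓘(ℝ, E) : M → Type _)) :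
    ℕ → FormSubset E M
  | 0 => sectionHull (flatForms cov)
  | i + 1 => sectionHull (kerSecondFund cov (derivedFlag cov i))

/-- The terminal subset of the (decreasing) derived flag: the intersection of its members, hence
equal to `W⁽ᵏ⁾` as soon as the flag is stationary from `k` on. -/
def maximalFlat (cov : CovariantDerivative 𝓘(ℝ, E) E (TangentSpace 𝓘(ℝ, E) : M → Type _)) :
    FormSubset E M := fun x ↦ ⋂ i, derivedFlag cov i x

/-- The connection is regular with `rank W̃ = n`: the terminal subset `W̃` of the derived flag in
the bundle of symmetric forms is a vector bundle of rank `n`. -/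
def IsRegularOfRank (cov : CovariantDerivative 𝓘(ℝ, E) E (TangentSpace 𝓘(ℝ, E) : M → Type _))
    (n : ℕ) : Prop :=
  IsVectorBundleOfRank (maximalFlat cov) n

/-- The connection is metric: some smooth Riemannian metric on `M` is parallel. -/
def IsMetricConnection
    (cov : CovariantDerivative 𝓘(ℝ, E) E (TangentSpace 𝓘(ℝ, E) : M → Type _)) : Prop :=
  ∃ g : ContMDiffRiemannianMetric 𝓘(ℝ, E) ∞ E (TangentSpace 𝓘(ℝ, E) : M → Type _),
    ∀ x v, covForm cov g.inner x v = 0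

end Connection

/-! ### Čech cohomology with coefficients in the constant sheaf of sections in `GL(n, ℝ)` -/

section Cech

universe u

variable {M : Type u} [TopologicalSpace M]

/-- An (indexed) open cover of `M`. -/
structure OpenCover (M : Type u) [TopologicalSpace M] : Type (u + 1) where
  ι : Type u
  U : ι → Opens M
  covers : ∀ x, ∃ α, x ∈ U α

/-- 0-cochains: locally constant maps `U_α → GL(n, ℝ)`. -/
abbrev Cochain0 (𝒰 : OpenCover M) (n : ℕ) : Type u :=
  ∀ α : 𝒰.ι, LocallyConstant (𝒰.U α) (GL (Fin n) ℝ)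

/-- 1-cochains: locally constant maps `U_α ∩ U_β → GL(n, ℝ)`. -/
abbrev Cochain1 (𝒰 : OpenCover M) (n : ℕ) : Type u :=
  ∀ α β : 𝒰.ι, LocallyConstant ↥(𝒰.U α ⊓ 𝒰.U β) (GL (Fin n) ℝ)

/-- `a` is a 1-cocycle: `a_{αγ}⁻¹ a_{αβ} a_{βγ} = 1` on triple intersections. -/
def IsCocycle {𝒰 : OpenCover M} {n : ℕ} (a : Cochain1 𝒰 n) : Prop :=
  ∀ (α β γ : 𝒰.ι) (x : M) (hα : x ∈ 𝒰.U α) (hβ : x ∈ 𝒰.U β) (hγ : x ∈ 𝒰.U γ),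
    (a α γ ⟨x, hα, hγ⟩)⁻¹ * a α β ⟨x, hα, hβ⟩ * a β γ ⟨x, hβ, hγ⟩ = 1

/-- `a ∼ a'` iff `a'_{αβ} = b_α⁻¹ a_{αβ} b_β` for some 0-cochain `b`. -/
def Cohomologous {𝒰 : OpenCover M} {n : ℕ} (a a' : Cochain1 𝒰 n) : Prop :=
  ∃ b : Cochain0 𝒰 n, ∀ (α β : 𝒰.ι) (x : M) (hα : x ∈ 𝒰.U α) (hβ : x ∈ 𝒰.U β),
    a' α β ⟨x, hα, hβ⟩ = (b α ⟨x, hα⟩)⁻¹ * a α β ⟨x, hα, hβ⟩ * b β ⟨x, hβ⟩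

/-- `ρ` exhibits `𝒱` as a refinement of `𝒰`. -/
def IsRefinement (𝒱 𝒰 : OpenCover M) (ρ : 𝒱.ι → 𝒰.ι) : Prop := ∀ α, 𝒱.U α ≤ 𝒰.U (ρ α)

/-- The image of a 1-cochain under a refinement. -/
def Cochain1.restrict {𝒱 𝒰 : OpenCover M} {ρ : 𝒱.ι → 𝒰.ι} (hρ : IsRefinement 𝒱 𝒰 ρ) {n : ℕ}
    (a : Cochain1 𝒰 n) : Cochain1 𝒱 n := fun α β ↦
  (a (ρ α) (ρ β)).comap
    ⟨fun x ↦ ⟨x.1, hρ α x.2.1, hρ β x.2.2⟩, continuous_subtype_val.subtype_mk _⟩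

/-- The pairs consisting of an open cover and a 1-cocycle on it. -/
structure CocycleOnCover (M : Type u) [TopologicalSpace M] (n : ℕ) : Type (u + 1) where
  cover : OpenCover M
  val : Cochain1 cover n
  isCocycle : IsCocycle val

/-- Two cocycles have the same image in the direct limit over all covers: they become cohomologous
on a common refinement. -/
def SameClass {n : ℕ} (a a' : CocycleOnCover M n) : Prop :=
  ∃ (𝒱 : OpenCover M) (ρ : 𝒱.ι → a.cover.ι) (ρ' : 𝒱.ι → a'.cover.ι)
    (hρ : IsRefinement 𝒱 a.cover ρ) (hρ' : IsRefinement 𝒱 a'.cover ρ'),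
    Cohomologous (a.val.restrict hρ) (a'.val.restrict hρ')

theorem IsCocycle.mul_eq {𝒰 : OpenCover M} {n : ℕ} {a : Cochain1 𝒰 n} (ha : IsCocycle a)
    (α β γ : 𝒰.ι) (x : M) (hα : x ∈ 𝒰.U α) (hβ : x ∈ 𝒰.U β) (hγ : x ∈ 𝒰.U γ) :
    a α β ⟨x, hα, hβ⟩ * a β γ ⟨x, hβ, hγ⟩ = a α γ ⟨x, hα, hγ⟩ := by
  have := ha α β γ x hα hβ hγ
  rw [mul_assoc, inv_mul_eq_one] at this
  exact this.symm

theorem sameClass_refl {n : ℕ} (a : CocycleOnCover M n) : SameClass a a :=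
  ⟨a.cover, id, id, fun _ ↦ le_rfl, fun _ ↦ le_rfl, fun _ ↦ 1, fun _ _ _ _ _ ↦ by simp⟩

theorem sameClass_symm {n : ℕ} {a a' : CocycleOnCover M n} (h : SameClass a a') :
    SameClass a' a := by
  obtain ⟨𝒱, ρ, ρ', hρ, hρ', b, hb⟩ := h
  refine ⟨𝒱, ρ', ρ, hρ', hρ, fun α ↦ (b α)⁻¹, fun α β x hα hβ ↦ ?_⟩
  rw [hb α β x hα hβ]
  simp [mul_assoc]

theorem sameClass_trans {n : ℕ} {a a' a'' : CocycleOnCover M n} (h : SameClass a a')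
    (h' : SameClass a' a'') : SameClass a a'' := by
  obtain ⟨𝒱, ρ, ρ', hρ, hρ', b, hb⟩ := h
  obtain ⟨𝒱', σ, σ', hσ, hσ', b', hb'⟩ := h'
  let 𝒲 : OpenCover M :=
    { ι := 𝒱.ι × 𝒱'.ι
      U := fun α ↦ 𝒱.U α.1 ⊓ 𝒱'.U α.2
      covers := fun x ↦ by
        obtain ⟨α, hα⟩ := 𝒱.covers x
        obtain ⟨β, hβ⟩ := 𝒱'.covers x
        exact ⟨(α, β), hα, hβ⟩ }
  refine ⟨𝒲, fun α ↦ ρ α.1, fun α ↦ σ' α.2, fun α ↦ inf_le_left.trans (hρ α.1),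
    fun α ↦ inf_le_right.trans (hσ' α.2), ?_⟩
  refine ⟨fun α ↦
    (b α.1).comap ⟨fun x ↦ ⟨x.1, x.2.1⟩, continuous_subtype_val.subtype_mk _⟩ *
    (a'.val (ρ' α.1) (σ α.2)).comap ⟨fun x ↦ ⟨x.1, hρ' _ x.2.1, hσ _ x.2.2⟩,
      continuous_subtype_val.subtype_mk _⟩ *
    (b' α.2).comap ⟨fun x ↦ ⟨x.1, x.2.2⟩, continuous_subtype_val.subtype_mk _⟩, ?_⟩
  intro α β x hα hβ
  have e1 := hb α.1 β.1 x hα.1 hβ.1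
  have e2 := hb' α.2 β.2 x hα.2 hβ.2
  have c1 := a'.isCocycle.mul_eq (ρ' α.1) (ρ' β.1) (σ β.2) x (hρ' _ hα.1) (hρ' _ hβ.1)
    (hσ _ hβ.2)
  have c2 := a'.isCocycle.mul_eq (ρ' α.1) (σ α.2) (σ β.2) x (hρ' _ hα.1) (hσ _ hα.2)
    (hσ _ hβ.2)
  simp only [Cochain1.restrict, LocallyConstant.coe_comap, ContinuousMap.coe_mk,
    Function.comp_apply, LocallyConstant.mul_apply] at e1 e2 ⊢
  rw [e2]
  have e3 := c1.trans c2.symm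
  rw [e1] at e3
  rw [eq_comm, ← inv_mul_eq_iff_eq_mul] at e3
  rw [← e3]
  group

/-- The direct limit defining `H¹(M, 𝒢_n)`. -/
instance cocycleSetoid (M : Type u) [TopologicalSpace M] (n : ℕ) : Setoid (CocycleOnCover M n) where
  r := SameClass
  iseqv := ⟨sameClass_refl, sameClass_symm, sameClass_trans⟩

/-- The first cohomology set `H¹(M, 𝒢_n)` of the constant sheaf of sections in `GL(n, ℝ)`. -/
def H1 (M : Type u) [TopologicalSpace M] (n : ℕ) : Type (u + 1) := Quotient (cocycleSetoid M n)

/-- The image of a 1-cochain under a homomorphism of coefficient groups. -/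
def Cochain1.map {𝒰 : OpenCover M} {m n : ℕ} (f : GL (Fin m) ℝ →* GL (Fin n) ℝ)
    (a : Cochain1 𝒰 m) : Cochain1 𝒰 n := fun α β ↦ (a α β).map f

/-- The map on cohomology induced by a homomorphism of coefficient groups. -/
def H1.map {m n : ℕ} (f : GL (Fin m) ℝ →* GL (Fin n) ℝ) : H1 M m → H1 M n :=
  Quotient.map
    (fun a ↦ ⟨a.cover, a.val.map f, fun α β γ x hα hβ hγ ↦ by
      have := congrArg f (a.isCocycle α β γ x hα hβ hγ)
      simpa [Cochain1.map] using this⟩)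
    (by
      rintro a a' ⟨𝒱, ρ, ρ', hρ, hρ', b, hb⟩
      refine ⟨𝒱, ρ, ρ', hρ, hρ', fun α ↦ (b α).map f, fun α β x hα hβ ↦ ?_⟩
      have := congrArg f (hb α β x hα hβ)
      simpa [Cochain1.map, Cochain1.restrict] using this)

/-- The matrix `diag(I_{n-m}, A)`, as a homomorphism in `A`. -/
def blockEmbed {m n : ℕ} (h : m ≤ n) :
    Matrix (Fin m) (Fin m) ℝ →* Matrix (Fin n) (Fin n) ℝ where
  toFun A := Matrix.reindex (finSumFinEquiv.trans (finCongr (Nat.sub_add_cancel h)))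
    (finSumFinEquiv.trans (finCongr (Nat.sub_add_cancel h)))
    (Matrix.fromBlocks (1 : Matrix (Fin (n - m)) (Fin (n - m)) ℝ) 0 0 A)
  map_one' := by
    rw [Matrix.fromBlocks_one, Matrix.reindex_apply, Matrix.submatrix_one_equiv]
  map_mul' A B := by
    rw [Matrix.reindex_apply, Matrix.reindex_apply, Matrix.reindex_apply,
      Matrix.submatrix_mul_equiv, Matrix.fromBlocks_multiply]
    simp

/-- The embedding `ι : GL(m, ℝ) → GL(n, ℝ)`, `A ↦ diag(I_{n-m}, A)`. -/
def glEmbed {m n : ℕ} (h : m ≤ n) : GL (Fin m) ℝ →* GL (Fin n) ℝ := Units.map (blockEmbed h)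

/-- `σ` lies in `H¹_m`, the image of `H¹(M, 𝒢_m)` in `H¹(M, 𝒢_n)`. -/
def H1.InImage {n : ℕ} (m : ℕ) (σ : H1 M n) : Prop :=
  ∃ (h : m ≤ n) (c : H1 M m), H1.map (glEmbed h) c = σ

/-- The rank of `σ ∈ H¹(M, 𝒢_n)`: `n - m`, with `m` least such that `σ ∈ H¹_m`. -/
def H1.rank {n : ℕ} (σ : H1 M n) : ℕ := n - sInf {m | H1.InImage m σ}

end Cech

/-! ### The cohomology class of `(W̃, ∇)` and the subbundle `W_∇` -/

section WNabla

universe u v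

variable {E : Type v} [NormedAddCommGroup E] [NormedSpace ℝ E] [FiniteDimensional ℝ E]
  {M : Type u} [TopologicalSpace M] [ChartedSpace E M] [IsManifold 𝓘(ℝ, E) ∞ M]

/-- An open cover of `M` with, over each of its members, a basis `h_{α1}, …, h_{αn}` of parallel
sections of `W̃`, and the resulting transition cochain:
`h_{αi} = ∑ j, (t_{αβ})_{ij} h_{βj}` on `U_α ∩ U_β`. -/
structure ParallelFrames
    (cov : CovariantDerivative 𝓘(ℝ, E) E (TangentSpace 𝓘(ℝ, E) : M → Type _)) (n : ℕ) where
  cover : OpenCover M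
  h : cover.ι → Fin n → Π x : M, BilinAt E x
  isSection : ∀ α i, IsLocalSection (maximalFlat cov) (cover.U α) (h α i)
  parallel : ∀ α i, ∀ x ∈ cover.U α, ∀ v, covForm cov (h α i) x v = 0
  basis : ∀ α, ∀ x ∈ cover.U α, IsFibreBasis (maximalFlat cov) (h α) x
  t : Cochain1 cover n
  transition : ∀ α β (x : M) (hα : x ∈ cover.U α) (hβ : x ∈ cover.U β) (i : Fin n),
    h α i x = ∑ j, (t α β ⟨x, hα, hβ⟩ : Matrix (Fin n) (Fin n) ℝ) i j • h β j x

namespace ParallelFrames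

variable {cov : CovariantDerivative 𝓘(ℝ, E) E (TangentSpace 𝓘(ℝ, E) : M → Type _)} {n : ℕ}

theorem isCocycle (F : ParallelFrames cov n) : IsCocycle F.t := by
  intro α β γ x hα hβ hγ
  rw [mul_assoc, inv_mul_eq_one]
  ext i j
  have h1 := F.transition α γ x hα hγ i
  rw [F.transition α β x hα hβ i] at h1
  simp_rw [F.transition β γ x hβ hγ, Finset.smul_sum, smul_smul] at h1
  rw [Finset.sum_comm] at h1
  simp_rw [← Finset.sum_smul] at h1
  have h2 := (F.basis γ x hγ).1
  rw [Fintype.linearIndependent_iffₛ] at h2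
  have h3 := h2 _ _ h1 j
  rw [← h3, Units.val_mul, Matrix.mul_apply]

/-- The class `[t] ∈ H¹(M, 𝒢_n)` of the transition cocycle. -/
def cohomologyClass (F : ParallelFrames cov n) : H1 M n :=
  Quotient.mk (cocycleSetoid M n) ⟨F.cover, F.t, F.isCocycle⟩

/-- The transition cocycle has the form `t = ι(a)` with `a ∈ C¹(𝒰, 𝒢_{n-m})`, so that the first
`m` members of the bases agree on overlaps. -/
def HasRankForm (F : ParallelFrames cov n) (m : ℕ) : Prop :=
  ∃ a : Cochain1 F.cover (n - m), F.t = a.map (glEmbed (Nat.sub_le n m))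

/-- The subbundle of `W̃` generated by the `h_{αi}` with `1 ≤ i ≤ m`; this is `W_∇` if `m` is the
rank of the class `τ` of `(W̃, ∇)` and the transition cocycle has the form `ι(a)`. -/
def subbundle (F : ParallelFrames cov n) (m : ℕ) (x : M) : Submodule ℝ (BilinAt E x) :=
  Submodule.span ℝ {w | ∃ α, x ∈ F.cover.U α ∧ ∃ i : Fin n, i.val < m ∧ F.h α i x = w}

end ParallelFrames

end WNabla

end

/-! The first point is that W̃ is a flat bundle. The curvature vanishes on it because W̃ lies in
V⁽⁰⁾. That ∇ preserves it is less direct: in each fibre the flag stabilises by finite dimension, but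
at a step that may vary with the point. Since W̃ is a subbundle, hence closed, the set of points
where step i is already terminal is closed. These sets cover M, so by Baire their interiors have
dense union. On such an interior W⁽ⁱ⁾ = W̃, and the kernel condition says that ∇ maps sections of W̃
into W̃; closedness of W̃ extends this to all of M (`dense_iUnion_interior_terminalSet`,
`covForm_mem_maximalFlat`). Local parallel frames of W̃ are then solutions of a flat linear system
Df = -A f, which is solved from scratch (`exists_solution_of_formCurv_eq_zero`,
`exists_local_parallel_frame`). Conversely, every parallel field of symmetric forms takes its values
in W̃ (`IsParallelOn.mem_maximalFlat`).

Two parallel frames differ by a locally constant matrix. Hence the transition cocycles of any two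
families of frames are cohomologous on a common refinement, and this gives τ. Changing the frames by
a 0-cochain realises any representative of τ after refinement, in particular one of the form ι(a)
with a of the least size k = n - m.

If W_∇ contains a positive definite w, then w extends to a global parallel field, because the first
m frame members agree on overlaps. Parallel transport keeps the field positive definite, M being
connected.

Now let g be a parallel metric. It is a section of W̃, and since the cocycle ι(a) is block diagonal,
the component q of g along the last k frame members is again a global parallel field. If g were
nowhere in W_∇, then q would vanish nowhere. Its coefficients form locally constant row vectors c
with c_α a_αβ = c_β. The metric induces the parallel scalar product tr(g⁻¹ q g⁻¹ w) on forms, and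
pairing q with the last k frame members gives column vectors l with a_αβ l_β = l_α. Moreover c · l
is the squared length of q, hence positive. So a preserves the line of l and its complement, the
kernel of c, and is cohomologous to a cocycle in GL(k - 1) (`exists_map_eq_of_fixed`). This
contradicts the minimality of k (`exists_mem_subbundle_of_isParallelOn`). -/

noncomputable section

set_option maxSynthPendingDepth 3

/-! ### Flat linear systems Df = -A f on a ball, by Picard iteration along rays -/

section FlatSystems

open Metric MeasureTheory intervalIntegral

variable {E : Type*} [NormedAddCommGroup E] [NormedSpace ℝ E] [FiniteDimensional ℝ E]
  {F : Type*} [NormedAddCommGroup F] [NormedSpace ℝ F]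
  {X : Type*} [NormedAddCommGroup X] [NormedSpace ℝ X]

omit [FiniteDimensional ℝ E] in
theorem smul_mem_ball_zero {r t : ℝ} {y : E} (hy : y ∈ ball (0 : E) r) (ht : t ∈ Icc (0 : ℝ) 1) :
    t • y ∈ ball (0 : E) r := by
  rw [mem_ball_zero_iff] at hy ⊢
  rw [norm_smul, Real.norm_of_nonneg ht.1]
  exact (mul_le_of_le_one_left (norm_nonneg _) ht.2).trans_lt hy

omit [NormedSpace ℝ X] in
theorem exists_nhds_bound_of_continuousOn {r : ℝ} {G : E → ℝ → X}
    (hG : ContinuousOn (fun p : E × ℝ ↦ G p.1 p.2) (ball 0 r ×ˢ Icc 0 1)) {y : E}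
    (hy : y ∈ ball (0 : E) r) :
    ∃ s ∈ 𝓝 y, s ⊆ ball 0 r ∧ ∃ C, ∀ y' ∈ s, ∀ t ∈ Icc (0 : ℝ) 1, ‖G y' t‖ ≤ C := by
  have := FiniteDimensional.proper ℝ E
  obtain ⟨ε, hε, hs⟩ := Metric.nhds_basis_closedBall.mem_iff.1 (isOpen_ball.mem_nhds hy)
  refine ⟨closedBall y ε, closedBall_mem_nhds y hε, hs, ?_⟩
  obtain ⟨C, hC⟩ := ((isCompact_closedBall y ε).prod (isCompact_Icc (a := (0 : ℝ)) (b := 1))).exists_bound_of_continuousOn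
    (hG.mono (prod_mono hs subset_rfl))
  exact ⟨C, fun y' hy' t ht ↦ hC (y', t) ⟨hy', ht⟩⟩

omit [NormedSpace ℝ E] [FiniteDimensional ℝ E] [NormedSpace ℝ X] in
theorem continuousOn_slice {r : ℝ} {G : E → ℝ → X}
    (hG : ContinuousOn (fun p : E × ℝ ↦ G p.1 p.2) (ball 0 r ×ˢ Icc 0 1)) {y : E}
    (hy : y ∈ ball (0 : E) r) : ContinuousOn (G y) (Icc 0 1) :=
  hG.comp (f := fun t : ℝ ↦ (y, t)) (by fun_prop) fun _ ht ↦ ⟨hy, ht⟩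

omit [NormedSpace ℝ E] [FiniteDimensional ℝ E] [NormedSpace ℝ X] in
theorem intervalIntegrable_slice {r : ℝ} {G : E → ℝ → X}
    (hG : ContinuousOn (fun p : E × ℝ ↦ G p.1 p.2) (ball 0 r ×ˢ Icc 0 1)) {y : E}
    (hy : y ∈ ball (0 : E) r) : IntervalIntegrable (G y) volume 0 1 :=
  (continuousOn_slice hG hy).intervalIntegrable_of_Icc zero_le_one

theorem continuousOn_integral_unitInterval {r : ℝ} {G : E → ℝ → X}
    (hG : ContinuousOn (fun p : E × ℝ ↦ G p.1 p.2) (ball 0 r ×ˢ Icc 0 1)) :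
    ContinuousOn (fun y ↦ ∫ t in (0 : ℝ)..1, G y t) (ball 0 r) := by
  intro y hy
  refine ContinuousAt.continuousWithinAt ?_
  obtain ⟨s, hs, hsr, C, hC⟩ := exists_nhds_bound_of_continuousOn hG hy
  refine intervalIntegral.continuousAt_of_dominated_interval (bound := fun _ ↦ C) ?_ ?_ (by simp) ?_
  · filter_upwards [hs] with y' hy'
    exact (intervalIntegrable_slice hG (hsr hy')).def'.aestronglyMeasurable
  · filter_upwards [hs] with y' hy'
    refine Filter.Eventually.of_forall fun t ht ↦ ?_
    rw [uIoc_of_le zero_le_one] at ht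
    exact hC y' hy' t ⟨ht.1.le, ht.2⟩
  · refine Filter.Eventually.of_forall fun t ht ↦ ?_
    rw [uIoc_of_le zero_le_one] at ht
    have : ContinuousOn (fun y' ↦ G y' t) (ball 0 r) :=
      hG.comp (f := fun y' : E ↦ (y', t)) (by fun_prop) fun _ h ↦ ⟨h, ht.1.le, ht.2⟩
    exact this.continuousAt (isOpen_ball.mem_nhds hy)

omit [FiniteDimensional ℝ E] [NormedSpace ℝ X] in
theorem continuousOn_comp_smul {r : ℝ} {g : E → X} (hg : ContinuousOn g (ball 0 r)) :
    ContinuousOn (fun p : E × ℝ ↦ g (p.2 • p.1)) (ball 0 r ×ˢ Icc 0 1) :=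
  hg.comp (by fun_prop) fun _ hp ↦ smul_mem_ball_zero hp.1 hp.2

variable [CompleteSpace F]

/-- The failure of the radial integral of a one-form to be a primitive of it. -/
def radialDefect (η' : E → E →L[ℝ] E →L[ℝ] F) (y : E) : E →L[ℝ] F :=
  ∫ t in (0 : ℝ)..1, t • ((η' (t • y)).flip y - η' (t • y) y)

omit [FiniteDimensional ℝ E] [CompleteSpace F] in
theorem continuousOn_radialDefect_integrand {r : ℝ} {η' : E → E →L[ℝ] E →L[ℝ] F}
    (hη' : ContinuousOn η' (ball 0 r)) :
    ContinuousOn (fun p : E × ℝ ↦ p.2 • ((η' (p.2 • p.1)).flip p.1 - η' (p.2 • p.1) p.1))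
      (ball 0 r ×ˢ Icc 0 1) := by
  have h1 := continuousOn_comp_smul (g := η') hη'
  have h2 : ContinuousOn (fun p : E × ℝ ↦ (η' (p.2 • p.1)).flip) (ball 0 r ×ˢ Icc 0 1) :=
    (ContinuousLinearMap.flipₗᵢ ℝ E E F).continuous.comp_continuousOn h1
  exact continuousOn_snd.smul ((h2.clm_apply continuousOn_fst).sub (h1.clm_apply continuousOn_fst))

/-- Differentiation under the integral sign gives the integrand η(ty) + t η'(ty)(·)(y), while t ↦ t
η(ty) has derivative η(ty) + t η'(ty)(y) and total increment η(y). The two integrands differ by t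
dη(·, y), whose integral is the defect. -/
theorem hasFDerivAt_radial_integral {r : ℝ} {η : E → E →L[ℝ] F} {η' : E → E →L[ℝ] E →L[ℝ] F}
    (hη : ∀ z ∈ ball (0 : E) r, HasFDerivAt η (η' z) z) (hη' : ContinuousOn η' (ball 0 r))
    {y : E} (hy : y ∈ ball (0 : E) r) :
    HasFDerivAt (fun y ↦ ∫ t in (0 : ℝ)..1, η (t • y) y) (η y + radialDefect η' y) y := by
  have hηc : ContinuousOn η (ball 0 r) := fun z hz ↦ (hη z hz).continuousAt.continuousWithinAt
  have h1 := continuousOn_comp_smul (g := η) hηc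
  have h2 := continuousOn_comp_smul (g := η') hη'
  have h2' : ContinuousOn (fun p : E × ℝ ↦ (η' (p.2 • p.1)).flip) (ball 0 r ×ˢ Icc 0 1) :=
    (ContinuousLinearMap.flipₗᵢ ℝ E E F).continuous.comp_continuousOn h2
  have hG : ContinuousOn (fun p : E × ℝ ↦ η (p.2 • p.1) p.1) (ball 0 r ×ˢ Icc 0 1) :=
    h1.clm_apply continuousOn_fst
  have hG' : ContinuousOn (fun p : E × ℝ ↦ η (p.2 • p.1) + p.2 • (η' (p.2 • p.1)).flip p.1)
      (ball 0 r ×ˢ Icc 0 1) :=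
    h1.add (continuousOn_snd.smul (h2'.clm_apply continuousOn_fst))
  have hH : ContinuousOn (fun p : E × ℝ ↦ η (p.2 • p.1) + p.2 • η' (p.2 • p.1) p.1)
      (ball 0 r ×ˢ Icc 0 1) :=
    h1.add (continuousOn_snd.smul (h2.clm_apply continuousOn_fst))
  obtain ⟨s, hs, hsr, C, hC⟩ := exists_nhds_bound_of_continuousOn
    (G := fun y t ↦ η (t • y) + t • (η' (t • y)).flip y) hG' hy
  have main := intervalIntegral.hasFDerivAt_integral_of_dominated_of_fderiv_le (μ := volume)
    (F := fun y t ↦ η (t • y) y) (F' := fun y t ↦ η (t • y) + t • (η' (t • y)).flip y)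
    (bound := fun _ ↦ C) (a := 0) (b := 1) hs ?_
    (intervalIntegrable_slice (G := fun y t ↦ η (t • y) y) hG hy)
    (intervalIntegrable_slice (G := fun y t ↦ η (t • y) + t • (η' (t • y)).flip y)
      hG' hy).def'.aestronglyMeasurable ?_ (by simp) ?_
  · convert main using 1
    have ftc : η y = ∫ t in (0 : ℝ)..1, (η (t • y) + t • η' (t • y) y) := by
      have hd : ∀ t ∈ uIcc (0 : ℝ) 1, HasDerivAt (fun t : ℝ ↦ t • η (t • y))
          (η (t • y) + t • η' (t • y) y) t := by
        intro t ht
        rw [uIcc_of_le zero_le_one] at ht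
        have e1 : HasDerivAt (fun t : ℝ ↦ t • y) y t := by
          simpa using (hasDerivAt_id t).smul_const y
        have e2 := (hη _ (smul_mem_ball_zero hy ht)).comp_hasDerivAt t e1
        have e3 : HasDerivAt (fun t : ℝ ↦ t • η (t • y))
            (t • η' (t • y) y + (1 : ℝ) • η (t • y)) t := (hasDerivAt_id t).smul e2
        exact e3.congr_deriv (by rw [one_smul, add_comm])
      rw [integral_eq_sub_of_hasDerivAt hd
        (intervalIntegrable_slice (G := fun y t ↦ η (t • y) + t • η' (t • y) y) hH hy)]
      simp
    rw [radialDefect]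
    nth_rw 1 [ftc]
    rw [← intervalIntegral.integral_add
      (intervalIntegrable_slice (G := fun y t ↦ η (t • y) + t • η' (t • y) y) hH hy)
      (intervalIntegrable_slice (G := fun y t ↦ t • ((η' (t • y)).flip y - η' (t • y) y))
        (continuousOn_radialDefect_integrand hη') hy)]
    refine integral_congr fun t _ ↦ ?_
    simp only [smul_sub]
    abel
  · filter_upwards [hs] with y' hy'
    exact (intervalIntegrable_slice (G := fun y t ↦ η (t • y) y) hG
      (hsr hy')).def'.aestronglyMeasurable
  · refine Filter.Eventually.of_forall fun t ht y' hy' ↦ ?_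
    rw [uIoc_of_le zero_le_one] at ht
    exact hC y' hy' t ⟨ht.1.le, ht.2⟩
  · refine Filter.Eventually.of_forall fun t ht y' hy' ↦ ?_
    rw [uIoc_of_le zero_le_one] at ht
    have e1 : HasFDerivAt (fun y : E ↦ t • y) (t • ContinuousLinearMap.id ℝ E) y' :=
      (hasFDerivAt_id y').const_smul t
    have e2 := (hη _ (smul_mem_ball_zero (hsr hy') ⟨ht.1.le, ht.2⟩)).comp y' e1
    have e3 := e2.clm_apply (hasFDerivAt_id y')
    exact e3.congr_fderiv (by ext v; simp)

omit [FiniteDimensional ℝ E] in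
theorem contDiffOn_one_of_hasFDerivAt {U : Set E} (hU : IsOpen U) {f : E → X} {f' : E → E →L[ℝ] X}
    (hf : ∀ z ∈ U, HasFDerivAt f (f' z) z) (hf' : ContinuousOn f' U) : ContDiffOn ℝ 1 f U := by
  rw [show (1 : ℕ∞ω) = 0 + 1 by simp, contDiffOn_succ_iff_fderiv_of_isOpen hU]
  refine ⟨fun z hz ↦ (hf z hz).differentiableAt.differentiableWithinAt, by simp, ?_⟩
  rw [contDiffOn_zero]
  exact hf'.congr fun z hz ↦ (hf z hz).fderiv

/-- Exchanging the arguments of a bilinear map, as a continuous linear map. -/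
def flipCLM (E F : Type*) [NormedAddCommGroup E] [NormedSpace ℝ E] [NormedAddCommGroup F]
    [NormedSpace ℝ F] : (E →L[ℝ] F →L[ℝ] F) →L[ℝ] F →L[ℝ] E →L[ℝ] F :=
  ((ContinuousLinearMap.flipₗᵢ ℝ E F F).toContinuousLinearEquiv :
    (E →L[ℝ] F →L[ℝ] F) →L[ℝ] F →L[ℝ] E →L[ℝ] F)

/-- The one-form `v ↦ A(v) f`. -/
def applyForm (A : E → E →L[ℝ] F →L[ℝ] F) (f : E → F) (z : E) : E →L[ℝ] F := (A z).flip (f z)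

/-- The Picard iterates, along rays, for the equation `Df = -A f`. -/
def picardIter (A : E → E →L[ℝ] F →L[ℝ] F) (w : F) : ℕ → E → F
  | 0 => fun _ ↦ w
  | j + 1 => fun y ↦ w - ∫ t in (0 : ℝ)..1, applyForm A (picardIter A w j) (t • y) y

/-- The curvature of the connection `D + A`. -/
def formCurv (A : E → E →L[ℝ] F →L[ℝ] F) (z u v : E) : F →L[ℝ] F :=
  fderiv ℝ A z u v - fderiv ℝ A z v u + (A z u) ∘L (A z v) - (A z v) ∘L (A z u)

variable {A : E → E →L[ℝ] F →L[ℝ] F} {r C : ℝ}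

omit [FiniteDimensional ℝ E] [CompleteSpace F] in
theorem ContDiffOn.applyForm {n : ℕ∞ω} {U : Set E} (hA : ContDiffOn ℝ n A U) {f : E → F}
    (hf : ContDiffOn ℝ n f U) : ContDiffOn ℝ n (applyForm A f) U :=
  have h : ContDiffOn ℝ n (fun z ↦ (A z).flip) U :=
    have hc : ContDiff ℝ n (flipCLM E F) := ContinuousLinearMap.contDiff _
    hc.comp_contDiffOn hA
  h.clm_apply hf

omit [FiniteDimensional ℝ E] [CompleteSpace F] in
theorem fderiv_applyForm {f : E → F} {z : E} (hA : DifferentiableAt ℝ A z)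
    (hf : DifferentiableAt ℝ f z) (u v : E) :
    fderiv ℝ (applyForm A f) z u v = fderiv ℝ A z u v (f z) + A z v (fderiv ℝ f z u) := by
  have e1 : HasFDerivAt (fun z ↦ (A z).flip) (flipCLM E F ∘L fderiv ℝ A z) z :=
    have hc : HasFDerivAt (flipCLM E F) (flipCLM E F) (A z) := ContinuousLinearMap.hasFDerivAt _
    have hA' : HasFDerivAt A (fderiv ℝ A z) z := hA.hasFDerivAt
    HasFDerivAt.comp (F := E →L[ℝ] F →L[ℝ] F) (G := F →L[ℝ] E →L[ℝ] F) z hc hA'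
  have e2 := e1.clm_apply hf.hasFDerivAt
  have : fderiv ℝ (applyForm A f) z = _ := e2.fderiv
  rw [this]
  simp [add_comm, flipCLM]

/-- The derivative formula for the next iterate needs the present one to be C¹, and it exhibits a
continuous derivative of the next; so regularity follows by induction and the formula with it. -/
theorem contDiffOn_picardIter (hA : ContDiffOn ℝ 1 A (ball 0 r)) (w : F) (j : ℕ) :
    ContDiffOn ℝ 1 (picardIter A w j) (ball 0 r) ∧ ∀ y ∈ ball (0 : E) r,
      fderiv ℝ (picardIter A w (j + 1)) y = -(applyForm A (picardIter A w j) y +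
        radialDefect (fderiv ℝ (applyForm A (picardIter A w j))) y) := by
  have key : ∀ j, ContDiffOn ℝ 1 (picardIter A w j) (ball 0 r) →
      ∀ y ∈ ball (0 : E) r, HasFDerivAt (picardIter A w (j + 1))
        (-(applyForm A (picardIter A w j) y +
          radialDefect (fderiv ℝ (applyForm A (picardIter A w j))) y)) y := by
    intro j hj y hy
    have h1 := hA.applyForm hj
    have h2 := hasFDerivAt_radial_integral (η' := fderiv ℝ (applyForm A (picardIter A w j)))
      (fun z hz ↦ ((h1.differentiableOn one_ne_zero).differentiableAt
        (isOpen_ball.mem_nhds hz)).hasFDerivAt)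
      (h1.continuousOn_fderiv_of_isOpen isOpen_ball le_rfl) hy
    exact h2.const_sub w
  have hC : ∀ j, ContDiffOn ℝ 1 (picardIter A w j) (ball 0 r) := by
    intro j
    induction j with
    | zero => exact contDiffOn_const
    | succ j ih =>
      have h1 := hA.applyForm ih
      refine contDiffOn_one_of_hasFDerivAt isOpen_ball (key j ih) (h1.continuousOn.add ?_).neg
      exact continuousOn_integral_unitInterval (continuousOn_radialDefect_integrand
        (h1.continuousOn_fderiv_of_isOpen isOpen_ball le_rfl))
  exact ⟨hC j, fun y hy ↦ (key j (hC j) y hy).fderiv⟩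

omit [FiniteDimensional ℝ E] [CompleteSpace F] in
theorem norm_applyForm_le {f : E → F} {z : E} (hA : ‖A z‖ ≤ C) : ‖applyForm A f z‖ ≤ C * ‖f z‖ := by
  refine ((A z).flip.le_opNorm _).trans ?_
  rw [ContinuousLinearMap.opNorm_flip]
  gcongr

omit [FiniteDimensional ℝ E] [CompleteSpace F] in
-- Put η = A f and k = Df + A f. Flatness removes every term of dη except dη(v, y) = A(y) k(v) -
-- A(v) k(y). So the defect is controlled by the failure of f to be a solution, with the small
-- factor 2Cr.
theorem norm_radialDefect_applyForm_le {f : E → F} {y : E} {κ : ℝ}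
    (hA : ∀ z ∈ ball (0 : E) r, DifferentiableAt ℝ A z) (hC : ∀ z ∈ ball (0 : E) r, ‖A z‖ ≤ C)
    (hflat : ∀ z ∈ ball (0 : E) r, ∀ u v, formCurv A z u v = 0)
    (hf : ∀ z ∈ ball (0 : E) r, DifferentiableAt ℝ f z)
    (hκ : ∀ z ∈ ball (0 : E) r, ‖fderiv ℝ f z + applyForm A f z‖ ≤ κ)
    (hy : y ∈ ball (0 : E) r) :
    ‖radialDefect (fderiv ℝ (applyForm A f)) y‖ ≤ 2 * (C * r) * κ := by
  have h0 := hκ y hy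
  have h0' := hC y hy
  have hκ0 : 0 ≤ κ := (norm_nonneg _).trans h0
  have hC0 : 0 ≤ C := (norm_nonneg (A y)).trans h0'
  have hyr : ‖y‖ ≤ r := (mem_ball_zero_iff.1 hy).le
  have hr0 : 0 ≤ r := (norm_nonneg _).trans hyr
  refine (intervalIntegral.norm_integral_le_of_norm_le_const (C := 2 * (C * r) * κ) fun t ht ↦ ?_).trans (by simp)
  rw [uIoc_of_le zero_le_one] at ht
  have hz := smul_mem_ball_zero hy ⟨ht.1.le, ht.2⟩
  set z := t • y
  rw [norm_smul, Real.norm_of_nonneg ht.1.le]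
  refine (mul_le_of_le_one_left (norm_nonneg _) ht.2).trans ?_
  refine ContinuousLinearMap.opNorm_le_bound _ (by positivity) fun v ↦ ?_
  set k := fderiv ℝ f z + applyForm A f z with hk
  have e : ((fderiv ℝ (applyForm A f) z).flip y - fderiv ℝ (applyForm A f) z y) v =
      A z y (k v) - A z v (k y) := by
    have := congrArg (fun L : F →L[ℝ] F ↦ L (f z)) (hflat z hz v y)
    simp only [formCurv, _root_.add_apply, _root_.sub_apply,
      ContinuousLinearMap.comp_apply, _root_.zero_apply] at this
    simp only [_root_.sub_apply, ContinuousLinearMap.flip_apply,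
      fderiv_applyForm (hA z hz) (hf z hz), hk, _root_.add_apply, applyForm, map_add]
    linear_combination (norm := module) this
  rw [e]
  have hkv : ∀ v, ‖k v‖ ≤ κ * ‖v‖ := fun v ↦ (k.le_opNorm v).trans (by gcongr; exact hκ z hz)
  have hAv : ∀ v x, ‖A z v x‖ ≤ C * ‖v‖ * ‖x‖ := fun v x ↦
    ((A z).le_opNorm₂ v x).trans (by gcongr; exact hC z hz)
  calc ‖A z y (k v) - A z v (k y)‖ ≤ ‖A z y (k v)‖ + ‖A z v (k y)‖ := norm_sub_le _ _
    _ ≤ C * ‖y‖ * (κ * ‖v‖) + C * ‖v‖ * (κ * ‖y‖) := by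
        gcongr
        · exact (hAv _ _).trans (by gcongr; exact hkv v)
        · exact (hAv _ _).trans (by gcongr; exact hkv y)
    _ = 2 * (C * ‖y‖) * κ * ‖v‖ := by ring
    _ ≤ 2 * (C * r) * κ * ‖v‖ := by gcongr

/-- Each step of the linear iteration contracts by Cr ≤ 1/8; the ratio 1/4 is enough for what
follows. -/
theorem norm_picardIter_sub_le (hA : ContDiffOn ℝ 1 A (ball 0 r))
    (hC : ∀ z ∈ ball (0 : E) r, ‖A z‖ ≤ C) (hCr : C * r ≤ 1 / 8) (w : F) (j : ℕ) :
    ∀ z ∈ ball (0 : E) r, ‖picardIter A w (j + 1) z - picardIter A w j z‖ ≤ ‖w‖ * (1 / 4) ^ j := by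
  have step : ∀ (f : E → F) (K : ℝ), (∀ z ∈ ball (0 : E) r, ‖f z‖ ≤ K) → ∀ z ∈ ball (0 : E) r,
      ‖∫ t in (0 : ℝ)..1, applyForm A f (t • z) z‖ ≤ K * (1 / 4) := by
    intro f K hf z hz
    have hK : 0 ≤ K := (norm_nonneg _).trans (hf z hz)
    refine (intervalIntegral.norm_integral_le_of_norm_le_const (C := K * (1 / 4)) fun t ht ↦ ?_).trans (by simp)
    rw [uIoc_of_le zero_le_one] at ht
    have htz := smul_mem_ball_zero hz ⟨ht.1.le, ht.2⟩
    have hC0 : 0 ≤ C := (norm_nonneg (A z)).trans (hC _ hz)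
    have hzr : ‖z‖ ≤ r := (mem_ball_zero_iff.1 hz).le
    calc ‖applyForm A f (t • z) z‖ ≤ ‖applyForm A f (t • z)‖ * ‖z‖ :=
          ContinuousLinearMap.le_opNorm _ _
      _ ≤ (C * K) * r := by
          gcongr
          exact (norm_applyForm_le (hC _ htz)).trans (by gcongr; exact hf _ htz)
      _ = K * (C * r) := by ring
      _ ≤ K * (1 / 4) := by gcongr; linarith
  induction j with
  | zero =>
    intro z hz
    have := step (picardIter A w 0) ‖w‖ (fun _ _ ↦ le_rfl) z hz
    simp only [picardIter, pow_zero, mul_one] at this ⊢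
    rw [sub_sub_cancel_left, norm_neg]
    exact this.trans (by nlinarith [norm_nonneg w])
  | succ j ih =>
    intro z hz
    have := step (fun z ↦ picardIter A w (j + 1) z - picardIter A w j z) _ ih z hz
    rw [pow_succ, ← mul_assoc]
    refine le_trans (le_of_eq ?_) this
    have hint : ∀ j, IntervalIntegrable (fun t : ℝ ↦ applyForm A (picardIter A w j) (t • z) z)
        volume 0 1 := fun j ↦
      intervalIntegrable_slice (G := fun z t ↦ applyForm A (picardIter A w j) (t • z) z)
        ((continuousOn_comp_smul (hA.applyForm (contDiffOn_picardIter hA w j).1).continuousOn).clm_apply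
          continuousOn_fst) hz
    have e : ∀ j, picardIter A w (j + 1) z =
      w - ∫ t in (0 : ℝ)..1, applyForm A (picardIter A w j) (t • z) z := fun _ ↦ rfl
    rw [e (j + 1), e j, sub_sub_sub_cancel_left, ← intervalIntegral.integral_sub (hint _) (hint _),
      ← norm_neg, ← intervalIntegral.integral_neg]
    congr 1
    refine integral_congr fun t _ ↦ ?_
    simp [applyForm]

/-- One has Df_{j+1} + A f_{j+1} = A(f_{j+1} - f_j) - defect_j. As 2Cr ≤ 1/4, bounds κ_j for the
left side may satisfy κ_{j+1} = C‖w‖ 2⁻ʲ + κ_j / 4, which κ_j = 4C‖w‖ 2⁻ʲ does. So Df_j converges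
uniformly to -A f with no bound on the derivatives of A. -/
theorem norm_fderiv_picardIter_add_le (hA : ContDiffOn ℝ 1 A (ball 0 r))
    (hC : ∀ z ∈ ball (0 : E) r, ‖A z‖ ≤ C) (hCr : C * r ≤ 1 / 8)
    (hflat : ∀ z ∈ ball (0 : E) r, ∀ u v, formCurv A z u v = 0) (w : F) (j : ℕ) :
    ∀ z ∈ ball (0 : E) r, ‖fderiv ℝ (picardIter A w j) z + applyForm A (picardIter A w j) z‖ ≤
      4 * (C * ‖w‖) * (1 / 2) ^ j := by
  induction j with
  | zero =>
    intro z hz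
    have h := norm_applyForm_le (f := picardIter A w 0) (hC z hz)
    have hC0 : 0 ≤ C := (norm_nonneg (A z)).trans (hC _ hz)
    have : fderiv ℝ (picardIter A w 0) z = 0 := by simp [picardIter]
    rw [this, zero_add, pow_zero]
    refine h.trans ?_
    simp only [picardIter]
    nlinarith [mul_nonneg hC0 (norm_nonneg w)]
  | succ j ih =>
    intro z hz
    have hC0 : 0 ≤ C := (norm_nonneg (A z)).trans (hC _ hz)
    obtain ⟨h1, h2⟩ := contDiffOn_picardIter hA w j
    have hd := norm_radialDefect_applyForm_le
      (fun z hz ↦ (hA.differentiableOn one_ne_zero).differentiableAt (isOpen_ball.mem_nhds hz)) hC hflat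
      (fun z hz ↦ (h1.differentiableOn one_ne_zero).differentiableAt (isOpen_ball.mem_nhds hz)) ih hz
    rw [h2 z hz]
    have e : -(applyForm A (picardIter A w j) z +
        radialDefect (fderiv ℝ (applyForm A (picardIter A w j))) z) +
        applyForm A (picardIter A w (j + 1)) z =
        applyForm A (fun z ↦ picardIter A w (j + 1) z - picardIter A w j z) z -
          radialDefect (fderiv ℝ (applyForm A (picardIter A w j))) z := by
      simp only [applyForm, map_sub]
      abel
    rw [e]
    have h3 := norm_applyForm_le (f := fun z ↦ picardIter A w (j + 1) z - picardIter A w j z)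
      (hC z hz)
    have h4 := norm_picardIter_sub_le hA hC hCr w j z hz
    have h5 : (1 / 4 : ℝ) ^ j ≤ (1 / 2) ^ j := by gcongr; norm_num
    have h6 : C * ‖picardIter A w (j + 1) z - picardIter A w j z‖ ≤ C * (‖w‖ * (1 / 2) ^ j) := by
      gcongr
      exact h4.trans (by gcongr)
    have h7 : 2 * (C * r) * (4 * (C * ‖w‖) * (1 / 2) ^ j) ≤
        2 * (1 / 8) * (4 * (C * ‖w‖) * (1 / 2) ^ j) := by gcongr
    refine (norm_sub_le _ _).trans ?_
    rw [pow_succ]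
    linarith

/-- A flat linear system `Df = -A f` has a solution with any prescribed initial value. -/
theorem exists_solution_of_formCurv_eq_zero (hA : ContDiffOn ℝ 1 A (ball 0 r))
    (hC : ∀ z ∈ ball (0 : E) r, ‖A z‖ ≤ C) (hCr : C * r ≤ 1 / 8) (hr : 0 < r)
    (hflat : ∀ z ∈ ball (0 : E) r, ∀ u v, formCurv A z u v = 0) (w : F) :
    ∃ f : E → F, f 0 = w ∧ ∀ z ∈ ball (0 : E) r, HasFDerivAt f (-applyForm A f z) z := by
  have hC0 : 0 ≤ C := (norm_nonneg (A 0)).trans (hC _ (mem_ball_self hr))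
  have hsub := norm_picardIter_sub_le hA hC hCr w
  have hcau : ∀ z ∈ ball (0 : E) r, ∃ a, Filter.Tendsto (fun j ↦ picardIter A w j z)
      Filter.atTop (𝓝 a) := fun z hz ↦
    cauchySeq_tendsto_of_complete (cauchySeq_of_le_geometric (1 / 4) ‖w‖ (by norm_num) fun j ↦ by
      rw [dist_comm, dist_eq_norm]
      exact hsub j z hz)
  choose! f hf using hcau
  have hfd : ∀ j, ∀ z ∈ ball (0 : E) r,
      ‖picardIter A w j z - f z‖ ≤ ‖w‖ * (1 / 4) ^ j / (1 - 1 / 4) := fun j z hz ↦ by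
    rw [← dist_eq_norm]
    refine dist_le_of_le_geometric_of_tendsto (1 / 4) ‖w‖ (by norm_num) (fun j ↦ ?_) (hf z hz) j
    rw [dist_comm, dist_eq_norm]
    exact hsub j z hz
  refine ⟨f, ?_, ?_⟩
  · refine tendsto_nhds_unique (hf 0 (mem_ball_self hr)) ?_
    have : ∀ j, picardIter A w j 0 = w := fun j ↦ by cases j <;> simp [picardIter]
    simp [this]
  · intro z hz
    refine hasFDerivAt_of_tendstoUniformlyOn (l := Filter.atTop) (f := picardIter A w)
      (g' := fun z ↦ -applyForm A f z) (f' := fun j z ↦ fderiv ℝ (picardIter A w j) z) isOpen_ball ?_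
      (fun j z hz ↦ (((contDiffOn_picardIter hA w j).1.differentiableOn
        one_ne_zero).differentiableAt (isOpen_ball.mem_nhds hz)).hasFDerivAt) hf hz
    rw [Metric.tendstoUniformlyOn_iff]
    intro ε hε
    have hlim : Filter.Tendsto (fun j : ℕ ↦ 4 * (C * ‖w‖) * (1 / 2 : ℝ) ^ j +
        C * (‖w‖ * (1 / 4) ^ j / (1 - 1 / 4))) Filter.atTop (𝓝 0) := by
      have a1 := (tendsto_pow_atTop_nhds_zero_of_lt_one (r := (1 / 2 : ℝ)) (by norm_num)
        (by norm_num)).const_mul (4 * (C * ‖w‖))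
      have a2 := ((((tendsto_pow_atTop_nhds_zero_of_lt_one (r := (1 / 4 : ℝ)) (by norm_num)
        (by norm_num)).const_mul ‖w‖).div_const (1 - 1 / 4)).const_mul C)
      simpa using a1.add a2
    filter_upwards [hlim.eventually (gt_mem_nhds hε)] with j hj z hz
    refine lt_of_le_of_lt ?_ hj
    rw [dist_comm, dist_eq_norm]
    have e : fderiv ℝ (picardIter A w j) z - -applyForm A f z =
        (fderiv ℝ (picardIter A w j) z + applyForm A (picardIter A w j) z) -
          applyForm A (fun z ↦ picardIter A w j z - f z) z := by
      simp only [applyForm, map_sub]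
      abel
    rw [e]
    refine (norm_sub_le _ _).trans (add_le_add
      (norm_fderiv_picardIter_add_le hA hC hCr hflat w j z hz) ?_)
    exact (norm_applyForm_le (hC z hz)).trans (by gcongr; exact hfd j z hz)

omit [FiniteDimensional ℝ E] [CompleteSpace F] in
/-- Solutions of `Df = -A f` on a small ball are determined by their value at the centre. -/
theorem eq_zero_of_hasFDerivAt_applyForm (hC : ∀ z ∈ ball (0 : E) r, ‖A z‖ ≤ C)
    {f : E → F} (hf : ∀ z ∈ ball (0 : E) r, HasFDerivAt f (-applyForm A f z) z) (h0 : f 0 = 0) :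
    ∀ z ∈ ball (0 : E) r, f z = 0 := by
  intro z hz
  have hr : 0 < r := pos_of_mem_ball hz
  have hC0 : 0 ≤ C := (norm_nonneg (A 0)).trans (hC _ (mem_ball_self hr))
  have hseg : ∀ t ∈ Icc (0 : ℝ) 1, t • z ∈ ball (0 : E) r := fun t ht ↦ smul_mem_ball_zero hz ht
  have hd : ∀ t ∈ Icc (0 : ℝ) 1, HasDerivAt (fun t : ℝ ↦ f (t • z))
      (-applyForm A f (t • z) z) t := fun t ht ↦ by
    have e1 : HasDerivAt (fun t : ℝ ↦ t • z) z t := by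
      simpa using (hasDerivAt_id t).smul_const z
    exact (hf _ (hseg t ht)).comp_hasDerivAt t e1
  have hgr := norm_le_gronwallBound_of_norm_deriv_right_le (f := fun t : ℝ ↦ f (t • z))
    (f' := fun t ↦ -applyForm A f (t • z) z) (δ := 0) (K := C * r) (ε := 0) (a := 0) (b := 1)
    (fun t ht ↦ (hd t ht).continuousAt.continuousWithinAt)
    (fun t ht ↦ (hd t ⟨ht.1, ht.2.le⟩).hasDerivWithinAt) (by simp [h0]) (fun t ht ↦ by
      rw [norm_neg, add_zero]
      refine (ContinuousLinearMap.le_opNorm _ _).trans ?_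
      have := norm_applyForm_le (f := f) (hC _ (hseg t ⟨ht.1, ht.2.le⟩))
      have hzr : ‖z‖ ≤ r := (mem_ball_zero_iff.1 hz).le
      calc _ ≤ C * ‖f (t • z)‖ * r := by gcongr
        _ = _ := by ring)
  have := hgr 1 ⟨zero_le_one, le_rfl⟩
  simpa [gronwallBound_ε0_δ0] using this

end FlatSystems

/-! ### Parallel sections of D + A near a point of a vector space -/

section LocalSystems

open Metric

variable {E : Type*} [NormedAddCommGroup E] [NormedSpace ℝ E]
  {F : Type*} [NormedAddCommGroup F] [NormedSpace ℝ F]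

/-- `f` is parallel on `U` for the connection `D + A`. -/
def ParallelOn (A : E → E →L[ℝ] F →L[ℝ] F) (f : E → F) (U : Set E) : Prop :=
  ∀ z ∈ U, HasFDerivAt f (-applyForm A f z) z

theorem ParallelOn.mono {A : E → E →L[ℝ] F →L[ℝ] F} {f : E → F} {U V : Set E}
    (h : ParallelOn A f U) (hVU : V ⊆ U) : ParallelOn A f V := fun z hz ↦ h z (hVU hz)

/-- Bootstrapping: if f is Cⁿ, then so is Df = -A f, hence f is Cⁿ⁺¹. -/
theorem ParallelOn.contDiffOn {A : E → E →L[ℝ] F →L[ℝ] F} {f : E → F} {U : Set E}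
    (h : ParallelOn A f U) (hU : IsOpen U) (hA : ContDiffOn ℝ ∞ A U) : ContDiffOn ℝ ∞ f U := by
  rw [contDiffOn_infty]
  intro n
  induction n with
  | zero =>
    rw [Nat.cast_zero, contDiffOn_zero]
    exact fun z hz ↦ (h z hz).continuousAt.continuousWithinAt
  | succ n ih =>
    rw [Nat.cast_succ, contDiffOn_succ_iff_fderiv_of_isOpen hU]
    refine ⟨fun z hz ↦ (h z hz).differentiableAt.differentiableWithinAt, by simp, ?_⟩
    have h1 : ContDiffOn ℝ n (fun z ↦ -applyForm A f z) U :=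
      (ContDiffOn.applyForm (hA.of_le (by exact_mod_cast le_top)) ih).neg
    exact h1.congr fun z hz ↦ (h z hz).fderiv

theorem ParallelOn.comp_add_left {A : E → E →L[ℝ] F →L[ℝ] F} {f : E → F} {z₀ : E} {r : ℝ}
    (h : ParallelOn A f (ball z₀ r)) :
    ParallelOn (fun y ↦ A (z₀ + y)) (fun y ↦ f (z₀ + y)) (ball 0 r) := by
  intro y hy
  have : z₀ + y ∈ ball z₀ r := by simpa using hy
  exact (hasFDerivAt_comp_add_left z₀).2 (h _ this)

theorem ParallelOn.eq_zero {A : E → E →L[ℝ] F →L[ℝ] F} {C : ℝ} {f : E → F} {z₀ : E} {r : ℝ}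
    (h : ParallelOn A f (ball z₀ r)) (hC : ∀ z ∈ ball z₀ r, ‖A z‖ ≤ C) (h0 : f z₀ = 0) :
    ∀ z ∈ ball z₀ r, f z = 0 := by
  intro z hz
  have := eq_zero_of_hasFDerivAt_applyForm (A := fun y ↦ A (z₀ + y)) (C := C) (r := r)
    (fun y hy ↦ hC _ (by simpa using hy)) h.comp_add_left (by simpa using h0) (z - z₀)
    (by simpa [dist_eq_norm] using hz)
  simpa using this

variable [FiniteDimensional ℝ E] [CompleteSpace F]

/-- The radius depends only on a bound for A near z₀, not on the initial value, so the solutions for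
all initial values live on a common ball. -/
theorem exists_parallelOn_ball {A : E → E →L[ℝ] F →L[ℝ] F} {Ω : Set E} (hΩ : IsOpen Ω)
    (hA : ContDiffOn ℝ 1 A Ω) (hflat : ∀ z ∈ Ω, ∀ u v, formCurv A z u v = 0) {z₀ : E}
    (hz₀ : z₀ ∈ Ω) :
    ∃ r > 0, ball z₀ r ⊆ Ω ∧ ∀ w, ∃ f, f z₀ = w ∧ ParallelOn A f (ball z₀ r) := by
  have hcont : ContinuousAt A z₀ := hA.continuousOn.continuousAt (hΩ.mem_nhds hz₀)
  set C := ‖A z₀‖ + 1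
  have hC : 0 < C := by positivity
  obtain ⟨r, hr, hrs⟩ := Metric.mem_nhds_iff.1 (Filter.inter_mem (hΩ.mem_nhds hz₀)
    (hcont.norm.eventually (ge_mem_nhds (lt_add_one ‖A z₀‖))))
  -- The bound r keeps the ball inside Ω with ‖A‖ ≤ C; the other gives Cρ ≤ 1/8.
  set ρ := min r (1 / (8 * C))
  have hρ : 0 < ρ := by positivity
  have hsub : ball z₀ ρ ⊆ ball z₀ r := ball_subset_ball (min_le_left _ _)
  have hmem : ∀ y ∈ ball (0 : E) ρ, z₀ + y ∈ ball z₀ ρ := fun y hy ↦ by simpa using hy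
  refine ⟨ρ, hρ, fun z hz ↦ (hrs (hsub hz)).1, fun w ↦ ?_⟩
  obtain ⟨f, hf0, hf⟩ := exists_solution_of_formCurv_eq_zero (A := fun y ↦ A (z₀ + y)) (r := ρ)
    (C := C) (hA.comp (contDiff_const.add contDiff_id).contDiffOn
      fun y hy ↦ (hrs (hsub (hmem y hy))).1)
    (fun y hy ↦ (hrs (hsub (hmem y hy))).2)
    (by
      calc C * ρ ≤ C * (1 / (8 * C)) := by gcongr; exact min_le_right _ _
        _ = 1 / 8 := by field_simp) hρ
    (fun y hy u v ↦ by
      have := hflat _ (hrs (hsub (hmem y hy))).1 u v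
      simpa only [formCurv, fderiv_comp_add_left] using this) w
  refine ⟨fun z ↦ f (-z₀ + z), by simpa using hf0, fun z hz ↦ ?_⟩
  have hz' : -z₀ + z ∈ ball (0 : E) ρ := by
    simpa [dist_eq_norm, sub_eq_neg_add] using hz
  have := (hasFDerivAt_comp_add_left (-z₀) (x := z)).2 (hf _ hz')
  simpa [applyForm] using this

end LocalSystems

/-! ### Preserved subbundles with vanishing curvature -/

section Frames

open Metric

variable {E : Type*} [NormedAddCommGroup E] [NormedSpace ℝ E] [FiniteDimensional ℝ E]
  {F : Type*} [NormedAddCommGroup F] [NormedSpace ℝ F] [FiniteDimensional ℝ F]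
  {V : Type*} [NormedAddCommGroup V] [NormedSpace ℝ V] [FiniteDimensional ℝ V]

omit [FiniteDimensional ℝ E] in
/-- A smooth injective bundle map has, locally, a smooth left inverse. -/
theorem exists_contDiffOn_leftInverse {J : E → V →L[ℝ] F} {Ω : Set E} (hΩ : IsOpen Ω)
    (hJ : ContDiffOn ℝ ∞ J Ω) {z₀ : E} (hz₀ : z₀ ∈ Ω) (hinj : Function.Injective (J z₀)) :
    ∃ (N : Set E) (L : E → F →L[ℝ] V), IsOpen N ∧ z₀ ∈ N ∧ N ⊆ Ω ∧ ContDiffOn ℝ ∞ L N ∧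
      ∀ z ∈ N, ∀ c, L z (J z c) = c := by
  have : CompleteSpace V := FiniteDimensional.complete ℝ V
  obtain ⟨l, hl⟩ := (J z₀ : V →ₗ[ℝ] F).exists_leftInverse_of_injective
    (LinearMap.ker_eq_bot.2 hinj)
  set L₀ : F →L[ℝ] V := LinearMap.toContinuousLinearMap l
  have hL₀ : L₀ ∘L J z₀ = 1 := by
    ext c
    exact congrArg (fun m : V →ₗ[ℝ] V ↦ m c) hl
  -- L₀ inverts J only at z₀. Where G = L₀ J is invertible, an open condition that holds at z₀, the
  -- corrected map G⁻¹ L₀ is a left inverse of J.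
  set G : E → V →L[ℝ] V := fun z ↦ L₀ ∘L J z
  have hG : ContDiffOn ℝ ∞ G Ω := contDiffOn_const.clm_comp hJ
  refine ⟨Ω ∩ G ⁻¹' {g | IsUnit g}, fun z ↦ Ring.inverse (G z) ∘L L₀,
    hG.continuousOn.isOpen_inter_preimage hΩ Units.isOpen, ⟨hz₀, ?_⟩, inter_subset_left, ?_, ?_⟩
  · change IsUnit (L₀ ∘L J z₀)
    rw [hL₀]
    exact isUnit_one
  · refine ContDiffOn.clm_comp (fun z hz ↦ ?_) contDiffOn_const
    obtain ⟨g, hg⟩ := hz.2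
    have h1 : ContDiffAt ℝ ∞ Ring.inverse (G z) := hg ▸ contDiffAt_ringInverse ℝ g
    exact h1.comp_contDiffWithinAt z ((hG z hz.1).mono inter_subset_left)
  · intro z hz c
    have := Ring.inverse_mul_cancel (G z) hz.2
    exact congrArg (fun m : V →L[ℝ] V ↦ m c) this

omit [FiniteDimensional ℝ E] [FiniteDimensional ℝ F] [FiniteDimensional ℝ V] in
/-- The connection `D + A` induces on a subbundle with frame `J` the connection `D + θ`. -/
theorem formCurv_eq_zero_of_frame {A : E → E →L[ℝ] F →L[ℝ] F} {J : E → V →L[ℝ] F}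
    {θ : E → E →L[ℝ] V →L[ℝ] V} {N : Set E} (hN : IsOpen N) (hA : ContDiffOn ℝ ∞ A N)
    (hJ : ContDiffOn ℝ ∞ J N) (hθ : ContDiffOn ℝ ∞ θ N)
    (hinj : ∀ z ∈ N, Function.Injective (J z))
    (hθJ : ∀ z ∈ N, ∀ v c, J z (θ z v c) = fderiv ℝ J z v c + A z v (J z c))
    (hcurv : ∀ z ∈ N, ∀ u v c, formCurv A z u v (J z c) = 0) :
    ∀ z ∈ N, ∀ u v, formCurv θ z u v = 0 := by
  intro z hz u v
  have hne : (∞ : ℕ∞ω) ≠ 0 := by simp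
  have dA : DifferentiableAt ℝ A z := (hA.differentiableOn hne).differentiableAt (hN.mem_nhds hz)
  have dJ : DifferentiableAt ℝ J z := (hJ.differentiableOn hne).differentiableAt (hN.mem_nhds hz)
  have dθ : DifferentiableAt ℝ θ z := (hθ.differentiableOn hne).differentiableAt (hN.mem_nhds hz)
  have dJ' : DifferentiableAt ℝ (fderiv ℝ J) z :=
    ((hJ.fderiv_of_isOpen hN (m := ∞) (by simp)).differentiableOn hne).differentiableAt
      (hN.mem_nhds hz)
  have hsymm : ∀ u v, fderiv ℝ (fderiv ℝ J) z u v = fderiv ℝ (fderiv ℝ J) z v u := fun u v ↦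
    ((hJ.contDiffAt (hN.mem_nhds hz)).isSymmSndFDerivAt
      (by rw [minSmoothness_of_isRCLikeNormedField]
          exact WithTop.coe_le_coe.2 (le_top (a := (2 : ℕ∞))))).eq u v
  -- The relation J θ_v = ∂_v J + A_v J is differentiated in the direction u. After antisymmetrising
  -- in u and v the second derivatives of J cancel, and J · curv(θ) = curv(A) · J remains.
  have key : ∀ u v c, fderiv ℝ J z u (θ z v c) + J z (fderiv ℝ θ z u v c) =
      fderiv ℝ (fderiv ℝ J) z u v c + (fderiv ℝ A z u v (J z c) + A z v (fderiv ℝ J z u c)) := by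
    intro u v c
    have e1 := ((dθ.hasFDerivAt.clm_apply (hasFDerivAt_const v z)).clm_apply (hasFDerivAt_const c z))
    have e2 := dJ.hasFDerivAt.clm_apply e1
    have e3 := (dJ'.hasFDerivAt.clm_apply (hasFDerivAt_const v z)).clm_apply (hasFDerivAt_const c z)
    have e4 := (dA.hasFDerivAt.clm_apply (hasFDerivAt_const v z)).clm_apply
      (dJ.hasFDerivAt.clm_apply (hasFDerivAt_const c z))
    have e5 := (e3.add e4).congr_of_eventuallyEq (f₁ := fun z ↦ J z (θ z v c)) (by
      filter_upwards [hN.mem_nhds hz] with y hy using hθJ y hy v c)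
    have := congrArg (fun m : E →L[ℝ] F ↦ m u) (e2.unique e5)
    simp at this
    rw [add_comm] at this
    rw [this]
    abel
  ext c
  refine hinj z hz ?_
  have h1 := key u v c
  have h2 := key v u c
  rw [hsymm v u] at h2
  have h3 := hcurv z hz u v c
  have p1 : ∀ v c, fderiv ℝ J z v c = J z (θ z v c) - A z v (J z c) := fun v c ↦ by
    rw [hθJ z hz]; abel
  simp only [p1, map_sub] at h1 h2
  simp only [formCurv, _root_.add_apply, _root_.sub_apply, ContinuousLinearMap.comp_apply,
    _root_.zero_apply, map_zero, map_add, map_sub] at h3 ⊢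
  linear_combination (norm := module) h1 - h2 + h3

/-- A subbundle, given by a frame `J`, that is preserved by the connection `D + A` and on which the
curvature vanishes has parallel local sections with any prescribed initial value. -/
theorem exists_parallelOn_of_frame {A : E → E →L[ℝ] F →L[ℝ] F} {J : E → V →L[ℝ] F} {Ω : Set E}
    (hΩ : IsOpen Ω) (hA : ContDiffOn ℝ ∞ A Ω) (hJ : ContDiffOn ℝ ∞ J Ω)
    (hinj : ∀ z ∈ Ω, Function.Injective (J z))
    (hpres : ∀ z ∈ Ω, ∀ v c, ∃ c', J z c' = fderiv ℝ J z v c + A z v (J z c))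
    (hcurv : ∀ z ∈ Ω, ∀ u v c, formCurv A z u v (J z c) = 0) {z₀ : E} (hz₀ : z₀ ∈ Ω) :
    ∃ r > 0, ball z₀ r ⊆ Ω ∧ ∀ c₀, ∃ c : E → V, c z₀ = c₀ ∧
      ParallelOn A (fun z ↦ J z (c z)) (ball z₀ r) := by
  have : CompleteSpace V := FiniteDimensional.complete ℝ V
  obtain ⟨N, L, hN, hz₀N, hNΩ, hL, hLJ⟩ := exists_contDiffOn_leftInverse hΩ hJ hz₀ (hinj z₀ hz₀)
  have hA' := hA.mono hNΩ
  have hJ' := hJ.mono hNΩ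
  set P : E → E →L[ℝ] V →L[ℝ] F := fun z ↦ fderiv ℝ J z +
    ((ContinuousLinearMap.compL ℝ V F F).flip (J z)) ∘L (A z) with hP
  have hPs : ContDiffOn ℝ ∞ P N := by
    refine (hJ'.fderiv_of_isOpen hN (m := ∞) (by simp)).add (ContDiffOn.clm_comp ?_ hA')
    exact ((ContinuousLinearMap.compL ℝ V F F).flip).contDiff.comp_contDiffOn hJ'
  -- P = DJ + A J is the covariant derivative of the frame. By `hpres` its values lie in the image
  -- of J, where J L = 1; hence J θ = P, and Dc = -θ c makes J c parallel.
  set θ : E → E →L[ℝ] V →L[ℝ] V := fun z ↦ (ContinuousLinearMap.compL ℝ V F V (L z)) ∘L (P z)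
    with hθdef
  have hθ : ContDiffOn ℝ ∞ θ N := by
    refine ContDiffOn.clm_comp ?_ hPs
    exact (ContinuousLinearMap.compL ℝ V F V).contDiff.comp_contDiffOn hL
  have hθJ : ∀ z ∈ N, ∀ v c, J z (θ z v c) = fderiv ℝ J z v c + A z v (J z c) := by
    intro z hz v c
    obtain ⟨c', hc'⟩ := hpres z (hNΩ hz) v c
    have : θ z v c = L z (fderiv ℝ J z v c + A z v (J z c)) := by simp [hθdef, hP]
    rw [this, ← hc', hLJ z hz]
  have hflat := formCurv_eq_zero_of_frame hN hA' hJ' hθ (fun z hz ↦ hinj z (hNΩ hz)) hθJ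
    fun z hz ↦ hcurv z (hNΩ hz)
  obtain ⟨r, hr, hrN, hex⟩ := exists_parallelOn_ball hN (hθ.of_le (by simp)) hflat hz₀N
  refine ⟨r, hr, hrN.trans hNΩ, fun c₀ ↦ ?_⟩
  obtain ⟨c, hc0, hc⟩ := hex c₀
  refine ⟨c, hc0, fun z hz ↦ ?_⟩
  have dJ : DifferentiableAt ℝ J z :=
    (hJ'.differentiableOn (by simp)).differentiableAt (hN.mem_nhds (hrN hz))
  refine (dJ.hasFDerivAt.clm_apply (hc z hz)).congr_fderiv ?_
  ext v
  have := hθJ z (hrN hz) v (c z)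
  simp [applyForm, this]

end Frames

/-! ### Parallel transport of vectors along segments -/

section Transport

open Metric

variable {E : Type*} [NormedAddCommGroup E] [NormedSpace ℝ E] [FiniteDimensional ℝ E]

/-- The connection form on bilinear forms induced by the connection form `Γ` on vectors. -/
def bilinConn (Γ : E →L[ℝ] E →L[ℝ] E) : E →L[ℝ] (E →L[ℝ] E →L[ℝ] ℝ) →L[ℝ] (E →L[ℝ] E →L[ℝ] ℝ) :=
  LinearMap.toContinuousLinearMap
    { toFun := fun v ↦ LinearMap.toContinuousLinearMap
        { toFun := fun b ↦ -(b ∘L Γ v) - (b.flip ∘L Γ v).flip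
          map_add' := fun b b' ↦ by ext; simp; ring
          map_smul' := fun c b ↦ by ext; simp; ring }
      map_add' := fun v v' ↦ by ext; simp; ring
      map_smul' := fun c v ↦ by ext; simp; ring }

@[simp]
theorem bilinConn_apply (Γ : E →L[ℝ] E →L[ℝ] E) (v : E) (b : E →L[ℝ] E →L[ℝ] ℝ) (u w : E) :
    bilinConn Γ v b u w = -b (Γ v u) w - b u (Γ v w) := by
  simp [bilinConn]

theorem contDiffOn_bilinConn {Γ : E → E →L[ℝ] E →L[ℝ] E} {Ω : Set E} {n : ℕ∞ω}
    (hΓ : ContDiffOn ℝ n Γ Ω) : ContDiffOn ℝ n (fun z ↦ bilinConn (Γ z)) Ω := by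
  rw [contDiffOn_clm_apply]
  intro v
  rw [contDiffOn_clm_apply]
  intro b
  rw [contDiffOn_clm_apply]
  intro u
  rw [contDiffOn_clm_apply]
  intro w
  simp only [bilinConn_apply]
  have h : ∀ u, ContDiffOn ℝ n (fun z ↦ Γ z v u) Ω := fun u ↦
    (hΓ.clm_apply contDiffOn_const).clm_apply contDiffOn_const
  exact ((b.flip w).contDiff.comp_contDiffOn (h u)).neg.sub ((b u).contDiff.comp_contDiffOn (h w))

/-- Local parallel transport along segments, acting on all parallel bilinear forms. -/
theorem exists_transport {Γ : E → E →L[ℝ] E →L[ℝ] E} {Ω : Set E} (hΩ : IsOpen Ω)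
    (hΓ : ContDiffOn ℝ 1 Γ Ω) {z₀ : E} (hz₀ : z₀ ∈ Ω) :
    ∃ ρ > 0, ball z₀ ρ ⊆ Ω ∧ ∀ a ∈ ball z₀ ρ, ∀ b ∈ ball z₀ ρ, ∃ T : E →L[ℝ] E,
      Function.Injective T ∧ ∀ f : E → E →L[ℝ] E →L[ℝ] ℝ,
        ParallelOn (fun z ↦ bilinConn (Γ z)) f (ball z₀ ρ) →
          ∀ u w, f b (T u) (T w) = f a u w := by
  have : CompleteSpace E := FiniteDimensional.complete ℝ E
  have hcont : ContinuousAt Γ z₀ := hΓ.continuousOn.continuousAt (hΩ.mem_nhds hz₀)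
  set C := ‖Γ z₀‖ + 1
  have hC : 0 < C := by positivity
  obtain ⟨r, hr, hrs⟩ := Metric.mem_nhds_iff.1 (Filter.inter_mem (hΩ.mem_nhds hz₀)
    (hcont.norm.eventually (ge_mem_nhds (lt_add_one ‖Γ z₀‖))))
  -- Since ‖b - a‖ ≤ 2ρ, the condition 7ρ ≤ r keeps a + s(b - a) in the ball of radius r for |s| <
  -- 3. The second bound gives C · 2ρ · 3 ≤ 1/8, the smallness condition for the system on the ball
  -- of radius 3 in ℝ.
  set ρ := min (r / 7) (1 / (48 * C))
  have hρ : 0 < ρ := by positivity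
  have hρr : 7 * ρ ≤ r := by
    have := min_le_left (r / 7) (1 / (48 * C))
    linarith
  have hρC : C * (2 * ρ) * 3 ≤ 1 / 8 := by
    calc C * (2 * ρ) * 3 ≤ C * (2 * (1 / (48 * C))) * 3 := by gcongr; exact min_le_right _ _
      _ = 1 / 8 := by field_simp; norm_num
  refine ⟨ρ, hρ, fun z hz ↦ (hrs (ball_subset_ball (by linarith) hz)).1, fun a ha b hb ↦ ?_⟩
  have hab : ‖b - a‖ ≤ 2 * ρ := by
    rw [mem_ball, dist_eq_norm] at ha hb
    calc ‖b - a‖ = ‖(b - z₀) - (a - z₀)‖ := by congr 1; abel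
      _ ≤ ‖b - z₀‖ + ‖a - z₀‖ := norm_sub_le _ _
      _ ≤ 2 * ρ := by linarith
  set γ : ℝ → E := fun s ↦ a + s • (b - a)
  have hγ : ∀ s ∈ ball (0 : ℝ) 3, γ s ∈ ball z₀ r := by
    intro s hs
    rw [mem_ball_zero_iff] at hs
    rw [mem_ball, dist_eq_norm] at ha ⊢
    calc ‖γ s - z₀‖ = ‖(a - z₀) + s • (b - a)‖ := by congr 1; simp only [γ]; abel
      _ ≤ ‖a - z₀‖ + ‖s‖ * ‖b - a‖ := (norm_add_le _ _).trans (by rw [norm_smul])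
      _ ≤ ‖a - z₀‖ + 3 * (2 * ρ) := by gcongr
      _ < ρ + 3 * (2 * ρ) := by gcongr
      _ ≤ r := by linarith
  have hγd : ∀ s, HasDerivAt γ (b - a) s := fun s ↦ by
    simpa [γ] using ((hasDerivAt_id s).smul_const (b - a)).const_add a
  have hγc : ContDiff ℝ 1 γ := by fun_prop
  set Λ : ℝ → E →L[ℝ] E := fun s ↦ Γ (γ s) (b - a)
  have hΛ : ContDiffOn ℝ 1 Λ (ball 0 3) :=
    (hΓ.comp hγc.contDiffOn fun s hs ↦ (hrs (hγ s hs)).1).clm_apply contDiffOn_const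
  have hΛn : ∀ s ∈ ball (0 : ℝ) 3, ‖Λ s‖ ≤ C * (2 * ρ) := fun s hs ↦
    ((Γ (γ s)).le_opNorm _).trans (by gcongr; exact (hrs (hγ s hs)).2)
  set A : ℝ → ℝ →L[ℝ] (E →L[ℝ] E) →L[ℝ] (E →L[ℝ] E) := fun s ↦
    (ContinuousLinearMap.id ℝ ℝ).smulRight (ContinuousLinearMap.compL ℝ E E E (Λ s))
  have hAapp : ∀ s t P, A s t P = t • (Λ s ∘L P) := fun s t P ↦ by simp [A]
  have hAc : ContDiffOn ℝ 1 A (ball 0 3) :=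
    contDiffOn_const.smulRight ((ContinuousLinearMap.compL ℝ E E E).contDiff.comp_contDiffOn hΛ)
  have hAn : ∀ s ∈ ball (0 : ℝ) 3, ‖A s‖ ≤ C * (2 * ρ) := by
    intro s hs
    refine ContinuousLinearMap.opNorm_le_bound₂ _ (by positivity) fun t P ↦ ?_
    rw [hAapp, norm_smul]
    calc ‖t‖ * ‖Λ s ∘L P‖ ≤ ‖t‖ * (C * (2 * ρ) * ‖P‖) := by
          gcongr
          exact (ContinuousLinearMap.opNorm_comp_le _ _).trans (by gcongr; exact hΛn s hs)
      _ = _ := by ring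
  -- Over a one-dimensional base every connection is flat, the curvature being alternating.
  have hflat : ∀ z ∈ ball (0 : ℝ) 3, ∀ u v, formCurv A z u v = 0 := by
    intro z _ u v
    have e1 : ∀ u v, fderiv ℝ A z u v = (u * v) • fderiv ℝ A z 1 1 := fun u v ↦ by
      rw [mul_smul, ← map_smul (fderiv ℝ A z 1), ← _root_.smul_apply, ← map_smul]
      simp
    ext P x
    simp only [formCurv, e1 u v, e1 v u, mul_comm v u, sub_self, zero_add, hAapp,
      _root_.sub_apply, ContinuousLinearMap.comp_apply, _root_.zero_apply, _root_.smul_apply,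
      map_smul, smul_smul]
  obtain ⟨P, hP0, hP⟩ := exists_solution_of_formCurv_eq_zero hAc hAn hρC (by norm_num) hflat
    (ContinuousLinearMap.id ℝ E)
  have hPd : ∀ s ∈ ball (0 : ℝ) 3, HasDerivAt P (-(Λ s ∘L P s)) s := fun s hs ↦ by
    have := (hP s hs).hasDerivAt
    simpa [applyForm, hAapp] using this
  refine ⟨P 1, ?_, fun f hf u w ↦ ?_⟩
  -- If P 1 kills u, the solution s ↦ P s u vanishes at s = 1. Uniqueness on the ball of centre 1
  -- and radius 2, which contains 0 and lies in the ball of radius 3 about 0, makes it vanish at s =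
  -- 0, where P is the identity.
  · rw [injective_iff_map_eq_zero]
    intro u hu
    have hpar : ParallelOn (fun s ↦ (ContinuousLinearMap.id ℝ ℝ).smulRight (Λ s)) (fun s ↦ P s u)
        (ball 1 2) := by
      intro s hs
      have hs' : s ∈ ball (0 : ℝ) 3 := by
        rw [mem_ball_zero_iff, Real.norm_eq_abs, abs_lt]
        rw [mem_ball, Real.dist_eq, abs_lt] at hs
        constructor <;> linarith
      have := ((hPd s hs').clm_apply (hasDerivAt_const s u)).hasFDerivAt
      refine this.congr_fderiv ?_
      ext
      simp [applyForm]
    have h0 := hpar.eq_zero (C := C * (2 * ρ)) (fun s hs ↦ ?_) hu 0 (by simp)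
    · simpa [hP0] using h0
    · have hs' : s ∈ ball (0 : ℝ) 3 := by
        rw [mem_ball_zero_iff, Real.norm_eq_abs, abs_lt]
        rw [mem_ball, Real.dist_eq, abs_lt] at hs
        constructor <;> linarith
      refine ContinuousLinearMap.opNorm_le_bound _ (by positivity) fun t ↦ ?_
      have := hΛn s hs'
      simp only [ContinuousLinearMap.smulRight_apply, ContinuousLinearMap.id_apply, norm_smul]
      nlinarith [norm_nonneg t]
  · have hI : ∀ s ∈ Icc (0 : ℝ) 1, s ∈ ball (0 : ℝ) 3 := fun s hs ↦ by
      rw [mem_ball_zero_iff, Real.norm_eq_abs, abs_lt]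
      constructor <;> linarith [hs.1, hs.2]
    have hγI : ∀ s ∈ Icc (0 : ℝ) 1, γ s ∈ ball z₀ ρ := fun s hs ↦ by
      have := (convex_ball z₀ ρ).add_smul_sub_mem ha hb hs
      exact this
    -- P solves the vector equation and f the induced one, so the derivative cancels. P is built
    -- from Γ alone and therefore serves all parallel f at once.
    have hd : ∀ s ∈ Icc (0 : ℝ) 1, HasDerivAt (fun s ↦ f (γ s) (P s u) (P s w)) 0 s := by
      intro s hs
      have e1 := (hf _ (hγI s hs)).comp_hasDerivAt s (hγd s)
      have e2 := (e1.clm_apply ((hPd s (hI s hs)).clm_apply (hasDerivAt_const s u))).clm_apply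
        ((hPd s (hI s hs)).clm_apply (hasDerivAt_const s w))
      refine e2.congr_deriv ?_
      simp [applyForm, Λ]
      ring
    have hc := constant_of_has_deriv_right_zero (f := fun s ↦ f (γ s) (P s u) (P s w)) (a := 0)
      (b := 1) (fun s hs ↦ (hd s hs).continuousAt.continuousWithinAt)
      (fun s hs ↦ (hd s ⟨hs.1, hs.2.le⟩).hasDerivWithinAt) 1 ⟨zero_le_one, le_rfl⟩
    simpa [γ, hP0] using hc

end Transport

/-! ### Forms and vector fields in a chart -/

section ChartRep

theorem contDiffAt_congr_iff {E F : Type*} [NormedAddCommGroup E] [NormedSpace ℝ E]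
    [NormedAddCommGroup F] [NormedSpace ℝ F] {f g : E → F} {z : E} {k : ℕ∞ω} (h : f =ᶠ[𝓝 z] g) :
    ContDiffAt ℝ k f z ↔ ContDiffAt ℝ k g z :=
  ⟨fun hf ↦ hf.congr_of_eventuallyEq h.symm, fun hg ↦ hg.congr_of_eventuallyEq h⟩

variable {E : Type*} [NormedAddCommGroup E] [NormedSpace ℝ E]
  {M : Type*} [TopologicalSpace M] [ChartedSpace E M] [IsManifold 𝓘(ℝ, E) ∞ M]

/-- The coordinate frame of the chart at `x₀`. -/
def coordFrame (x₀ x : M) : E →L[ℝ] TangentSpace 𝓘(ℝ, E) x :=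
  (trivializationAt E (TangentSpace 𝓘(ℝ, E)) x₀).symmL ℝ x

/-- The coordinates of tangent vectors in the chart at `x₀`. -/
def coordVec (x₀ x : M) : TangentSpace 𝓘(ℝ, E) x →L[ℝ] E :=
  (trivializationAt E (TangentSpace 𝓘(ℝ, E)) x₀).continuousLinearMapAt ℝ x

theorem coordVec_coordFrame {x₀ x : M} (hx : x ∈ (chartAt E x₀).source) (u : E) :
    coordVec x₀ x (coordFrame x₀ x u) = u :=
  Trivialization.continuousLinearMapAt_symmL _ hx u

theorem coordFrame_coordVec {x₀ x : M} (hx : x ∈ (chartAt E x₀).source)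
    (u : TangentSpace 𝓘(ℝ, E) x) : coordFrame x₀ x (coordVec x₀ x u) = u :=
  Trivialization.symmL_continuousLinearMapAt _ hx u

/-- The components of a bilinear form in the chart at `x₀`. -/
def toModel (x₀ x : M) : BilinAt E x →ₗ[ℝ] (E →L[ℝ] E →L[ℝ] ℝ) where
  toFun w := (ContinuousLinearMap.precomp ℝ (coordFrame x₀ x)) ∘L w ∘L coordFrame x₀ x
  map_add' w w' := by ext; simp
  map_smul' c w := by ext; simp

/-- The bilinear form with given components in the chart at `x₀`. -/
def ofModel (x₀ x : M) : (E →L[ℝ] E →L[ℝ] ℝ) →ₗ[ℝ] BilinAt E x where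
  toFun w := (ContinuousLinearMap.precomp ℝ (coordVec x₀ x)) ∘L w ∘L coordVec x₀ x
  map_add' w w' := by ext; simp
  map_smul' c w := by ext; simp

theorem toModel_apply (x₀ x : M) (w : BilinAt E x) (u v : E) :
    toModel x₀ x w u v = w (coordFrame x₀ x u) (coordFrame x₀ x v) := rfl

theorem ofModel_apply (x₀ x : M) (b : E →L[ℝ] E →L[ℝ] ℝ) (u v : TangentSpace 𝓘(ℝ, E) x) :
    ofModel x₀ x b u v = b (coordVec x₀ x u) (coordVec x₀ x v) := rfl

theorem toModel_ofModel {x₀ x : M} (hx : x ∈ (chartAt E x₀).source) (b : E →L[ℝ] E →L[ℝ] ℝ) :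
    toModel x₀ x (ofModel x₀ x b) = b := by
  ext u v
  rw [toModel_apply, ofModel_apply, coordVec_coordFrame hx, coordVec_coordFrame hx]

theorem ofModel_toModel {x₀ x : M} (hx : x ∈ (chartAt E x₀).source) (w : BilinAt E x) :
    ofModel x₀ x (toModel x₀ x w) = w := by
  ext u v
  rw [ofModel_apply, toModel_apply, coordFrame_coordVec hx, coordFrame_coordVec hx]

theorem toModel_injective {x₀ x : M} (hx : x ∈ (chartAt E x₀).source) :
    Function.Injective (toModel (E := E) x₀ x) :=
  Function.LeftInverse.injective (ofModel_toModel hx)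

theorem isSymmForm_iff_toModel {x₀ x : M} (hx : x ∈ (chartAt E x₀).source) (w : BilinAt E x) :
    IsSymmForm w ↔ ∀ u v, toModel x₀ x w u v = toModel x₀ x w v u := by
  refine ⟨fun h u v ↦ h _ _, fun h u v ↦ ?_⟩
  have := h (coordVec x₀ x u) (coordVec x₀ x v)
  rwa [toModel_apply, toModel_apply, coordFrame_coordVec hx, coordFrame_coordVec hx] at this

/-- Identifies the trivialisation of the hom bundle with concrete components, so that regularity of
a section becomes regularity of `formRep`. -/
theorem trivializationAt_bilin_snd {x₀ x : M} (hx : x ∈ (chartAt E x₀).source) (w : BilinAt E x) :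
    (trivializationAt (E →L[ℝ] E →L[ℝ] ℝ) (fun x : M ↦ BilinAt E x) x₀
      (TotalSpace.mk' (E →L[ℝ] E →L[ℝ] ℝ) x w)).2 = toModel x₀ x w := by
  rw [hom_trivializationAt_apply]
  ext u v
  dsimp only
  rw [inCoordinates_apply_eq₂ (F₃ := ℝ) (E₃ := Bundle.Trivial M ℝ) hx hx (mem_univ _)]
  rw [toModel_apply, coordFrame, Trivialization.symmL_apply _ hx, Trivialization.symmL_apply _ hx]
  simp

/-- The components, as functions on the chart domain, of a field of forms. -/
def formRep (x₀ : M) (h : Π x : M, BilinAt E x) (z : E) : E →L[ℝ] E →L[ℝ] ℝ :=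
  toModel x₀ ((extChartAt 𝓘(ℝ, E) x₀).symm z) (h ((extChartAt 𝓘(ℝ, E) x₀).symm z))

/-- The components of a vector field in a chart. -/
def vecRep (x₀ : M) (X : Π x : M, TangentSpace 𝓘(ℝ, E) x) (z : E) : E :=
  coordVec x₀ ((extChartAt 𝓘(ℝ, E) x₀).symm z) (X ((extChartAt 𝓘(ℝ, E) x₀).symm z))

omit [IsManifold 𝓘(ℝ, E) ∞ M] in
theorem extChartAt_symm_mem {x₀ : M} {z : E} (hz : z ∈ (extChartAt 𝓘(ℝ, E) x₀).target) :
    (extChartAt 𝓘(ℝ, E) x₀).symm z ∈ (chartAt E x₀).source := by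
  rw [← extChartAt_source 𝓘(ℝ, E)]
  exact (extChartAt 𝓘(ℝ, E) x₀).map_target hz

omit [IsManifold 𝓘(ℝ, E) ∞ M] in
theorem extChartAt_mem_target {x₀ x : M} (hx : x ∈ (chartAt E x₀).source) :
    extChartAt 𝓘(ℝ, E) x₀ x ∈ (extChartAt 𝓘(ℝ, E) x₀).target :=
  (extChartAt 𝓘(ℝ, E) x₀).map_source (by rwa [extChartAt_source])

omit [IsManifold 𝓘(ℝ, E) ∞ M] in
theorem extChartAt_symm_apply {x₀ x : M} (hx : x ∈ (chartAt E x₀).source) :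
    (extChartAt 𝓘(ℝ, E) x₀).symm (extChartAt 𝓘(ℝ, E) x₀ x) = x :=
  (extChartAt 𝓘(ℝ, E) x₀).left_inv (by rwa [extChartAt_source])

theorem formRep_extChartAt {x₀ x : M} (hx : x ∈ (chartAt E x₀).source)
    (h : Π x : M, BilinAt E x) : formRep x₀ h (extChartAt 𝓘(ℝ, E) x₀ x) = toModel x₀ x (h x) := by
  rw [formRep, extChartAt_symm_apply hx]

theorem vecRep_extChartAt {x₀ x : M} (hx : x ∈ (chartAt E x₀).source)
    (X : Π x : M, TangentSpace 𝓘(ℝ, E) x) :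
    vecRep x₀ X (extChartAt 𝓘(ℝ, E) x₀ x) = coordVec x₀ x (X x) := by
  rw [vecRep, extChartAt_symm_apply hx]

omit [NormedSpace ℝ E] [IsManifold 𝓘(ℝ, E) ∞ M] in
theorem eventually_mem_chart {x₀ x : M} (hx : x ∈ (chartAt E x₀).source) :
    ∀ᶠ y in 𝓝 x, y ∈ (chartAt E x₀).source :=
  (chartAt E x₀).open_source.mem_nhds hx

variable {F : Type*} [NormedAddCommGroup F] [NormedSpace ℝ F]

theorem mdifferentiableAt_iff_rep {x₀ x : M} (hx : x ∈ (chartAt E x₀).source) {f : M → F} :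
    MDifferentiableAt 𝓘(ℝ, E) 𝓘(ℝ, F) f x ↔
      DifferentiableAt ℝ (f ∘ (extChartAt 𝓘(ℝ, E) x₀).symm) (extChartAt 𝓘(ℝ, E) x₀ x) := by
  rw [mdifferentiableAt_iff_source_of_mem_source hx]
  simp [mdifferentiableWithinAt_univ, mdifferentiableAt_iff_differentiableAt]

theorem contMDiffAt_iff_rep {x₀ x : M} (hx : x ∈ (chartAt E x₀).source) {f : M → F} {k : ℕ∞ω}
    (hk : k ≤ ∞) :
    ContMDiffAt 𝓘(ℝ, E) 𝓘(ℝ, F) k f x ↔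
      ContDiffAt ℝ k (f ∘ (extChartAt 𝓘(ℝ, E) x₀).symm) (extChartAt 𝓘(ℝ, E) x₀ x) := by
  have : IsManifold 𝓘(ℝ, E) k M := IsManifold.of_le hk
  rw [contMDiffAt_iff_source_of_mem_source hx]
  simp [contMDiffWithinAt_univ, contMDiffAt_iff_contDiffAt]

omit [IsManifold 𝓘(ℝ, E) ∞ M] in
theorem eventually_symm_mem_chart {x₀ x : M} (hx : x ∈ (chartAt E x₀).source) :
    ∀ᶠ z in 𝓝 (extChartAt 𝓘(ℝ, E) x₀ x), z ∈ (extChartAt 𝓘(ℝ, E) x₀).target :=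
  (isOpen_extChartAt_target x₀).mem_nhds (extChartAt_mem_target hx)

theorem eventually_toModel_eq {x₀ x : M} (hx : x ∈ (chartAt E x₀).source)
    (h : Π x : M, BilinAt E x) :
    ((fun x ↦ (trivializationAt (E →L[ℝ] E →L[ℝ] ℝ) (fun x : M ↦ BilinAt E x) x₀
      (TotalSpace.mk' (E →L[ℝ] E →L[ℝ] ℝ) x (h x))).2) ∘ (extChartAt 𝓘(ℝ, E) x₀).symm)
      =ᶠ[𝓝 (extChartAt 𝓘(ℝ, E) x₀ x)] formRep x₀ h := by
  filter_upwards [eventually_symm_mem_chart hx] with z hz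
  exact trivializationAt_bilin_snd (extChartAt_symm_mem hz) _

theorem mem_baseSet_bilin {x₀ x : M} (hx : x ∈ (chartAt E x₀).source) :
    x ∈ (trivializationAt (E →L[ℝ] E →L[ℝ] ℝ) (fun x : M ↦ BilinAt E x) x₀).baseSet := by
  rw [hom_trivializationAt_baseSet, hom_trivializationAt_baseSet]
  exact ⟨hx, hx, mem_univ _⟩

theorem diffFormAt_iff {x₀ x : M} (hx : x ∈ (chartAt E x₀).source) {h : Π x : M, BilinAt E x} :
    DiffFormAt h x ↔ DifferentiableAt ℝ (formRep x₀ h) (extChartAt 𝓘(ℝ, E) x₀ x) := by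
  rw [← (eventually_toModel_eq hx h).differentiableAt_iff, ← mdifferentiableAt_iff_rep hx]
  exact (trivializationAt (E →L[ℝ] E →L[ℝ] ℝ) (fun x : M ↦ BilinAt E x)
    x₀).mdifferentiableAt_section_iff 𝓘(ℝ, E) h (mem_baseSet_bilin hx)

theorem smoothFormAt_iff {x₀ x : M} (hx : x ∈ (chartAt E x₀).source) {h : Π x : M, BilinAt E x} :
    ContMDiffAt 𝓘(ℝ, E) (𝓘(ℝ, E).prod 𝓘(ℝ, E →L[ℝ] E →L[ℝ] ℝ)) ∞ (formMap h) x ↔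
      ContDiffAt ℝ ∞ (formRep x₀ h) (extChartAt 𝓘(ℝ, E) x₀ x) := by
  rw [← contDiffAt_congr_iff (eventually_toModel_eq hx h), ← contMDiffAt_iff_rep hx le_rfl]
  exact (trivializationAt (E →L[ℝ] E →L[ℝ] ℝ) (fun x : M ↦ BilinAt E x)
    x₀).contMDiffAt_section_iff (mem_baseSet_bilin hx)

theorem eventually_coordVec_eq {x₀ x : M} (hx : x ∈ (chartAt E x₀).source)
    (X : Π x : M, TangentSpace 𝓘(ℝ, E) x) :
    ((fun x ↦ (trivializationAt E (TangentSpace 𝓘(ℝ, E)) x₀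
      (TotalSpace.mk' E x (X x))).2) ∘ (extChartAt 𝓘(ℝ, E) x₀).symm)
      =ᶠ[𝓝 (extChartAt 𝓘(ℝ, E) x₀ x)] vecRep x₀ X := by
  filter_upwards [eventually_symm_mem_chart hx] with z hz
  have hz' : (extChartAt 𝓘(ℝ, E) x₀).symm z ∈
    (trivializationAt E (TangentSpace 𝓘(ℝ, E)) x₀).baseSet := extChartAt_symm_mem hz
  simp only [Function.comp_apply, vecRep, coordVec]
  rw [Trivialization.continuousLinearMapAt_apply, Trivialization.coe_linearMapAt_of_mem _ hz']

theorem cmdiffAt_vec_iff {x₀ x : M} (hx : x ∈ (chartAt E x₀).source)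
    {X : Π x : M, TangentSpace 𝓘(ℝ, E) x} :
    CMDiffAt ∞ (T% X) x ↔ ContDiffAt ℝ ∞ (vecRep x₀ X) (extChartAt 𝓘(ℝ, E) x₀ x) := by
  rw [← contDiffAt_congr_iff (eventually_coordVec_eq hx X), ← contMDiffAt_iff_rep hx le_rfl]
  exact (trivializationAt E (TangentSpace 𝓘(ℝ, E)) x₀).contMDiffAt_section_iff hx

theorem vecRep_coordFrame {x₀ : M} {z : E} (hz : z ∈ (extChartAt 𝓘(ℝ, E) x₀).target) (u : E) :
    vecRep x₀ (fun x ↦ coordFrame x₀ x u) z = u :=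
  coordVec_coordFrame (extChartAt_symm_mem hz) u

theorem cmdiffAt_coordFrame {x₀ x : M} (hx : x ∈ (chartAt E x₀).source) (u : E) :
    CMDiffAt ∞ (T% (fun x ↦ coordFrame x₀ x u)) x := by
  rw [cmdiffAt_vec_iff hx]
  refine (contDiffAt_const (c := u)).congr_of_eventuallyEq ?_
  filter_upwards [eventually_symm_mem_chart hx] with z hz
  exact vecRep_coordFrame hz u

theorem mdiffAt_coordFrame {x₀ x : M} (hx : x ∈ (chartAt E x₀).source) (u : E) :
    MDiffAt (T% (fun x ↦ coordFrame x₀ x u)) x :=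
  (cmdiffAt_coordFrame hx u).mdifferentiableAt (by simp)

/-- The coordinate frame is the derivative of the inverse chart, so the chain rule turns derivatives
along it into partial derivatives. -/
theorem mvfderiv_coordFrame {x₀ : M} {z : E} (hz : z ∈ (extChartAt 𝓘(ℝ, E) x₀).target) {f : M → F}
    (hf : MDifferentiableAt 𝓘(ℝ, E) 𝓘(ℝ, F) f ((extChartAt 𝓘(ℝ, E) x₀).symm z)) (v : E) :
    d% f ((extChartAt 𝓘(ℝ, E) x₀).symm z) (coordFrame x₀ ((extChartAt 𝓘(ℝ, E) x₀).symm z) v) =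
      fderiv ℝ (f ∘ (extChartAt 𝓘(ℝ, E) x₀).symm) z v := by
  have h1 : coordFrame x₀ ((extChartAt 𝓘(ℝ, E) x₀).symm z) v =
      mfderivWithin 𝓘(ℝ, E) 𝓘(ℝ, E) (extChartAt 𝓘(ℝ, E) x₀).symm (range 𝓘(ℝ, E)) z v := by
    have := TangentBundle.symmL_trivializationAt (I := 𝓘(ℝ, E)) (extChartAt_symm_mem hz)
    rw [(extChartAt 𝓘(ℝ, E) x₀).right_inv hz] at this
    exact DFunLike.congr_fun this v
  have h2 : MDifferentiableAt 𝓘(ℝ, E) 𝓘(ℝ, E) (extChartAt 𝓘(ℝ, E) x₀).symm z := by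
    have := mdifferentiableWithinAt_extChartAt_symm (I := 𝓘(ℝ, E)) hz
    simpa [mdifferentiableWithinAt_univ] using this
  rw [h1]
  simp only [modelWithCornersSelf_coe, range_id, mfderivWithin_univ]
  have h3 : mfderiv 𝓘(ℝ, E) 𝓘(ℝ, F) (f ∘ (extChartAt 𝓘(ℝ, E) x₀).symm) z = _ :=
    mfderiv_comp z hf h2
  rw [mfderiv_eq_fderiv] at h3
  rw [h3]
  rfl

end ChartRep

/-! ### The curvature of D + A as a commutator -/

section CurvatureIdentity

variable {E : Type*} [NormedAddCommGroup E] [NormedSpace ℝ E]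
  {F : Type*} [NormedAddCommGroup F] [NormedSpace ℝ F]

theorem hasFDerivAt_covariant {A : E → E →L[ℝ] F →L[ℝ] F} {f : E → F} {Y : E → E} {z : E}
    (hA : DifferentiableAt ℝ A z) (hf : ContDiffAt ℝ 2 f z) (hY : DifferentiableAt ℝ Y z) (v : E) :
    fderiv ℝ (fun z ↦ fderiv ℝ f z (Y z) + A z (Y z) (f z)) z v =
      fderiv ℝ (fderiv ℝ f) z v (Y z) + fderiv ℝ f z (fderiv ℝ Y z v)
        + (fderiv ℝ A z v (Y z) (f z) + A z (fderiv ℝ Y z v) (f z) + A z (Y z) (fderiv ℝ f z v)) := by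
  have h1 : DifferentiableAt ℝ (fderiv ℝ f) z :=
    (hf.fderiv_right (m := 1) (by norm_num)).differentiableAt one_ne_zero
  have h2 : DifferentiableAt ℝ f z := hf.differentiableAt two_ne_zero
  have e := (h1.hasFDerivAt.clm_apply hY.hasFDerivAt).fun_add
    ((hA.hasFDerivAt.clm_apply hY.hasFDerivAt).clm_apply h2.hasFDerivAt)
  rw [e.fderiv]
  simp
  abel

/-- The second derivatives of f cancel by symmetry, the terms with DX and DY are those of the
bracket, and what is left is of order zero in f, X and Y. -/
theorem curvature_eq_formCurv {A : E → E →L[ℝ] F →L[ℝ] F} {f : E → F} {X Y : E → E} {z : E}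
    (hA : DifferentiableAt ℝ A z) (hf : ContDiffAt ℝ 2 f z) (hX : DifferentiableAt ℝ X z)
    (hY : DifferentiableAt ℝ Y z) :
    (fderiv ℝ (fun z ↦ fderiv ℝ f z (Y z) + A z (Y z) (f z)) z (X z)
        + A z (X z) (fderiv ℝ f z (Y z) + A z (Y z) (f z)))
      - (fderiv ℝ (fun z ↦ fderiv ℝ f z (X z) + A z (X z) (f z)) z (Y z)
        + A z (Y z) (fderiv ℝ f z (X z) + A z (X z) (f z)))
      - (fderiv ℝ f z (fderiv ℝ Y z (X z) - fderiv ℝ X z (Y z))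
        + A z (fderiv ℝ Y z (X z) - fderiv ℝ X z (Y z)) (f z))
      = formCurv A z (X z) (Y z) (f z) := by
  have hs := (hf.isSymmSndFDerivAt (by simp)).eq (X z) (Y z)
  rw [hasFDerivAt_covariant hA hf hY, hasFDerivAt_covariant hA hf hX, hs]
  simp only [formCurv, map_add, map_sub, _root_.add_apply, _root_.sub_apply,
    ContinuousLinearMap.comp_apply]
  abel

end CurvatureIdentity

/-! ### Christoffel symbols, and the curvature in a chart -/

section ChartConnection

variable {E : Type*} [NormedAddCommGroup E] [NormedSpace ℝ E] [FiniteDimensional ℝ E]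
  {M : Type*} [TopologicalSpace M] [ChartedSpace E M] [IsManifold 𝓘(ℝ, E) ∞ M]
  (cov : CovariantDerivative 𝓘(ℝ, E) E (TangentSpace 𝓘(ℝ, E) : M → Type _))

/-- The coordinates of `∇ (coordFrame x₀ · u)` in the chart at `x₀`. -/
def covFrame (x₀ x : M) (u : E) : E →L[ℝ] E :=
  coordVec x₀ x ∘L cov (fun x ↦ coordFrame x₀ x u) x ∘L coordFrame x₀ x

omit [FiniteDimensional ℝ E] in
theorem covFrame_add {x₀ x : M} (hx : x ∈ (chartAt E x₀).source) (u u' : E) :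
    covFrame cov x₀ x (u + u') = covFrame cov x₀ x u + covFrame cov x₀ x u' := by
  have h := cov.isCovariantDerivativeOn.add (mdiffAt_coordFrame hx u) (mdiffAt_coordFrame hx u')
  have e : (fun x ↦ coordFrame x₀ x (u + u')) =
      (fun x ↦ coordFrame x₀ x u) + fun x ↦ coordFrame x₀ x u' := funext fun x ↦ map_add _ _ _
  rw [covFrame, e, h, ContinuousLinearMap.add_comp, ContinuousLinearMap.comp_add]
  rfl

omit [FiniteDimensional ℝ E] in
theorem covFrame_smul {x₀ x : M} (hx : x ∈ (chartAt E x₀).source) (c : ℝ) (u : E) :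
    covFrame cov x₀ x (c • u) = c • covFrame cov x₀ x u := by
  have h := cov.isCovariantDerivativeOn.smul_const c (mdiffAt_coordFrame hx u)
  have e : (fun x ↦ coordFrame x₀ x (c • u)) = c • (fun x ↦ coordFrame x₀ x u) :=
    funext fun x ↦ map_smul _ _ _
  rw [covFrame, e, h, ContinuousLinearMap.smul_comp, ContinuousLinearMap.comp_smul]
  rfl

open Classical in
/-- The Christoffel symbols of a connection in the chart at `x₀`. -/
def connSymbol (x₀ : M) (z : E) : E →L[ℝ] E →L[ℝ] E :=
  if hz : z ∈ (extChartAt 𝓘(ℝ, E) x₀).target then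
    (LinearMap.toContinuousLinearMap
      { toFun := covFrame cov x₀ ((extChartAt 𝓘(ℝ, E) x₀).symm z)
        map_add' := covFrame_add cov (extChartAt_symm_mem hz)
        map_smul' := covFrame_smul cov (extChartAt_symm_mem hz) }).flip
  else 0

theorem connSymbol_apply {x₀ : M} {z : E} (hz : z ∈ (extChartAt 𝓘(ℝ, E) x₀).target) (v u : E) :
    connSymbol cov x₀ z v u = coordVec x₀ ((extChartAt 𝓘(ℝ, E) x₀).symm z)
      (cov (fun x ↦ coordFrame x₀ x u) ((extChartAt 𝓘(ℝ, E) x₀).symm z)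
        (coordFrame x₀ ((extChartAt 𝓘(ℝ, E) x₀).symm z) v)) := by
  rw [connSymbol, dif_pos hz]
  rfl

/-- The induced connection form on bilinear forms in the chart at `x₀`. -/
def chartConn (x₀ : M) (z : E) :
    E →L[ℝ] (E →L[ℝ] E →L[ℝ] ℝ) →L[ℝ] (E →L[ℝ] E →L[ℝ] ℝ) :=
  bilinConn (connSymbol cov x₀ z)

/-- The covariant derivative in the chart at `x₀`. -/
theorem toModel_covForm {x₀ : M} {z : E} (hz : z ∈ (extChartAt 𝓘(ℝ, E) x₀).target)
    {h : Π x : M, BilinAt E x} (hh : DiffFormAt h ((extChartAt 𝓘(ℝ, E) x₀).symm z)) (v : E) :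
    toModel x₀ ((extChartAt 𝓘(ℝ, E) x₀).symm z) (covForm cov h ((extChartAt 𝓘(ℝ, E) x₀).symm z)
        (coordFrame x₀ ((extChartAt 𝓘(ℝ, E) x₀).symm z) v)) =
      fderiv ℝ (formRep x₀ h) z v + chartConn cov x₀ z v (formRep x₀ h z) := by
  have hx := extChartAt_symm_mem hz
  ext u w
  have hd := (diffFormAt_iff hx).1 hh
  rw [(extChartAt 𝓘(ℝ, E) x₀).right_inv hz] at hd
  rw [toModel_apply, covForm_apply cov hh _ (mdiffAt_coordFrame hx u) (mdiffAt_coordFrame hx w),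
    mvfderiv_coordFrame hz (hh.apply (mdiffAt_coordFrame hx u) (mdiffAt_coordFrame hx w))]
  have e : (fun p ↦ h p (coordFrame x₀ p u) (coordFrame x₀ p w)) ∘ (extChartAt 𝓘(ℝ, E) x₀).symm =
    fun z ↦ formRep x₀ h z u w := rfl
  rw [e, ((hd.hasFDerivAt.clm_apply (hasFDerivAt_const u z)).clm_apply
    (hasFDerivAt_const w z)).fderiv]
  simp only [chartConn, _root_.add_apply, bilinConn_apply, connSymbol_apply cov hz, formRep,
    toModel_apply, coordFrame_coordVec hx]
  simp
  ring

variable {cov}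

/-- The smoothness hypothesis is applied to globally smooth fields, but the coordinate frame is
smooth only on the chart domain. It is multiplied by a bump function supported there, and locality
of ∇ shows that nothing changes near the point. -/
theorem contDiffOn_connSymbol [T2Space M] (hsmooth : CovariantDerivative.ContMDiffCovariantDerivative cov ∞)
    (x₀ : M) : ContDiffOn ℝ ∞ (connSymbol cov x₀) (extChartAt 𝓘(ℝ, E) x₀).target := by
  rw [contDiffOn_clm_apply]
  intro v
  rw [contDiffOn_clm_apply]
  intro u z hz
  refine ContDiffAt.contDiffWithinAt ?_
  have hx := extChartAt_symm_mem hz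
  set x := (extChartAt 𝓘(ℝ, E) x₀).symm z with hxdef
  obtain ⟨ψ, -, hψ⟩ := (SmoothBumpFunction.nhds_basis_tsupport (I := 𝓘(ℝ, E)) x).mem_iff.1
    ((chartAt E x₀).open_source.mem_nhds hx)
  set S : Π x : M, TangentSpace 𝓘(ℝ, E) x := (ψ : M → ℝ) • fun x ↦ coordFrame x₀ x u with hS
  have hSsm : ContMDiff 𝓘(ℝ, E) (𝓘(ℝ, E).prod 𝓘(ℝ, E)) ∞ (T% S) :=
    ContMDiffOn.smul_section_of_tsupport (ψ.contMDiff.contMDiffOn) (chartAt E x₀).open_source hψ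
      fun y hy ↦ (cmdiffAt_coordFrame hy u).contMDiffWithinAt
  have hSe : ∀ᶠ y in 𝓝 x, S y = coordFrame x₀ y u := by
    filter_upwards [ψ.eventuallyEq_one] with y hy
    simp [hS, hy]
  have h1 := hsmooth.contMDiff.contMDiff (σ := S) (by simpa [contMDiffOn_univ] using hSsm)
  have h2 : CMDiffAt ∞ (T% (fun p ↦ cov S p (coordFrame x₀ p v))) x :=
    ContMDiffAt.clm_bundle_apply (h1.contMDiffAt Filter.univ_mem) (cmdiffAt_coordFrame hx v)
  rw [cmdiffAt_vec_iff hx, hxdef, (extChartAt 𝓘(ℝ, E) x₀).right_inv hz] at h2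
  refine h2.congr_of_eventuallyEq ?_
  have h3 : ∀ᶠ y in 𝓝 x, cov (fun x ↦ coordFrame x₀ x u) y = cov S y := by
    filter_upwards [hSe.eventually_nhds, eventually_mem_chart hx] with y hy hy'
    exact cov.isCovariantDerivativeOn.congr_of_eventuallyEq (mdiffAt_coordFrame hy' u)
      (hSsm.mdifferentiable (by simp) y) Filter.univ_mem (hy.mono fun _ h ↦ h.symm)
  have hc : ContinuousAt (extChartAt 𝓘(ℝ, E) x₀).symm z := continuousAt_extChartAt_symm'' hz
  filter_upwards [(isOpen_extChartAt_target x₀).mem_nhds hz, hc.eventually h3] with y hy hy'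
  rw [connSymbol_apply cov hy, hy']
  rfl

theorem contDiffOn_chartConn [T2Space M] (hsmooth : CovariantDerivative.ContMDiffCovariantDerivative cov ∞)
    (x₀ : M) : ContDiffOn ℝ ∞ (chartConn cov x₀) (extChartAt 𝓘(ℝ, E) x₀).target :=
  contDiffOn_bilinConn (contDiffOn_connSymbol hsmooth x₀)

variable (cov)

omit [FiniteDimensional ℝ E] in
theorem mlieBracket_eq_lieBracket (V W : Π x : E, TangentSpace 𝓘(ℝ, E) x) (z : E) :
    VectorField.mlieBracket 𝓘(ℝ, E) V W z = VectorField.lieBracket ℝ V W z := by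
  rw [← VectorField.mlieBracketWithin_univ, VectorField.mlieBracketWithin_eq_lieBracketWithin]
  exact congrFun VectorField.lieBracketWithin_univ z

/-- The bracket commutes with pullback along the inverse chart, and that pullback is passage to
components because `coordVec` inverts the derivative of the inverse chart. -/
theorem coordVec_mlieBracket {x₀ : M} {z : E} (hz : z ∈ (extChartAt 𝓘(ℝ, E) x₀).target)
    {X Y : Π x : M, TangentSpace 𝓘(ℝ, E) x}
    (hX : MDiffAt (T% X) ((extChartAt 𝓘(ℝ, E) x₀).symm z))
    (hY : MDiffAt (T% Y) ((extChartAt 𝓘(ℝ, E) x₀).symm z)) :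
    coordVec x₀ ((extChartAt 𝓘(ℝ, E) x₀).symm z)
        (VectorField.mlieBracket 𝓘(ℝ, E) X Y ((extChartAt 𝓘(ℝ, E) x₀).symm z)) =
      fderiv ℝ (vecRep x₀ Y) z (vecRep x₀ X z) - fderiv ℝ (vecRep x₀ X) z (vecRep x₀ Y z) := by
  have hd : ∀ z ∈ (extChartAt 𝓘(ℝ, E) x₀).target,
      (mfderiv 𝓘(ℝ, E) 𝓘(ℝ, E) (extChartAt 𝓘(ℝ, E) x₀).symm z).inverse =
        coordVec x₀ ((extChartAt 𝓘(ℝ, E) x₀).symm z) := by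
    intro z hz
    have hx := extChartAt_symm_mem hz
    have h1 : ∀ v : E, coordFrame x₀ ((extChartAt 𝓘(ℝ, E) x₀).symm z) v =
        mfderiv 𝓘(ℝ, E) 𝓘(ℝ, E) (extChartAt 𝓘(ℝ, E) x₀).symm z v := by
      have := TangentBundle.symmL_trivializationAt (I := 𝓘(ℝ, E)) hx
      rw [(extChartAt 𝓘(ℝ, E) x₀).right_inv hz, modelWithCornersSelf_coe, range_id,
        mfderivWithin_univ] at this
      exact DFunLike.congr_fun this
    refine ContinuousLinearMap.inverse_eq ?_ ?_
    · exact ContinuousLinearMap.ext fun v ↦ (h1 _).symm.trans (coordFrame_coordVec hx v)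
    · exact ContinuousLinearMap.ext fun v ↦
        (congrArg _ (h1 v)).symm.trans (coordVec_coordFrame hx v)
  have : IsManifold 𝓘(ℝ, E) (minSmoothness ℝ 2) M := by
    rw [minSmoothness_of_isRCLikeNormedField]
    exact IsManifold.of_le (n := ∞) (WithTop.coe_le_coe.2 le_top)
  have hC : CompleteSpace E := FiniteDimensional.complete ℝ E
  have hs : ContMDiffAt 𝓘(ℝ, E) 𝓘(ℝ, E) ∞ (extChartAt 𝓘(ℝ, E) x₀).symm z :=
    (contMDiffOn_extChartAt_symm x₀).contMDiffAt ((isOpen_extChartAt_target x₀).mem_nhds hz)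
  have key := VectorField.mpullback_mlieBracket (I := 𝓘(ℝ, E)) hX hY hs (by
    rw [minSmoothness_of_isRCLikeNormedField]; exact WithTop.coe_le_coe.2 le_top)
  have he : ∀ V : Π x : M, TangentSpace 𝓘(ℝ, E) x,
      VectorField.mpullback 𝓘(ℝ, E) 𝓘(ℝ, E) (extChartAt 𝓘(ℝ, E) x₀).symm V =ᶠ[𝓝 z]
        vecRep x₀ V := by
    intro V
    filter_upwards [(isOpen_extChartAt_target x₀).mem_nhds hz] with y hy
    rw [VectorField.mpullback, hd y hy]
    rfl
  rw [(he X).mlieBracket_vectorField_eq (he Y), (he _).self_of_nhds] at key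
  exact key.trans (mlieBracket_eq_lieBracket _ _ z)

omit [FiniteDimensional ℝ E] in
theorem vecRep_coord {x₀ : M} {z : E} (hz : z ∈ (extChartAt 𝓘(ℝ, E) x₀).target)
    (X : Π x : M, TangentSpace 𝓘(ℝ, E) x) :
    coordFrame x₀ ((extChartAt 𝓘(ℝ, E) x₀).symm z) (vecRep x₀ X z) =
      X ((extChartAt 𝓘(ℝ, E) x₀).symm z) :=
  coordFrame_coordVec (extChartAt_symm_mem hz) _

theorem formRep_covForm {x₀ : M} {z : E} (hz : z ∈ (extChartAt 𝓘(ℝ, E) x₀).target)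
    {h : Π x : M, BilinAt E x} (hh : DiffFormAt h ((extChartAt 𝓘(ℝ, E) x₀).symm z))
    (Y : Π x : M, TangentSpace 𝓘(ℝ, E) x) :
    formRep x₀ (fun p ↦ covForm cov h p (Y p)) z =
      fderiv ℝ (formRep x₀ h) z (vecRep x₀ Y z)
        + chartConn cov x₀ z (vecRep x₀ Y z) (formRep x₀ h z) := by
  rw [formRep, ← toModel_covForm cov hz hh, vecRep_coord hz]

/-- The right side involves X, Y and h only through their values at the point: this is the
tensoriality of the curvature. -/
theorem toModel_curvForm [T2Space M]
    (hsmooth : CovariantDerivative.ContMDiffCovariantDerivative cov ∞)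
    {x₀ : M} {z : E} (hz : z ∈ (extChartAt 𝓘(ℝ, E) x₀).target)
    {X Y : Π x : M, TangentSpace 𝓘(ℝ, E) x} {h : Π x : M, BilinAt E x} {U : Set M}
    (hU : IsOpen U) (hzU : (extChartAt 𝓘(ℝ, E) x₀).symm z ∈ U)
    (hX : CMDiff[U] ∞ (T% X)) (hY : CMDiff[U] ∞ (T% Y)) (hh : SmoothFormOn h U) :
    toModel x₀ ((extChartAt 𝓘(ℝ, E) x₀).symm z)
        (curvForm cov X Y h ((extChartAt 𝓘(ℝ, E) x₀).symm z)) =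
      formCurv (chartConn cov x₀) z (vecRep x₀ X z) (vecRep x₀ Y z) (formRep x₀ h z) := by
  have hx := extChartAt_symm_mem hz
  have hUn := hU.mem_nhds hzU
  have hri := (extChartAt 𝓘(ℝ, E) x₀).right_inv hz
  have cX : ContDiffAt ℝ ∞ (vecRep x₀ X) z := by
    have := (cmdiffAt_vec_iff hx).1 (hX.contMDiffAt hUn)
    rwa [hri] at this
  have cY : ContDiffAt ℝ ∞ (vecRep x₀ Y) z := by
    have := (cmdiffAt_vec_iff hx).1 (hY.contMDiffAt hUn)
    rwa [hri] at this
  have ch : ContDiffAt ℝ ∞ (formRep x₀ h) z := by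
    have := (smoothFormAt_iff hx).1 (hh.contMDiffAt hUn)
    rwa [hri] at this
  have cA : ContDiffAt ℝ ∞ (chartConn cov x₀) z :=
    (contDiffOn_chartConn hsmooth x₀).contDiffAt ((isOpen_extChartAt_target x₀).mem_nhds hz)
  have hcont : ContinuousAt (extChartAt 𝓘(ℝ, E) x₀).symm z := continuousAt_extChartAt_symm'' hz
  have ev : ∀ Y : Π x : M, TangentSpace 𝓘(ℝ, E) x, formRep x₀ (fun p ↦ covForm cov h p (Y p)) =ᶠ[𝓝 z]
      fun z ↦ fderiv ℝ (formRep x₀ h) z (vecRep x₀ Y z)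
        + chartConn cov x₀ z (vecRep x₀ Y z) (formRep x₀ h z) := by
    intro Y
    filter_upwards [(isOpen_extChartAt_target x₀).mem_nhds hz, hcont.eventually hUn] with y hy hy'
    exact formRep_covForm cov hy ((hh.contMDiffAt (hU.mem_nhds hy')).mdifferentiableAt (by simp)) Y
  have hcd : ∀ Y : Π x : M, TangentSpace 𝓘(ℝ, E) x, ContDiffAt ℝ ∞ (vecRep x₀ Y) z →
      DiffFormAt (fun p ↦ covForm cov h p (Y p)) ((extChartAt 𝓘(ℝ, E) x₀).symm z) := by
    intro Y cY
    rw [diffFormAt_iff hx, hri, (ev Y).differentiableAt_iff]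
    exact ((((ch.fderiv_right (m := ∞) (by simp)).clm_apply cY).add
      ((cA.clm_apply cY).clm_apply ch))).differentiableAt (by simp)
  have hdh : DiffFormAt h ((extChartAt 𝓘(ℝ, E) x₀).symm z) :=
    (hh.contMDiffAt hUn).mdifferentiableAt (by simp)
  have mX : MDiffAt (T% X) ((extChartAt 𝓘(ℝ, E) x₀).symm z) :=
    (hX.contMDiffAt hUn).mdifferentiableAt (by simp)
  have mY : MDiffAt (T% Y) ((extChartAt 𝓘(ℝ, E) x₀).symm z) :=
    (hY.contMDiffAt hUn).mdifferentiableAt (by simp)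
  have e1 := formRep_covForm cov hz (hcd Y cY) X
  have e2 := formRep_covForm cov hz (hcd X cX) Y
  have e3 := formRep_covForm cov hz hdh (VectorField.mlieBracket 𝓘(ℝ, E) X Y)
  rw [(ev Y).fderiv_eq, (ev Y).self_of_nhds] at e1
  rw [(ev X).fderiv_eq, (ev X).self_of_nhds] at e2
  rw [vecRep, coordVec_mlieBracket hz mX mY] at e3
  rw [curvForm, map_sub, map_sub]
  refine (congrArg₂ (· - ·) (congrArg₂ (· - ·) e1 e2) e3).trans ?_
  exact curvature_eq_formCurv (cA.differentiableAt (by simp))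
    (ch.of_le (WithTop.coe_le_coe.2 le_top)) (cX.differentiableAt (by simp))
    (cY.differentiableAt (by simp))

end ChartConnection

/-! ### Fields of forms prescribed by their components -/

section FieldsOfForms

variable {E : Type*} [NormedAddCommGroup E] [NormedSpace ℝ E]
  {M : Type*} [TopologicalSpace M] [ChartedSpace E M] [IsManifold 𝓘(ℝ, E) ∞ M]

/-- The field of forms with given components in the chart at `x₀`. -/
def formOfRep (x₀ : M) (f : E → E →L[ℝ] E →L[ℝ] ℝ) (x : M) : BilinAt E x :=
  ofModel x₀ x (f (extChartAt 𝓘(ℝ, E) x₀ x))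

theorem formRep_formOfRep {x₀ : M} {z : E} (hz : z ∈ (extChartAt 𝓘(ℝ, E) x₀).target)
    (f : E → E →L[ℝ] E →L[ℝ] ℝ) : formRep x₀ (formOfRep x₀ f) z = f z := by
  rw [formRep, formOfRep, toModel_ofModel (extChartAt_symm_mem hz),
    (extChartAt 𝓘(ℝ, E) x₀).right_inv hz]

theorem formRep_formOfRep_eventuallyEq {x₀ : M} {z : E}
    (hz : z ∈ (extChartAt 𝓘(ℝ, E) x₀).target)
    (f : E → E →L[ℝ] E →L[ℝ] ℝ) : formRep x₀ (formOfRep x₀ f) =ᶠ[𝓝 z] f := by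
  filter_upwards [(isOpen_extChartAt_target x₀).mem_nhds hz] with y hy
  exact formRep_formOfRep hy f

theorem formRep_add (x₀ : M) (h h' : Π x : M, BilinAt E x) :
    formRep x₀ (fun x ↦ h x + h' x) = formRep x₀ h + formRep x₀ h' := by
  ext1 z; exact map_add _ _ _

theorem formRep_smul (x₀ : M) (c : ℝ) (h : Π x : M, BilinAt E x) :
    formRep x₀ (fun x ↦ c • h x) = c • formRep x₀ h := by
  ext1 z; exact map_smul _ _ _

theorem formRep_zero (x₀ : M) : formRep x₀ (fun x ↦ (0 : BilinAt E x)) = 0 := by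
  ext1 z; exact map_zero _

theorem formRep_eventuallyEq {x₀ : M} {z : E} (hz : z ∈ (extChartAt 𝓘(ℝ, E) x₀).target)
    {h h' : Π x : M, BilinAt E x} (e : ∀ᶠ x in 𝓝 ((extChartAt 𝓘(ℝ, E) x₀).symm z), h x = h' x) :
    formRep x₀ h =ᶠ[𝓝 z] formRep x₀ h' := by
  have hc : ContinuousAt (extChartAt 𝓘(ℝ, E) x₀).symm z := continuousAt_extChartAt_symm'' hz
  filter_upwards [hc.eventually e] with y hy
  rw [formRep, formRep, hy]

theorem diffFormAt_iff_of_mem_target {x₀ : M} {z : E} (hz : z ∈ (extChartAt 𝓘(ℝ, E) x₀).target)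
    {h : Π x : M, BilinAt E x} :
    DiffFormAt h ((extChartAt 𝓘(ℝ, E) x₀).symm z) ↔ DifferentiableAt ℝ (formRep x₀ h) z := by
  rw [diffFormAt_iff (extChartAt_symm_mem hz), (extChartAt 𝓘(ℝ, E) x₀).right_inv hz]

/-- The part of the domain of the chart at `x₀` that corresponds to `U`. -/
def chartPart (x₀ : M) (U : Set M) : Set E :=
  (extChartAt 𝓘(ℝ, E) x₀).target ∩ (extChartAt 𝓘(ℝ, E) x₀).symm ⁻¹' U

omit [IsManifold 𝓘(ℝ, E) ∞ M] in
theorem isOpen_chartPart (x₀ : M) {U : Set M} (hU : IsOpen U) : IsOpen (chartPart (E := E) x₀ U) :=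
  (continuousOn_extChartAt_symm x₀).isOpen_inter_preimage (isOpen_extChartAt_target x₀) hU

omit [IsManifold 𝓘(ℝ, E) ∞ M] in
theorem mem_chartPart {x₀ x : M} {U : Set M} (hx : x ∈ (chartAt E x₀).source) (hU : x ∈ U) :
    extChartAt 𝓘(ℝ, E) x₀ x ∈ chartPart x₀ U :=
  ⟨extChartAt_mem_target hx, by rwa [mem_preimage, extChartAt_symm_apply hx]⟩

/-- The part of `M` that corresponds to the subset `Ω` of the chart at `x₀`. -/
def manifoldPart (x₀ : M) (Ω : Set E) : Set M :=
  (chartAt E x₀).source ∩ extChartAt 𝓘(ℝ, E) x₀ ⁻¹' Ω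

omit [IsManifold 𝓘(ℝ, E) ∞ M] in
theorem isOpen_manifoldPart (x₀ : M) {Ω : Set E} (hΩ : IsOpen Ω) :
    IsOpen (manifoldPart x₀ Ω) := by
  have := (continuousOn_extChartAt (I := 𝓘(ℝ, E)) x₀).isOpen_inter_preimage
    (isOpen_extChartAt_source x₀) hΩ
  rwa [extChartAt_source] at this

theorem SmoothFormOn.diffFormAt {U : Set M} (hU : IsOpen U) {h : Π x : M, BilinAt E x}
    (hs : SmoothFormOn h U) {x : M} (hx : x ∈ U) : DiffFormAt h x :=
  (ContMDiffOn.contMDiffAt hs (hU.mem_nhds hx)).mdifferentiableAt (by simp)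

theorem SmoothFormOn.contDiffAt {U : Set M} (hU : IsOpen U) {h : Π x : M, BilinAt E x}
    (hs : SmoothFormOn h U) {x₀ : M} {z : E} (hz : z ∈ chartPart x₀ U) :
    ContDiffAt ℝ ∞ (formRep x₀ h) z := by
  have := (smoothFormAt_iff (extChartAt_symm_mem hz.1)).1
    (ContMDiffOn.contMDiffAt hs (hU.mem_nhds hz.2))
  rwa [(extChartAt 𝓘(ℝ, E) x₀).right_inv hz.1] at this

theorem smoothFormOn_of_contDiffAt {U : Set M} {h : Π x : M, BilinAt E x}
    (hs : ∀ x ∈ U, ∃ x₀, x ∈ (chartAt E x₀).source ∧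
      ContDiffAt ℝ ∞ (formRep x₀ h) (extChartAt 𝓘(ℝ, E) x₀ x)) : SmoothFormOn h U := by
  intro x hx
  obtain ⟨x₀, h1, h2⟩ := hs x hx
  exact ContMDiffAt.contMDiffWithinAt ((smoothFormAt_iff h1).2 h2)

theorem SmoothFormOn.add {U : Set M} (hU : IsOpen U) {h h' : Π x : M, BilinAt E x}
    (hs : SmoothFormOn h U) (hs' : SmoothFormOn h' U) : SmoothFormOn (fun x ↦ h x + h' x) U :=
  smoothFormOn_of_contDiffAt fun x hx ↦ ⟨x, mem_chart_source E x, by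
    rw [formRep_add]
    have := mem_chartPart (mem_chart_source E x) hx
    exact (hs.contDiffAt hU this).add (hs'.contDiffAt hU this)⟩

theorem SmoothFormOn.smul {U : Set M} (hU : IsOpen U) {h : Π x : M, BilinAt E x} (c : ℝ)
    (hs : SmoothFormOn h U) : SmoothFormOn (fun x ↦ c • h x) U :=
  smoothFormOn_of_contDiffAt fun x hx ↦ ⟨x, mem_chart_source E x, by
    rw [formRep_smul]
    exact contDiffAt_const.smul (hs.contDiffAt hU (mem_chartPart (mem_chart_source E x) hx))⟩

theorem smoothFormOn_zero {U : Set M} : SmoothFormOn (fun x ↦ (0 : BilinAt E x)) U :=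
  smoothFormOn_of_contDiffAt fun x hx ↦ ⟨x, mem_chart_source E x, by
    rw [formRep_zero]
    exact contDiffAt_const⟩

theorem SmoothFormOn.mono {U V : Set M} {h : Π x : M, BilinAt E x} (hs : SmoothFormOn h U)
    (hVU : V ⊆ U) : SmoothFormOn h V := ContMDiffOn.mono hs hVU

theorem smoothFormOn_formOfRep {x₀ : M} {f : E → E →L[ℝ] E →L[ℝ] ℝ} {Ω : Set E} (hΩ : IsOpen Ω)
    (hf : ContDiffOn ℝ ∞ f Ω) : SmoothFormOn (formOfRep x₀ f) (manifoldPart x₀ Ω) :=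
  smoothFormOn_of_contDiffAt fun _ hx ↦ ⟨x₀, hx.1,
    (hf.contDiffAt (hΩ.mem_nhds hx.2)).congr_of_eventuallyEq
      (formRep_formOfRep_eventuallyEq (extChartAt_mem_target hx.1) f)⟩

end FieldsOfForms

/-! ### Parallel fields of forms on the manifold -/

section InducedConnection

variable {E : Type*} [NormedAddCommGroup E] [NormedSpace ℝ E] [FiniteDimensional ℝ E]
  {M : Type*} [TopologicalSpace M] [ChartedSpace E M] [IsManifold 𝓘(ℝ, E) ∞ M]
  (cov : CovariantDerivative 𝓘(ℝ, E) E (TangentSpace 𝓘(ℝ, E) : M → Type _))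

theorem toModel_covForm_coord {x₀ x : M} (hx : x ∈ (chartAt E x₀).source)
    {h : Π x : M, BilinAt E x} (hh : DiffFormAt h x) (v : E) :
    toModel x₀ x (covForm cov h x (coordFrame x₀ x v)) =
      fderiv ℝ (formRep x₀ h) (extChartAt 𝓘(ℝ, E) x₀ x) v
        + chartConn cov x₀ (extChartAt 𝓘(ℝ, E) x₀ x) v (toModel x₀ x (h x)) := by
  have hz := extChartAt_mem_target hx
  have e := extChartAt_symm_apply hx
  have := toModel_covForm cov (h := h) hz (by rwa [e]) v
  rw [formRep_extChartAt hx] at this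
  rw [← this, e]

theorem covForm_add {x : M} {h h' : Π x : M, BilinAt E x} (hh : DiffFormAt h x)
    (hh' : DiffFormAt h' x) (v : TangentSpace 𝓘(ℝ, E) x) :
    covForm cov (fun x ↦ h x + h' x) x v = covForm cov h x v + covForm cov h' x v := by
  have hx := mem_chart_source E x
  have d := (diffFormAt_iff hx).1 hh
  have d' := (diffFormAt_iff hx).1 hh'
  have hd : DiffFormAt (fun x ↦ h x + h' x) x := by
    rw [diffFormAt_iff hx, formRep_add]; exact d.add d'
  apply toModel_injective hx
  rw [← coordFrame_coordVec hx v, map_add, toModel_covForm_coord cov hx hd,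
    toModel_covForm_coord cov hx hh, toModel_covForm_coord cov hx hh', formRep_add,
    fderiv_add d d']
  simp only [map_add, _root_.add_apply]
  abel

theorem covForm_smul {x : M} {h : Π x : M, BilinAt E x} (hh : DiffFormAt h x) (c : ℝ)
    (v : TangentSpace 𝓘(ℝ, E) x) :
    covForm cov (fun x ↦ c • h x) x v = c • covForm cov h x v := by
  have hx := mem_chart_source E x
  have d := (diffFormAt_iff hx).1 hh
  have hd : DiffFormAt (fun x ↦ c • h x) x := by
    rw [diffFormAt_iff hx, formRep_smul]; exact d.const_smul c
  apply toModel_injective hx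
  rw [← coordFrame_coordVec hx v, map_smul, toModel_covForm_coord cov hx hd,
    toModel_covForm_coord cov hx hh, formRep_smul, fderiv_const_smul d]
  simp only [map_smul, _root_.smul_apply, smul_add]

theorem covForm_zero (x : M) (v : TangentSpace 𝓘(ℝ, E) x) :
    covForm cov (fun x ↦ (0 : BilinAt E x)) x v = 0 := by
  have hx := mem_chart_source E x
  have hd : DiffFormAt (fun x ↦ (0 : BilinAt E x)) x := by
    rw [diffFormAt_iff hx, formRep_zero]; exact differentiableAt_const _
  have := covForm_smul cov hd 0 v
  simpa using this

/-- Both cases matter: `covForm` has the default value 0 at points of non-differentiability, so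
differentiability must be seen to be local too. -/
theorem covForm_congr {x : M} {h h' : Π x : M, BilinAt E x} (e : ∀ᶠ y in 𝓝 x, h y = h' y)
    (v : TangentSpace 𝓘(ℝ, E) x) : covForm cov h x v = covForm cov h' x v := by
  have hx := mem_chart_source E x
  have hz := extChartAt_mem_target (E := E) hx
  have er : formRep x h =ᶠ[𝓝 (extChartAt 𝓘(ℝ, E) x x)] formRep x h' :=
    formRep_eventuallyEq hz (by rwa [extChartAt_symm_apply hx])
  by_cases hh : DiffFormAt h x
  · have hh' : DiffFormAt h' x := by
      rwa [diffFormAt_iff hx, ← er.differentiableAt_iff, ← diffFormAt_iff hx]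
    apply toModel_injective hx
    rw [← coordFrame_coordVec hx v, toModel_covForm_coord cov hx hh,
      toModel_covForm_coord cov hx hh', er.fderiv_eq, e.self_of_nhds]
  · have hh' : ¬ DiffFormAt h' x := by
      rwa [diffFormAt_iff hx, ← er.differentiableAt_iff, ← diffFormAt_iff hx]
    rw [covForm, dif_neg hh, covForm, dif_neg hh']

/-- `h` is differentiable and parallel on `U`. -/
def IsParallelOn (h : Π x : M, BilinAt E x) (U : Set M) : Prop :=
  ∀ x ∈ U, DiffFormAt h x ∧ ∀ v, covForm cov h x v = 0

variable {cov}

theorem IsParallelOn.mono {h : Π x : M, BilinAt E x} {U V : Set M} (hh : IsParallelOn cov h U)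
    (hVU : V ⊆ U) : IsParallelOn cov h V := fun x hx ↦ hh x (hVU hx)

theorem IsParallelOn.congr {h h' : Π x : M, BilinAt E x} {U : Set M} (hU : IsOpen U)
    (hh : IsParallelOn cov h U) (e : ∀ x ∈ U, h x = h' x) : IsParallelOn cov h' U := by
  intro x hx
  have e' : ∀ᶠ y in 𝓝 x, h y = h' y := by
    filter_upwards [hU.mem_nhds hx] with y hy using e y hy
  refine ⟨?_, fun v ↦ by rw [← covForm_congr cov e' v]; exact (hh x hx).2 v⟩
  have hc := mem_chart_source E x
  rw [diffFormAt_iff hc, ← (formRep_eventuallyEq (extChartAt_mem_target hc)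
    (by rwa [extChartAt_symm_apply hc])).differentiableAt_iff, ← diffFormAt_iff hc]
  exact (hh x hx).1

theorem IsParallelOn.add {h h' : Π x : M, BilinAt E x} {U : Set M} (hh : IsParallelOn cov h U)
    (hh' : IsParallelOn cov h' U) : IsParallelOn cov (fun x ↦ h x + h' x) U := by
  intro x hx
  refine ⟨?_, fun v ↦ by rw [covForm_add cov (hh x hx).1 (hh' x hx).1, (hh x hx).2,
    (hh' x hx).2, add_zero]⟩
  have hc := mem_chart_source E x
  rw [diffFormAt_iff hc, formRep_add]
  exact ((diffFormAt_iff hc).1 (hh x hx).1).add ((diffFormAt_iff hc).1 (hh' x hx).1)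

theorem IsParallelOn.smul {h : Π x : M, BilinAt E x} {U : Set M} (hh : IsParallelOn cov h U)
    (c : ℝ) : IsParallelOn cov (fun x ↦ c • h x) U := by
  intro x hx
  refine ⟨?_, fun v ↦ by rw [covForm_smul cov (hh x hx).1, (hh x hx).2, smul_zero]⟩
  have hc := mem_chart_source E x
  rw [diffFormAt_iff hc, formRep_smul]
  exact ((diffFormAt_iff hc).1 (hh x hx).1).const_smul c

theorem isParallelOn_zero {U : Set M} : IsParallelOn cov (fun x ↦ (0 : BilinAt E x)) U := by
  intro x hx
  have hc := mem_chart_source E x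
  refine ⟨?_, covForm_zero cov x⟩
  rw [diffFormAt_iff hc, formRep_zero]
  exact differentiableAt_const _

theorem IsParallelOn.sum {ι : Type*} (s : Finset ι) {h : ι → Π x : M, BilinAt E x} {U : Set M}
    (hh : ∀ i ∈ s, IsParallelOn cov (h i) U) : IsParallelOn cov (fun x ↦ ∑ i ∈ s, h i x) U := by
  classical
  induction s using Finset.induction_on with
  | empty => simpa using isParallelOn_zero
  | insert i s hi ih =>
    simp only [Finset.sum_insert hi]
    exact (hh i (s.mem_insert_self i)).add (ih fun j hj ↦ hh j (Finset.mem_insert_of_mem hj))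

theorem IsParallelOn.parallelOn {h : Π x : M, BilinAt E x} {U : Set M}
    (hh : IsParallelOn cov h U) (x₀ : M) :
    ParallelOn (chartConn cov x₀) (formRep x₀ h) (chartPart x₀ U) := by
  rintro z ⟨hz, hzU⟩
  obtain ⟨h1, h2⟩ := hh _ hzU
  have h3 := (diffFormAt_iff_of_mem_target hz).1 h1
  refine h3.hasFDerivAt.congr_fderiv ?_
  ext1 v
  have := toModel_covForm cov hz h1 v
  rw [h2, map_zero] at this
  exact eq_neg_of_add_eq_zero_left this.symm

theorem isParallelOn_of_parallelOn {h : Π x : M, BilinAt E x} {x₀ : M} {Ω : Set E}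
    (hf : ParallelOn (chartConn cov x₀) (formRep x₀ h) Ω) :
    IsParallelOn cov h (manifoldPart x₀ Ω) := by
  rintro x ⟨hx, hxΩ⟩
  have h1 := hf _ hxΩ
  have hd := (diffFormAt_iff hx).2 h1.differentiableAt
  refine ⟨hd, fun v ↦ toModel_injective hx ?_⟩
  rw [← coordFrame_coordVec hx v, toModel_covForm_coord cov hx hd, h1.fderiv, map_zero,
    ← formRep_extChartAt hx]
  simp [applyForm]

/-- The parallel equation upgrades differentiability to smoothness, by bootstrapping in a chart. -/
theorem IsParallelOn.smoothFormOn [T2Space M]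
    (hsmooth : CovariantDerivative.ContMDiffCovariantDerivative cov ∞)
    {h : Π x : M, BilinAt E x} {U : Set M} (hU : IsOpen U) (hh : IsParallelOn cov h U) :
    SmoothFormOn h U :=
  smoothFormOn_of_contDiffAt fun x hx ↦ ⟨x, mem_chart_source E x, by
    have ho := isOpen_chartPart (E := E) x hU
    exact ((hh.parallelOn x).contDiffOn ho ((contDiffOn_chartConn hsmooth x).mono fun z hz ↦ hz.1)
      ).contDiffAt (ho.mem_nhds (mem_chartPart (mem_chart_source E x) hx))⟩

/-- Local parallel transport, acting on all parallel fields of bilinear forms. -/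
theorem exists_local_transport [T2Space M]
    (hsmooth : CovariantDerivative.ContMDiffCovariantDerivative cov ∞) {U : Set M} (hU : IsOpen U)
    {x : M} (hx : x ∈ U) :
    ∃ N : Set M, IsOpen N ∧ x ∈ N ∧ N ⊆ U ∧ ∀ a ∈ N, ∀ b ∈ N,
      ∃ T : TangentSpace 𝓘(ℝ, E) a →ₗ[ℝ] TangentSpace 𝓘(ℝ, E) b, Function.Injective T ∧
        ∀ h : Π x : M, BilinAt E x, IsParallelOn cov h N → ∀ u w, h b (T u) (T w) = h a u w := by
  have hc := mem_chart_source E x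
  obtain ⟨ρ, hρ, hsub, hT⟩ := exists_transport (isOpen_chartPart (E := E) x hU)
    (((contDiffOn_connSymbol hsmooth x).mono fun z hz ↦ hz.1).of_le (by simp))
    (mem_chartPart hc hx)
  have hN : manifoldPart x (Metric.ball (extChartAt 𝓘(ℝ, E) x x) ρ) ⊆ U := by
    rintro y ⟨hy, hy'⟩
    have := (hsub hy').2
    rwa [mem_preimage, extChartAt_symm_apply hy] at this
  refine ⟨manifoldPart x (Metric.ball (extChartAt 𝓘(ℝ, E) x x) ρ), isOpen_manifoldPart x
    Metric.isOpen_ball, ⟨hc, Metric.mem_ball_self hρ⟩, hN, ?_⟩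
  rintro a ⟨ha, ha'⟩ b ⟨hb, hb'⟩
  obtain ⟨T, hTi, hT⟩ := hT _ ha' _ hb'
  refine ⟨(coordFrame x b ∘L T ∘L coordVec x a).toLinearMap, ?_, ?_⟩
  · have h1 : Function.Injective (coordFrame (E := E) x b) :=
      Function.LeftInverse.injective (coordVec_coordFrame hb)
    have h2 : Function.Injective (coordVec (E := E) x a) :=
      Function.LeftInverse.injective (coordFrame_coordVec ha)
    exact h1.comp (hTi.comp h2)
  · intro h hh u w
    have hp := (hh.parallelOn x).mono (U := chartPart x _)
      (V := Metric.ball (extChartAt 𝓘(ℝ, E) x x) ρ) (fun z hz ↦ ⟨(hsub hz).1, by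
        refine ⟨extChartAt_symm_mem (hsub hz).1, ?_⟩
        rwa [mem_preimage, (extChartAt 𝓘(ℝ, E) x).right_inv (hsub hz).1]⟩)
    have := hT _ hp (coordVec x a u) (coordVec x a w)
    rw [formRep_extChartAt ha, formRep_extChartAt hb, toModel_apply, toModel_apply,
      coordFrame_coordVec ha, coordFrame_coordVec ha] at this
    exact this

end InducedConnection

/-! ### The derived flag: linearity, stabilisation, parallel fields -/

section Flag

variable {E : Type*} [NormedAddCommGroup E] [NormedSpace ℝ E] [FiniteDimensional ℝ E]
  {M : Type*} [TopologicalSpace M] [ChartedSpace E M] [IsManifold 𝓘(ℝ, E) ∞ M]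

/-- The fibres of `V` are linear subspaces. -/
structure IsLinearSubset (V : FormSubset E M) : Prop where
  zero : ∀ x, (0 : BilinAt E x) ∈ V x
  add : ∀ x, ∀ w ∈ V x, ∀ w' ∈ V x, w + w' ∈ V x
  smul : ∀ x (c : ℝ), ∀ w ∈ V x, c • w ∈ V x

/-- The fibre of a linear subset, as a submodule. -/
def IsLinearSubset.fibre {V : FormSubset E M} (hV : IsLinearSubset V) (x : M) :
    Submodule ℝ (BilinAt E x) where
  carrier := V x
  zero_mem' := hV.zero x
  add_mem' := fun {w w'} hw hw' ↦ hV.add x w hw w' hw'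
  smul_mem' c w hw := hV.smul x c w hw

omit [FiniteDimensional ℝ E] in
theorem IsLocalSection.mono {V V' : FormSubset E M} {U U' : Set M} {h : Π x : M, BilinAt E x}
    (hh : IsLocalSection V U h) (hV : ∀ x, V x ⊆ V' x) (hU' : IsOpen U') (hU : U' ⊆ U) :
    IsLocalSection V' U' h :=
  ⟨hU', hh.smooth.mono hU, fun x hx ↦ hV x (hh.mem x (hU hx))⟩

omit [FiniteDimensional ℝ E] in
theorem IsLinearSubset.add_section {V : FormSubset E M} (hV : IsLinearSubset V) {U : Set M}
    {h h' : Π x : M, BilinAt E x} (hh : IsLocalSection V U h) (hh' : IsLocalSection V U h') :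
    IsLocalSection V U (fun x ↦ h x + h' x) :=
  ⟨hh.isOpen, hh.smooth.add hh.isOpen hh'.smooth, fun x hx ↦
    hV.add x _ (hh.mem x hx) _ (hh'.mem x hx)⟩

omit [FiniteDimensional ℝ E] in
theorem IsLinearSubset.smul_section {V : FormSubset E M} (hV : IsLinearSubset V) {U : Set M} (c : ℝ)
    {h : Π x : M, BilinAt E x} (hh : IsLocalSection V U h) :
    IsLocalSection V U (fun x ↦ c • h x) :=
  ⟨hh.isOpen, hh.smooth.smul hh.isOpen c, fun x hx ↦ hV.smul x c _ (hh.mem x hx)⟩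

omit [FiniteDimensional ℝ E] in
theorem IsLinearSubset.zero_section {V : FormSubset E M} (hV : IsLinearSubset V) :
    IsLocalSection V univ (fun _ ↦ 0) :=
  ⟨isOpen_univ, smoothFormOn_zero, fun x _ ↦ hV.zero x⟩

omit [FiniteDimensional ℝ E] in
theorem IsLinearSubset.sectionHull {V : FormSubset E M} (hV : IsLinearSubset V) :
    IsLinearSubset (sectionHull V) where
  zero x := ⟨univ, _, mem_univ _, hV.zero_section, rfl⟩
  add x := by
    rintro w ⟨U, h, hx, hh, rfl⟩ w' ⟨U', h', hx', hh', rfl⟩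
    exact ⟨U ∩ U', _, ⟨hx, hx'⟩, hV.add_section
      (hh.mono (fun _ ↦ Subset.rfl) (hh.isOpen.inter hh'.isOpen) inter_subset_left)
      (hh'.mono (fun _ ↦ Subset.rfl) (hh.isOpen.inter hh'.isOpen) inter_subset_right), rfl⟩
  smul x c := by
    rintro w ⟨U, h, hx, hh, rfl⟩
    exact ⟨U, _, hx, hV.smul_section c hh, rfl⟩

variable (cov : CovariantDerivative 𝓘(ℝ, E) E (TangentSpace 𝓘(ℝ, E) : M → Type _))

theorem IsLinearSubset.kerSecondFund {V : FormSubset E M} (hV : IsLinearSubset V) :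
    IsLinearSubset (kerSecondFund cov V) where
  zero x := ⟨univ, _, mem_univ _, hV.zero_section, rfl, fun v ↦ by
    rw [covForm_zero]; exact hV.zero x⟩
  add x := by
    rintro w ⟨U, h, hx, hh, rfl, hc⟩ w' ⟨U', h', hx', hh', rfl, hc'⟩
    refine ⟨U ∩ U', _, ⟨hx, hx'⟩, hV.add_section
      (hh.mono (fun _ ↦ Subset.rfl) (hh.isOpen.inter hh'.isOpen) inter_subset_left)
      (hh'.mono (fun _ ↦ Subset.rfl) (hh.isOpen.inter hh'.isOpen) inter_subset_right), rfl,
      fun v ↦ ?_⟩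
    rw [covForm_add cov (hh.smooth.diffFormAt hh.isOpen hx)
      (hh'.smooth.diffFormAt hh'.isOpen hx')]
    exact hV.add x _ (hc v) _ (hc' v)
  smul x c := by
    rintro w ⟨U, h, hx, hh, rfl, hc⟩
    refine ⟨U, _, hx, hV.smul_section c hh, rfl, fun v ↦ ?_⟩
    rw [covForm_smul cov (hh.smooth.diffFormAt hh.isOpen hx)]
    exact hV.smul x c _ (hc v)

theorem kerSecondFund_subset (V : FormSubset E M) (x : M) : kerSecondFund cov V x ⊆ V x := by
  rintro w ⟨U, h, hx, hh, rfl, -⟩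
  exact hh.mem x hx

omit [FiniteDimensional ℝ E] in
theorem sectionHull_subset (V : FormSubset E M) (x : M) : sectionHull V x ⊆ V x := by
  rintro w ⟨U, h, hx, hh, rfl⟩
  exact hh.mem x hx

theorem derivedFlag_succ_subset (i : ℕ) (x : M) :
    derivedFlag cov (i + 1) x ⊆ derivedFlag cov i x :=
  (sectionHull_subset _ x).trans (kerSecondFund_subset cov _ x)

theorem derivedFlag_antitone {i j : ℕ} (hij : i ≤ j) (x : M) :
    derivedFlag cov j x ⊆ derivedFlag cov i x :=
  antitone_nat_of_succ_le (f := fun i ↦ derivedFlag cov i x)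
    (fun i ↦ derivedFlag_succ_subset cov i x) hij

theorem maximalFlat_subset (i : ℕ) (x : M) : maximalFlat cov x ⊆ derivedFlag cov i x :=
  iInter_subset _ i

variable {cov} [T2Space M]

theorem curvForm_eq_zero_iff (hsmooth : CovariantDerivative.ContMDiffCovariantDerivative cov ∞)
    {x₀ x : M} (hx : x ∈ (chartAt E x₀).source)
    {X Y : Π x : M, TangentSpace 𝓘(ℝ, E) x} {h : Π x : M, BilinAt E x} {U : Set M}
    (hU : IsOpen U) (hxU : x ∈ U) (hX : CMDiff[U] ∞ (T% X)) (hY : CMDiff[U] ∞ (T% Y))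
    (hh : SmoothFormOn h U) :
    curvForm cov X Y h x = 0 ↔
      formCurv (chartConn cov x₀) (extChartAt 𝓘(ℝ, E) x₀ x) (coordVec x₀ x (X x))
        (coordVec x₀ x (Y x)) (toModel x₀ x (h x)) = 0 := by
  have := toModel_curvForm cov hsmooth (extChartAt_mem_target hx)
    hU (by rwa [extChartAt_symm_apply hx]) hX hY hh
  rw [vecRep_extChartAt hx, vecRep_extChartAt hx, formRep_extChartAt hx] at this
  rw [← this, extChartAt_symm_apply hx, map_eq_zero_iff _ (toModel_injective hx)]

/-- By tensoriality the extensions are irrelevant, which leaves a linear condition in the fibre. For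
the forward direction, fields with constant components serve as extensions. -/
theorem mem_flatForms_iff (hsmooth : CovariantDerivative.ContMDiffCovariantDerivative cov ∞)
    {x₀ x : M} (hx : x ∈ (chartAt E x₀).source) (w : BilinAt E x) :
    w ∈ flatForms cov x ↔ IsSymmForm w ∧ ∀ u v : E, formCurv (chartConn cov x₀)
      (extChartAt 𝓘(ℝ, E) x₀ x) u v (toModel x₀ x w) = 0 := by
  refine and_congr_right fun hw ↦ ⟨fun H u v ↦ ?_, fun H U X Y h hxU hX hY hh e ↦ ?_⟩
  · have hs : SmoothFormOn (formOfRep x₀ fun _ ↦ toModel x₀ x w) (chartAt E x₀).source := by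
      have := smoothFormOn_formOfRep (x₀ := x₀) (Ω := univ) isOpen_univ
        (contDiffOn_const (c := toModel x₀ x w))
      simpa [manifoldPart] using this
    have hval : formOfRep x₀ (fun _ ↦ toModel x₀ x w) x = w := ofModel_toModel hx w
    have hsym : IsLocalSection symmForms (chartAt E x₀).source
        (formOfRep x₀ fun _ ↦ toModel x₀ x w) := by
      refine ⟨(chartAt E x₀).open_source, hs, fun y hy ↦ ?_⟩
      rw [symmForms, mem_ofPred_eq, isSymmForm_iff_toModel hy, formOfRep, toModel_ofModel hy]
      exact (isSymmForm_iff_toModel hx w).1 hw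
    have hX : ∀ u : E, CMDiff[(chartAt E x₀).source] ∞ (T% (fun y ↦ coordFrame x₀ y u)) :=
      fun u y hy ↦ (cmdiffAt_coordFrame hy u).contMDiffWithinAt
    have := H _ _ _ _ hx (hX u) (hX v) hsym hval
    rw [curvForm_eq_zero_iff hsmooth hx (chartAt E x₀).open_source hx (hX u) (hX v) hs, hval,
      coordVec_coordFrame hx, coordVec_coordFrame hx] at this
    exact this
  · rw [curvForm_eq_zero_iff hsmooth hx hh.isOpen hxU hX hY hh.smooth, e]
    exact H _ _

theorem isLinearSubset_flatForms
    (hsmooth : CovariantDerivative.ContMDiffCovariantDerivative cov ∞) :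
    IsLinearSubset (flatForms cov) where
  zero x := (mem_flatForms_iff hsmooth (mem_chart_source E x) _).2 ⟨fun _ _ ↦ rfl, fun u v ↦ by rw [map_zero, map_zero]⟩
  add x w hw w' hw' := by
    rw [mem_flatForms_iff hsmooth (mem_chart_source E x)] at *
    refine ⟨fun u v ↦ ?_, fun u v ↦ by rw [map_add, map_add, hw.2, hw'.2, add_zero]⟩
    simp only [_root_.add_apply, hw.1 u v, hw'.1 u v]
  smul x c w hw := by
    rw [mem_flatForms_iff hsmooth (mem_chart_source E x)] at *
    refine ⟨fun u v ↦ ?_, fun u v ↦ by rw [map_smul, map_smul, hw.2, smul_zero]⟩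
    simp only [_root_.smul_apply, hw.1 u v]

theorem isLinearSubset_derivedFlag
    (hsmooth : CovariantDerivative.ContMDiffCovariantDerivative cov ∞) (i : ℕ) :
    IsLinearSubset (derivedFlag cov i) := by
  induction i with
  | zero => exact (isLinearSubset_flatForms hsmooth).sectionHull
  | succ i ih => exact (ih.kerSecondFund cov).sectionHull

theorem isLinearSubset_maximalFlat
    (hsmooth : CovariantDerivative.ContMDiffCovariantDerivative cov ∞) :
    IsLinearSubset (maximalFlat cov) where
  zero x := mem_iInter.2 fun i ↦ (isLinearSubset_derivedFlag hsmooth i).zero x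
  add x w hw w' hw' := mem_iInter.2 fun i ↦ (isLinearSubset_derivedFlag hsmooth i).add x w
    (mem_iInter.1 hw i) w' (mem_iInter.1 hw' i)
  smul x c w hw := mem_iInter.2 fun i ↦ (isLinearSubset_derivedFlag hsmooth i).smul x c w
    (mem_iInter.1 hw i)

omit [T2Space M] in
theorem mem_flatForms_of_mem_maximalFlat {x : M} {w : BilinAt E x} (hw : w ∈ maximalFlat cov x) :
    w ∈ flatForms cov x :=
  sectionHull_subset _ x (maximalFlat_subset cov 0 x hw)

/-- A descending chain of subspaces of a finite-dimensional fibre stabilises. The step depends on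
the point, which is what makes the Baire argument below necessary. -/
theorem exists_maximalFlat_eq (hsmooth : CovariantDerivative.ContMDiffCovariantDerivative cov ∞)
    (x : M) : ∃ i, derivedFlag cov i x ⊆ maximalFlat cov x := by
  have : FiniteDimensional ℝ (BilinAt E x) :=
    FiniteDimensional.of_injective (toModel x x) (toModel_injective (mem_chart_source E x))
  let f : ℕ →o (Submodule ℝ (BilinAt E x))ᵒᵈ :=
    ⟨fun i ↦ OrderDual.toDual ((isLinearSubset_derivedFlag hsmooth i).fibre x),
      fun i j hij ↦ derivedFlag_antitone cov hij x⟩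
  obtain ⟨i, hi⟩ := IsArtinian.monotone_stabilizes f
  refine ⟨i, fun w hw ↦ mem_iInter.2 fun j ↦ ?_⟩
  rcases le_total i j with h | h
  · have := congrArg (fun S : (Submodule ℝ (BilinAt E x))ᵒᵈ ↦
      ((OrderDual.ofDual S : Submodule ℝ (BilinAt E x)) : Set (BilinAt E x))) (hi j h)
    exact this.subset hw
  · exact derivedFlag_antitone cov h x hw

/-- Parallel fields of symmetric forms take values in the maximal flat subset. -/
theorem IsParallelOn.mem_maximalFlat
    (hsmooth : CovariantDerivative.ContMDiffCovariantDerivative cov ∞) {U : Set M} (hU : IsOpen U)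
    {h : Π x : M, BilinAt E x} (hh : IsParallelOn cov h U) (hs : ∀ x ∈ U, IsSymmForm (h x))
    {x : M} (hx : x ∈ U) : h x ∈ maximalFlat cov x := by
  have hsm := hh.smoothFormOn hsmooth hU
  -- The induction runs over all points of U at once: h itself is the section required at every
  -- stage, and ∇h = 0 lies in each member of the flag.
  have key : ∀ i, IsLocalSection (derivedFlag cov i) U h := by
    intro i
    induction i with
    | zero =>
      have : IsLocalSection (flatForms cov) U h := by
        refine ⟨hU, hsm, fun x hx ↦ ?_⟩
        refine (mem_flatForms_iff hsmooth (mem_chart_source E x) _).2 ⟨hs x hx, fun u v ↦ ?_⟩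
        have hc := mem_chart_source E x
        have hX : ∀ u : E, CMDiff[U ∩ (chartAt E x).source] ∞ (T% (fun y ↦ coordFrame x y u)) :=
          fun u y hy ↦ (cmdiffAt_coordFrame hy.2 u).contMDiffWithinAt
        have h1 := (curvForm_eq_zero_iff hsmooth hc (hU.inter (chartAt E x).open_source) ⟨hx, hc⟩
          (hX u) (hX v) (hsm.mono inter_subset_left)).1 (by
            have h0 : ∀ Y : Π x : M, TangentSpace 𝓘(ℝ, E) x,
                ∀ᶠ y in 𝓝 x, covForm cov h y (Y y) = 0 := by
              intro Y
              filter_upwards [hU.mem_nhds hx] with y hy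
              exact (hh y hy).2 _
            rw [curvForm, covForm_congr cov (h0 _), covForm_congr cov (h0 _), (hh x hx).2,
              covForm_zero, covForm_zero, sub_zero, sub_zero])
        rwa [coordVec_coordFrame hc, coordVec_coordFrame hc] at h1
      exact ⟨hU, hsm, fun x hx ↦ ⟨U, h, hx, this, rfl⟩⟩
    | succ i ih =>
      have : IsLocalSection (kerSecondFund cov (derivedFlag cov i)) U h :=
        ⟨hU, hsm, fun x hx ↦ ⟨U, h, hx, ih, rfl, fun v ↦ by
          rw [(hh x hx).2]; exact (isLinearSubset_derivedFlag hsmooth i).zero x⟩⟩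
      exact ⟨hU, hsm, fun x hx ↦ ⟨U, h, hx, this, rfl⟩⟩
  exact mem_iInter.2 fun i ↦ (key i).mem x hx

end Flag

/-! ### Smooth frames of a subbundle -/

section BundleFrames

variable {E : Type*} [NormedAddCommGroup E] [NormedSpace ℝ E]
  {M : Type*} [TopologicalSpace M] [ChartedSpace E M] [IsManifold 𝓘(ℝ, E) ∞ M]
  {V : FormSubset E M} {n : ℕ}

/-- Openness of U is carried by the sections of the frame. In rank 0 there are none, and U is
replaced by the whole manifold. -/
theorem IsVectorBundleOfRank.exists_open_frame (hV : IsVectorBundleOfRank V n) (x : M) :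
    ∃ (U : Set M) (h : Fin n → Π x : M, BilinAt E x), IsOpen U ∧ x ∈ U ∧
      (∀ i, IsLocalSection V U (h i)) ∧ ∀ y ∈ U, IsFibreBasis V h y := by
  rcases n with _ | n
  · refine ⟨univ, fun i ↦ i.elim0, isOpen_univ, mem_univ _, fun i ↦ i.elim0, fun y _ ↦ ?_⟩
    obtain ⟨U, h, hy, -, hb⟩ := hV y
    have : h = fun i ↦ i.elim0 := funext fun i ↦ i.elim0
    exact this ▸ hb y hy
  · obtain ⟨U, h, hx, hh, hb⟩ := hV x
    exact ⟨U, h, (hh 0).isOpen, hx, hh, hb⟩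

omit [IsManifold 𝓘(ℝ, E) ∞ M] in
theorem IsFibreBasis.mem_iff {h : Fin n → Π x : M, BilinAt E x} {x : M} (hb : IsFibreBasis V h x)
    (w : BilinAt E x) : w ∈ V x ↔ ∃ c : Fin n → ℝ, ∑ i, c i • h i x = w := by
  rw [← hb.2, SetLike.mem_coe, Submodule.mem_span_range_iff_exists_fun]

variable [FiniteDimensional ℝ E]

/-- The components of a smooth local frame, with a smooth left inverse. -/
theorem IsVectorBundleOfRank.exists_chart_frame (hV : IsVectorBundleOfRank V n) (x₀ : M) :
    ∃ (Ω : Set E) (J : E → (Fin n → ℝ) →L[ℝ] (E →L[ℝ] E →L[ℝ] ℝ))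
      (L : E → (E →L[ℝ] E →L[ℝ] ℝ) →L[ℝ] (Fin n → ℝ)),
      IsOpen Ω ∧ extChartAt 𝓘(ℝ, E) x₀ x₀ ∈ Ω ∧ Ω ⊆ (extChartAt 𝓘(ℝ, E) x₀).target ∧
      ContDiffOn ℝ ∞ J Ω ∧ ContDiffOn ℝ ∞ L Ω ∧ (∀ z ∈ Ω, ∀ c, L z (J z c) = c) ∧
      ∀ x ∈ manifoldPart x₀ Ω, ∀ w : BilinAt E x,
        w ∈ V x ↔ ∃ c, J (extChartAt 𝓘(ℝ, E) x₀ x) c = toModel x₀ x w := by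
  obtain ⟨U, h, hU, hx₀, hh, hb⟩ := hV.exists_open_frame x₀
  let J : E → (Fin n → ℝ) →L[ℝ] (E →L[ℝ] E →L[ℝ] ℝ) := fun z ↦
    ∑ i, (ContinuousLinearMap.proj i : (Fin n → ℝ) →L[ℝ] ℝ).smulRight (formRep x₀ (h i) z)
  have hJa : ∀ z c, J z c = ∑ i, c i • formRep x₀ (h i) z := fun z c ↦ by
    simp [J]
  have hJx : ∀ x ∈ (chartAt E x₀).source, ∀ c, J (extChartAt 𝓘(ℝ, E) x₀ x) c =
      toModel x₀ x (∑ i, c i • h i x) := fun x hx c ↦ by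
    rw [hJa, map_sum]
    simp only [formRep_extChartAt hx, map_smul]
  have hJs : ContDiffOn ℝ ∞ J (chartPart x₀ U) := by
    rw [contDiffOn_clm_apply]
    intro c
    simp only [hJa]
    exact ContDiffOn.sum fun i _ z hz ↦ ((contDiffAt_const (c := c i)).smul
      ((hh i).smooth.contDiffAt hU hz)).contDiffWithinAt
  have hc := mem_chart_source E x₀
  have hinj : Function.Injective (J (extChartAt 𝓘(ℝ, E) x₀ x₀)) := by
    rw [injective_iff_map_eq_zero]
    intro c hc0
    rw [hJx x₀ hc, map_eq_zero_iff _ (toModel_injective hc)] at hc0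
    exact funext (Fintype.linearIndependent_iff.1 (hb x₀ hx₀).1 c hc0)
  obtain ⟨N, L, hN, hzN, hNsub, hL, hLJ⟩ := exists_contDiffOn_leftInverse
    (isOpen_chartPart x₀ hU) hJs (mem_chartPart hc hx₀) hinj
  refine ⟨N, J, L, hN, hzN, fun z hz ↦ (hNsub hz).1, hJs.mono hNsub, hL, hLJ, ?_⟩
  rintro x ⟨hx, hxN⟩ w
  have hxU : x ∈ U := by
    have := (hNsub hxN).2
    rwa [mem_preimage, extChartAt_symm_apply hx] at this
  rw [(hb x hxU).mem_iff]
  refine exists_congr fun c ↦ ?_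
  rw [hJx x hx, (toModel_injective hx).eq_iff]

/-- A subbundle is closed. -/
theorem IsVectorBundleOfRank.mem_of_frequently (hV : IsVectorBundleOfRank V n) {x : M}
    {s : Π x : M, BilinAt E x} (hs : ContinuousAt (formRep x s) (extChartAt 𝓘(ℝ, E) x x))
    (hf : ∃ᶠ y in 𝓝 x, s y ∈ V y) : s x ∈ V x := by
  obtain ⟨Ω, J, L, hΩ, hx, -, hJ, hL, hLJ, hmem⟩ := hV.exists_chart_frame x
  have hc := mem_chart_source E x
  have hn := hΩ.mem_nhds hx
  have hxm : x ∈ manifoldPart x Ω := ⟨hc, hx⟩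
  -- G = s - J L s is continuous at the point and vanishes wherever s lies in the subbundle.
  -- Vanishing at points arbitrarily near forces vanishing at the limit, so that s = J(L s) there.
  set G : E → E →L[ℝ] E →L[ℝ] ℝ := fun z ↦ formRep x s z - J z (L z (formRep x s z)) with hG
  have hGc : ContinuousAt G (extChartAt 𝓘(ℝ, E) x x) :=
    hs.sub ((hJ.continuousOn.continuousAt hn).clm_apply
      ((hL.continuousOn.continuousAt hn).clm_apply hs))
  have hGz : ∀ y ∈ manifoldPart x Ω, s y ∈ V y → G (extChartAt 𝓘(ℝ, E) x y) = 0 := by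
    intro y hy hsy
    obtain ⟨c, hc⟩ := (hmem y hy _).1 hsy
    rw [hG]
    dsimp only
    rw [formRep_extChartAt hy.1, ← hc, hLJ _ hy.2, sub_self]
  have h0 : G (extChartAt 𝓘(ℝ, E) x x) = 0 := by
    by_contra hne
    have h1 : ∀ᶠ y in 𝓝 x, G (extChartAt 𝓘(ℝ, E) x y) ≠ 0 :=
      (continuousAt_extChartAt (I := 𝓘(ℝ, E)) x).eventually (hGc.eventually_ne hne)
    have h2 : ∀ᶠ y in 𝓝 x, y ∈ manifoldPart x Ω := (isOpen_manifoldPart x hΩ).mem_nhds hxm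
    obtain ⟨y, hy, hy1, hy2⟩ := (hf.and_eventually (h1.and h2)).exists
    exact hy1 (hGz y hy2 hy)
  refine (hmem x hxm _).2
    ⟨L (extChartAt 𝓘(ℝ, E) x x) (formRep x s (extChartAt 𝓘(ℝ, E) x x)), ?_⟩
  rw [← formRep_extChartAt hc]
  exact (sub_eq_zero.1 h0).symm

/-- The covariant derivative of a section of a subbundle at a zero lies in the subbundle. -/
theorem IsVectorBundleOfRank.covForm_mem (hV : IsVectorBundleOfRank V n)
    (cov : CovariantDerivative 𝓘(ℝ, E) E (TangentSpace 𝓘(ℝ, E) : M → Type _)) {U : Set M}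
    {d : Π x : M, BilinAt E x} (hd : IsLocalSection V U d) {x : M} (hx : x ∈ U) (h0 : d x = 0)
    (v : TangentSpace 𝓘(ℝ, E) x) : covForm cov d x v ∈ V x := by
  obtain ⟨Ω, J, L, hΩ, hxΩ, -, hJ, hL, hLJ, hmem⟩ := hV.exists_chart_frame x
  have hc := mem_chart_source E x
  have hn := hΩ.mem_nhds hxΩ
  have hdd := hd.smooth.diffFormAt hd.isOpen hx
  have hr := (diffFormAt_iff hc).1 hdd
  have dJ : DifferentiableAt ℝ J (extChartAt 𝓘(ℝ, E) x x) :=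
    (hJ.contDiffAt hn).differentiableAt (by simp)
  have dL : DifferentiableAt ℝ L (extChartAt 𝓘(ℝ, E) x x) :=
    (hL.contDiffAt hn).differentiableAt (by simp)
  have hr0 : formRep x d (extChartAt 𝓘(ℝ, E) x x) = 0 := by
    rw [formRep_extChartAt hc, h0, map_zero]
  -- Near the point d = J b with b = L d. As b vanishes at the point itself, the product rule leaves
  -- only J · Db, a value of J.
  have he : formRep x d =ᶠ[𝓝 (extChartAt 𝓘(ℝ, E) x x)] fun z ↦ J z (L z (formRep x d z)) := by
    filter_upwards [hn, (isOpen_chartPart x hd.isOpen).mem_nhds (mem_chartPart hc hx)] with z hz hz'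
    have hzs := extChartAt_symm_mem hz'.1
    have hri := (extChartAt 𝓘(ℝ, E) x).right_inv hz'.1
    obtain ⟨c, hc⟩ := (hmem _ ⟨hzs, by rwa [mem_preimage, hri]⟩ _).1 (hd.mem _ hz'.2)
    rw [hri] at hc
    rw [formRep, ← hc, hLJ z hz]
  refine (hmem x ⟨hc, hxΩ⟩ _).2
    ⟨fderiv ℝ (fun z ↦ L z (formRep x d z)) (extChartAt 𝓘(ℝ, E) x x) (coordVec x x v), ?_⟩
  rw [← coordFrame_coordVec hc v, toModel_covForm_coord cov hc hdd, h0, map_zero, map_zero,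
    add_zero, coordFrame_coordVec hc, he.fderiv_eq,
    (dJ.hasFDerivAt.clm_apply (dL.clm_apply hr).hasFDerivAt).fderiv, hr0, map_zero]
  simp

end BundleFrames

/-! ### The maximal flat bundle is preserved by ∇ and has parallel frames -/

section MaximalFlat

variable {E : Type*} [NormedAddCommGroup E] [NormedSpace ℝ E] [FiniteDimensional ℝ E]
  {M : Type*} [TopologicalSpace M] [ChartedSpace E M] [IsManifold 𝓘(ℝ, E) ∞ M] [T2Space M]
  {cov : CovariantDerivative 𝓘(ℝ, E) E (TangentSpace 𝓘(ℝ, E) : M → Type _)} {n : ℕ}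

omit [T2Space M] in
-- Each member of the flag is a hull, and a section witnessing that w lies in the hull of V consists
-- of elements of that hull.
theorem exists_section_of_mem_derivedFlag {i : ℕ} {x : M} {w : BilinAt E x}
    (hw : w ∈ derivedFlag cov i x) : ∃ (U : Set M) (h : Π x : M, BilinAt E x), x ∈ U ∧
      IsLocalSection (derivedFlag cov i) U h ∧ h x = w := by
  have key : ∀ V : FormSubset E M, w ∈ sectionHull V x → ∃ (U : Set M) (h : Π x : M, BilinAt E x),
      x ∈ U ∧ IsLocalSection (sectionHull V) U h ∧ h x = w := by
    rintro V ⟨U, h, hx, hh, rfl⟩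
    exact ⟨U, h, hx, ⟨hh.isOpen, hh.smooth, fun y hy ↦ ⟨U, h, hy, hh, rfl⟩⟩, rfl⟩
  cases i with
  | zero => exact key _ hw
  | succ i => exact key _ hw

/-- The points at which the `i`-th member of the derived flag is terminal. -/
def terminalSet (cov : CovariantDerivative 𝓘(ℝ, E) E (TangentSpace 𝓘(ℝ, E) : M → Type _))
    (i : ℕ) : Set M := {x | derivedFlag cov i x ⊆ maximalFlat cov x}

omit [T2Space M] in
-- An element of W⁽ⁱ⁾ over a limit point extends to a section of W⁽ⁱ⁾. That section lies in W̃ at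
-- terminal points arbitrarily near, hence at the limit because W̃ is closed.
theorem isClosed_terminalSet (hreg : IsRegularOfRank cov n) (i : ℕ) :
    IsClosed (terminalSet cov i) := by
  refine isClosed_of_closure_subset fun x hx w hw ↦ ?_
  obtain ⟨U, h, hxU, hh, rfl⟩ := exists_section_of_mem_derivedFlag hw
  refine IsVectorBundleOfRank.mem_of_frequently hreg
    ((hh.smooth.contDiffAt hh.isOpen
      (mem_chartPart (mem_chart_source E x) hxU)).continuousAt) ?_
  have hU : ∀ᶠ y in 𝓝 x, y ∈ U := hh.isOpen.mem_nhds hxU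
  exact ((mem_closure_iff_frequently.1 hx).and_eventually hU).mono
    fun y hy ↦ hy.1 (hh.mem y hy.2)

/-- Baire's theorem for the closed terminal sets, which cover M by pointwise stabilisation; M is
locally compact, being finite-dimensional. -/
theorem dense_iUnion_interior_terminalSet
    (hsmooth : CovariantDerivative.ContMDiffCovariantDerivative cov ∞)
    (hreg : IsRegularOfRank cov n) : Dense (⋃ i, interior (terminalSet cov i)) := by
  have : LocallyCompactSpace M := Manifold.locallyCompact_of_finiteDimensional 𝓘(ℝ, E)
  refine dense_iUnion_interior_of_closed (isClosed_terminalSet hreg) ?_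
  exact eq_univ_of_forall fun x ↦ mem_iUnion.2 (exists_maximalFlat_eq hsmooth x)

/-- As h(x) lies in the kernel of the second fundamental form of W⁽ⁱ⁾, some section h' of W⁽ⁱ⁾
through it has ∇h' in W⁽ⁱ⁾ at x. Near x that member is W̃, so h - h' is a section of W̃ vanishing at
x, and its derivative at x lies in W̃. -/
theorem covForm_mem_maximalFlat_of_interior
    (hsmooth : CovariantDerivative.ContMDiffCovariantDerivative cov ∞)
    (hreg : IsRegularOfRank cov n) {U : Set M} {h : Π x : M, BilinAt E x}
    (hh : IsLocalSection (maximalFlat cov) U h) {x : M} (hx : x ∈ U) {i : ℕ}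
    (hi : x ∈ interior (terminalSet cov i)) (v : TangentSpace 𝓘(ℝ, E) x) :
    covForm cov h x v ∈ maximalFlat cov x := by
  have hlin := isLinearSubset_maximalFlat hsmooth
  have h1 : h x ∈ kerSecondFund cov (derivedFlag cov i) x :=
    sectionHull_subset _ x (maximalFlat_subset cov (i + 1) x (hh.mem x hx))
  obtain ⟨U', h', hx', hh', he, hc⟩ := h1
  have ho := (hh.isOpen.inter hh'.isOpen).inter (isOpen_interior (s := terminalSet cov i))
  have hd : IsLocalSection (maximalFlat cov) (U ∩ U' ∩ interior (terminalSet cov i))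
      (fun y ↦ h y + (-1 : ℝ) • h' y) := by
    refine hlin.add_section (hh.mono (fun _ ↦ Subset.rfl) ho fun y hy ↦ hy.1.1)
      (hlin.smul_section (-1) ⟨ho, hh'.smooth.mono fun y hy ↦ hy.1.2, fun y hy ↦ ?_⟩)
    exact interior_subset hy.2 (hh'.mem y hy.1.2)
  have h2 := IsVectorBundleOfRank.covForm_mem hreg cov hd ⟨⟨hx, hx'⟩, hi⟩
    (by rw [he, neg_one_smul, add_neg_cancel]) v
  have d1 := hh.smooth.diffFormAt hh.isOpen hx
  have d2 := hh'.smooth.diffFormAt hh'.isOpen hx'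
  have d3 : DiffFormAt (fun y ↦ (-1 : ℝ) • h' y) x :=
    (hh'.smooth.smul hh'.isOpen (-1)).diffFormAt hh'.isOpen hx'
  rw [covForm_add cov d1 d3, covForm_smul cov d2] at h2
  have h3 := hlin.add x _ h2 _ (interior_subset hi (hc v))
  rwa [neg_one_smul, neg_add_cancel_right] at h3

/-- The maximal flat subset of a regular connection is preserved by the connection. -/
theorem covForm_mem_maximalFlat
    (hsmooth : CovariantDerivative.ContMDiffCovariantDerivative cov ∞)
    (hreg : IsRegularOfRank cov n) {U : Set M} {h : Π x : M, BilinAt E x}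
    (hh : IsLocalSection (maximalFlat cov) U h) {x : M} (hx : x ∈ U)
    (v : TangentSpace 𝓘(ℝ, E) x) :
    covForm cov h x v ∈ maximalFlat cov x := by
  have hc := mem_chart_source E x
  -- With coordinate directions, y ↦ ∇h is a field that is continuous at x and lies in W̃ at a dense
  -- set of y near x; hence also at x.
  have key : ∀ u : E, covForm cov h x (coordFrame x x u) ∈ maximalFlat cov x := by
    intro u
    refine IsVectorBundleOfRank.mem_of_frequently hreg
      (s := fun y ↦ covForm cov h y (coordFrame x y u)) ?_ ?_
    · have hz := mem_chartPart (E := E) hc hx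
      have ho := isOpen_chartPart (E := E) x hh.isOpen
      have e : formRep x (fun y ↦ covForm cov h y (coordFrame x y u)) =ᶠ[𝓝 (extChartAt 𝓘(ℝ, E) x x)]
          fun z ↦ fderiv ℝ (formRep x h) z u + chartConn cov x z u (formRep x h z) := by
        filter_upwards [ho.mem_nhds hz] with z hz
        have := formRep_covForm cov hz.1 (hh.smooth.diffFormAt hh.isOpen hz.2)
          (fun y ↦ coordFrame x y u)
        rwa [vecRep_coordFrame hz.1] at this
      refine ContinuousAt.congr ?_ e.symm
      have c1 := hh.smooth.contDiffAt hh.isOpen hz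
      have c2 := (contDiffOn_chartConn hsmooth x).contDiffAt
        ((isOpen_extChartAt_target x).mem_nhds hz.1)
      exact ((c1.fderiv_right (m := 0) (by simp)).continuousAt.clm_apply continuousAt_const).add
        ((c2.continuousAt.clm_apply continuousAt_const).clm_apply c1.continuousAt)
    · have hU : ∀ᶠ y in 𝓝 x, y ∈ U := hh.isOpen.mem_nhds hx
      refine ((mem_closure_iff_frequently.1
        (dense_iUnion_interior_terminalSet hsmooth hreg x)).and_eventually hU).mono ?_
      rintro y ⟨hy, hyU⟩
      obtain ⟨i, hi⟩ := mem_iUnion.1 hy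
      exact covForm_mem_maximalFlat_of_interior hsmooth hreg hh hyU hi _
  rw [← coordFrame_coordVec hc v]
  exact key _

/-- Local parallel frames of the maximal flat subbundle. -/
theorem exists_local_parallel_frame
    (hsmooth : CovariantDerivative.ContMDiffCovariantDerivative cov ∞)
    (hreg : IsRegularOfRank cov n) (x : M) :
    ∃ (U : Opens M) (h : Fin n → Π x : M, BilinAt E x), x ∈ U ∧
      (∀ i, IsLocalSection (maximalFlat cov) U (h i)) ∧ (∀ i, IsParallelOn cov (h i) U) ∧
      ∀ y ∈ U, IsFibreBasis (maximalFlat cov) h y := by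
  obtain ⟨Ω, J, L, hΩ, hxΩ, hΩt, hJ, hL, hLJ, hmem⟩ :=
    IsVectorBundleOfRank.exists_chart_frame hreg x
  have hc := mem_chart_source E x
  have hsymm : ∀ z ∈ Ω, ∃ y ∈ manifoldPart x Ω, extChartAt 𝓘(ℝ, E) x y = z := fun z hz ↦
    ⟨(extChartAt 𝓘(ℝ, E) x).symm z, ⟨extChartAt_symm_mem (hΩt hz), by
      rwa [mem_preimage, (extChartAt 𝓘(ℝ, E) x).right_inv (hΩt hz)]⟩,
      (extChartAt 𝓘(ℝ, E) x).right_inv (hΩt hz)⟩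
  have hpres : ∀ z ∈ Ω, ∀ v c, ∃ c', J z c' = fderiv ℝ J z v c + chartConn cov x z v (J z c) := by
    intro z hz v c
    obtain ⟨y, hy, rfl⟩ := hsymm z hz
    have hsec : IsLocalSection (maximalFlat cov) (manifoldPart x Ω)
        (formOfRep x fun z ↦ J z c) := by
      refine ⟨isOpen_manifoldPart x hΩ, smoothFormOn_formOfRep hΩ (hJ.clm_apply contDiffOn_const),
        fun y hy ↦ (hmem y hy _).2 ⟨c, ?_⟩⟩
      rw [formOfRep, toModel_ofModel hy.1]
    have h1 := covForm_mem_maximalFlat hsmooth hreg hsec hy (coordFrame x y v)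
    obtain ⟨c', hc'⟩ := (hmem y hy _).1 h1
    refine ⟨c', hc'.trans ?_⟩
    rw [toModel_covForm_coord cov hy.1 (hsec.smooth.diffFormAt hsec.isOpen hy),
      (formRep_formOfRep_eventuallyEq (hΩt hy.2) _).fderiv_eq, formOfRep, toModel_ofModel hy.1,
      ((((hJ.contDiffAt (hΩ.mem_nhds hy.2)).differentiableAt (by simp)).hasFDerivAt).clm_apply
        (hasFDerivAt_const c _)).fderiv]
    simp
  have hcurv : ∀ z ∈ Ω, ∀ u v c, formCurv (chartConn cov x) z u v (J z c) = 0 := by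
    intro z hz u v c
    obtain ⟨y, hy, rfl⟩ := hsymm z hz
    have h1 : ofModel x y (J (extChartAt 𝓘(ℝ, E) x y) c) ∈ maximalFlat cov y :=
      (hmem y hy _).2 ⟨c, (toModel_ofModel hy.1 _).symm⟩
    have h2 := ((mem_flatForms_iff hsmooth hy.1 _).1 (mem_flatForms_of_mem_maximalFlat h1)).2 u v
    rwa [toModel_ofModel hy.1] at h2
  obtain ⟨r, hr, hrΩ, hsol⟩ := exists_parallelOn_of_frame hΩ
    ((contDiffOn_chartConn hsmooth x).mono hΩt) hJ
    (fun z hz ↦ Function.LeftInverse.injective (hLJ z hz)) hpres hcurv hxΩ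
  -- The initial values are the standard basis, and the solutions share one ball.
  choose c hc0 hcp using fun i : Fin n ↦ hsol (Pi.single i 1)
  set h : Fin n → Π x : M, BilinAt E x := fun i ↦ formOfRep x fun z ↦ J z (c i z) with hh
  set B := Metric.ball (extChartAt 𝓘(ℝ, E) x x) r with hB
  have hBo : IsOpen (manifoldPart x B) := isOpen_manifoldPart x Metric.isOpen_ball
  have hpar : ∀ i, IsParallelOn cov (h i) (manifoldPart x B) := by
    intro i
    refine isParallelOn_of_parallelOn fun z hz ↦ ?_
    have e := formRep_formOfRep_eventuallyEq (hΩt (hrΩ hz)) fun z ↦ J z (c i z)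
    refine ((hcp i z hz).congr_of_eventuallyEq e).congr_fderiv ?_
    exact congrArg (fun b ↦ -(chartConn cov x z).flip b) e.self_of_nhds.symm
  have hval : ∀ i, ∀ y ∈ manifoldPart x B, h i y ∈ maximalFlat cov y := fun i y hy ↦
    (hmem y ⟨hy.1, hrΩ hy.2⟩ _).2 ⟨c i (extChartAt 𝓘(ℝ, E) x y), by
      rw [hh]; dsimp only; rw [formOfRep, toModel_ofModel hy.1]⟩
  have hcc : ContinuousAt (fun z i ↦ c i z) (extChartAt 𝓘(ℝ, E) x x) := by
    refine continuousAt_pi.2 fun i ↦ ?_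
    have h1 : ContinuousAt (fun z ↦ L z (J z (c i z))) (extChartAt 𝓘(ℝ, E) x x) :=
      (hL.continuousOn.continuousAt (hΩ.mem_nhds hxΩ)).clm_apply
        (hcp i _ (Metric.mem_ball_self hr)).continuousAt
    refine h1.congr ?_
    filter_upwards [hΩ.mem_nhds hxΩ] with z hz using hLJ z hz _
  -- Linear independence is an open condition, and the coefficient vectors are the standard basis at
  -- the centre.
  have hli : ∀ᶠ z in 𝓝 (extChartAt 𝓘(ℝ, E) x x), LinearIndependent ℝ fun i ↦ c i z := by
    refine hcc.eventually (isOpen_setOfPred_linearIndependent.mem_nhds ?_)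
    rw [mem_ofPred_eq]
    simp only [hc0]
    exact Pi.linearIndependent_single_one (Fin n) ℝ
  obtain ⟨O, hOsub, hO, hxO⟩ := eventually_nhds_iff.1 hli
  have hU : IsOpen (manifoldPart x (B ∩ O)) := isOpen_manifoldPart x (Metric.isOpen_ball.inter hO)
  have hsub : manifoldPart x (B ∩ O) ⊆ manifoldPart x B := fun y hy ↦ ⟨hy.1, hy.2.1⟩
  refine ⟨⟨manifoldPart x (B ∩ O), hU⟩, h, ⟨hc, Metric.mem_ball_self hr, hxO⟩, fun i ↦
    ⟨hU, ((hpar i).smoothFormOn hsmooth hBo).mono hsub, fun y hy ↦ hval i y (hsub hy)⟩,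
    fun i ↦ (hpar i).mono hsub, ?_⟩
  rintro y ⟨hy, hyB, hyO⟩
  have hyΩ := hrΩ hyB
  have hci := hOsub _ hyO
  have hJi : LinearMap.ker (J (extChartAt 𝓘(ℝ, E) x y)).toLinearMap = ⊥ :=
    LinearMap.ker_eq_bot.2 (Function.LeftInverse.injective (hLJ _ hyΩ))
  have hm : ∀ i, toModel x y (h i y) = J (extChartAt 𝓘(ℝ, E) x y) (c i (extChartAt 𝓘(ℝ, E) x y)) :=
    fun i ↦ by rw [hh]; dsimp only; rw [formOfRep, toModel_ofModel hy]
  constructor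
  · refine LinearIndependent.of_comp (toModel x y) ?_
    have := hci.map' _ hJi
    exact (funext hm : ⇑(toModel x y) ∘ (fun i ↦ h i y) = _) ▸ this
  · ext w
    rw [SetLike.mem_coe, Submodule.mem_span_range_iff_exists_fun, hmem y ⟨hy, hyΩ⟩]
    constructor
    · rintro ⟨a, rfl⟩
      refine ⟨∑ i, a i • c i (extChartAt 𝓘(ℝ, E) x y), ?_⟩
      rw [map_sum, map_sum]
      simp only [map_smul, hm]
    · rintro ⟨b, hb⟩
      have hspan := hci.span_eq_top_of_card_eq_finrank' (by simp)
      obtain ⟨a, ha⟩ := (Submodule.mem_span_range_iff_exists_fun ℝ).1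
        (hspan ▸ Submodule.mem_top : b ∈ _)
      refine ⟨a, toModel_injective hy ?_⟩
      rw [← hb, ← ha, map_sum, map_sum]
      simp only [map_smul, hm]

end MaximalFlat

/-! ### The embeddings diag(I, A) -/

section BlockEmbed

/-- The splitting of `Fin n` used by `blockEmbed`. -/
def blockEquiv {m n : ℕ} (h : m ≤ n) : Fin (n - m) ⊕ Fin m ≃ Fin n :=
  finSumFinEquiv.trans (finCongr (Nat.sub_add_cancel h))

variable {m n : ℕ} (h : m ≤ n)

@[simp]
theorem blockEquiv_inl_val (i : Fin (n - m)) : (blockEquiv h (Sum.inl i)).val = i.val := by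
  simp [blockEquiv]

@[simp]
theorem blockEquiv_inr_val (i : Fin m) : (blockEquiv h (Sum.inr i)).val = n - m + i.val := by
  simp [blockEquiv]

theorem blockEmbed_blockEquiv (A : Matrix (Fin m) (Fin m) ℝ) (s t : Fin (n - m) ⊕ Fin m) :
    blockEmbed h A (blockEquiv h s) (blockEquiv h t) = Matrix.fromBlocks 1 0 0 A s t := by
  change Matrix.fromBlocks 1 0 0 A ((blockEquiv h).symm (blockEquiv h s))
    ((blockEquiv h).symm (blockEquiv h t)) = _
  rw [Equiv.symm_apply_apply, Equiv.symm_apply_apply]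

theorem blockEmbed_apply (A : Matrix (Fin m) (Fin m) ℝ) (i j : Fin n) :
    blockEmbed h A i j = if hij : n - m ≤ i.val ∧ n - m ≤ j.val then
      A ⟨i.val - (n - m), by omega⟩ ⟨j.val - (n - m), by omega⟩ else if i = j then 1 else 0 := by
  obtain ⟨s, rfl⟩ := (blockEquiv h).surjective i
  obtain ⟨t, rfl⟩ := (blockEquiv h).surjective j
  rw [blockEmbed_blockEquiv]
  rcases s with s | s <;> rcases t with t | t
  · rw [dif_neg (by rw [blockEquiv_inl_val, blockEquiv_inl_val]; omega)]
    simp [Matrix.one_apply]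
  · rw [dif_neg (by rw [blockEquiv_inl_val]; omega)]
    simp
  · rw [dif_neg (by rw [blockEquiv_inl_val (i := t)]; omega)]
    simp
  · rw [dif_pos (by simp)]
    simp

theorem blockEmbed_injective : Function.Injective (blockEmbed (m := m) (n := n) h) := by
  intro A B hAB
  ext i j
  have := congrFun (congrFun hAB (blockEquiv h (Sum.inr i))) (blockEquiv h (Sum.inr j))
  rwa [blockEmbed_blockEquiv, blockEmbed_blockEquiv] at this

theorem glEmbed_injective : Function.Injective (glEmbed (m := m) (n := n) h) :=
  Units.map_injective (blockEmbed_injective h)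

theorem blockEmbed_self (A : Matrix (Fin n) (Fin n) ℝ) : blockEmbed le_rfl A = A := by
  ext i j
  rw [blockEmbed_apply, dif_pos (by simp)]
  simp

theorem glEmbed_self : glEmbed (le_refl n) = MonoidHom.id _ := by
  ext A : 1
  exact Units.ext (blockEmbed_self _)

theorem glEmbed_comp {k : ℕ} (h' : k ≤ m) :
    (glEmbed h).comp (glEmbed h') = glEmbed (h'.trans h) := by
  ext A : 1
  refine Units.ext ?_
  change blockEmbed h (blockEmbed h' (A : Matrix (Fin k) (Fin k) ℝ)) = blockEmbed (h'.trans h) _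
  ext i j
  rw [blockEmbed_apply, blockEmbed_apply (h'.trans h)]
  have e : ∀ i' j' : Fin m, _ := blockEmbed_apply h' (A : Matrix (Fin k) (Fin k) ℝ)
  simp only [e]
  by_cases hi : n - k ≤ i.val ∧ n - k ≤ j.val
  · rw [dif_pos hi, dif_pos (by omega), dif_pos (by omega)]
    have e1 : i.val - (n - m) - (m - k) = i.val - (n - k) := by omega
    have e2 : j.val - (n - m) - (m - k) = j.val - (n - k) := by omega
    simp only [e1, e2]
  · rw [dif_neg hi]
    by_cases hj : n - m ≤ i.val ∧ n - m ≤ j.val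
    · rw [dif_pos hj, dif_neg (by omega)]
      simp only [Fin.ext_iff]
      congr 1
      exact propext ⟨fun _ ↦ by omega, fun _ ↦ by omega⟩
    · rw [dif_neg hj]

end BlockEmbed

/-! ### Splitting off a fixed axis -/

section Splitting

open Matrix

variable {k : ℕ}

/-- The matrices that preserve the splitting of `ℝᵏ⁺¹` into the first axis and its complement,
and are the identity on the former. -/
def FixesFirst (X : Matrix (Fin (k + 1)) (Fin (k + 1)) ℝ) : Prop :=
  X *ᵥ Pi.single 0 1 = Pi.single 0 1 ∧ Pi.single 0 1 ᵥ* X = Pi.single 0 1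

theorem FixesFirst.col {X : Matrix (Fin (k + 1)) (Fin (k + 1)) ℝ} (hX : FixesFirst X)
    (i : Fin (k + 1)) : X i 0 = if i = 0 then 1 else 0 := by
  have := congrFun hX.1 i
  simpa [Pi.single_apply] using this

theorem FixesFirst.row {X : Matrix (Fin (k + 1)) (Fin (k + 1)) ℝ} (hX : FixesFirst X)
    (i : Fin (k + 1)) : X 0 i = if i = 0 then 1 else 0 := by
  have := congrFun hX.2 i
  simpa [Pi.single_apply] using this

/-- The lower right block. -/
def lowerBlock (X : Matrix (Fin (k + 1)) (Fin (k + 1)) ℝ) : Matrix (Fin k) (Fin k) ℝ :=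
  X.submatrix Fin.succ Fin.succ

theorem FixesFirst.blockEmbed_lowerBlock {X : Matrix (Fin (k + 1)) (Fin (k + 1)) ℝ}
    (hX : FixesFirst X) : blockEmbed (Nat.le_succ k) (lowerBlock X) = X := by
  ext i j
  rw [blockEmbed_apply]
  cases i using Fin.cases with
  | zero =>
    rw [dif_neg (by simp), hX.row]
    simp only [eq_comm]
  | succ i =>
    cases j using Fin.cases with
    | zero => rw [dif_neg (by simp), hX.col]
    | succ j =>
      rw [dif_pos (by simp)]
      simp only [lowerBlock, submatrix_apply]
      congr 1 <;> ext <;> simp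

theorem FixesFirst.inv {X : GL (Fin (k + 1)) ℝ}
    (hX : FixesFirst (X : Matrix (Fin (k + 1)) (Fin (k + 1)) ℝ)) :
    FixesFirst ((X⁻¹ : GL (Fin (k + 1)) ℝ) : Matrix (Fin (k + 1)) (Fin (k + 1)) ℝ) := by
  have h1 : ((X⁻¹ : GL (Fin (k + 1)) ℝ) : Matrix (Fin (k + 1)) (Fin (k + 1)) ℝ) *
      (X : Matrix (Fin (k + 1)) (Fin (k + 1)) ℝ) = 1 := X.inv_mul
  have h2 : (X : Matrix (Fin (k + 1)) (Fin (k + 1)) ℝ) *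
      ((X⁻¹ : GL (Fin (k + 1)) ℝ) : Matrix (Fin (k + 1)) (Fin (k + 1)) ℝ) = 1 := X.mul_inv
  constructor
  · conv_lhs => rw [← hX.1]
    rw [mulVec_mulVec, h1, one_mulVec]
  · conv_lhs => rw [← hX.2]
    rw [vecMul_vecMul, h2, vecMul_one]

/-- X⁻¹ respects the same splitting, so its lower block inverts that of X; this is read off through
the injective multiplicative map `blockEmbed`. -/
theorem exists_glEmbed_eq {X : GL (Fin (k + 1)) ℝ}
    (hX : FixesFirst (X : Matrix (Fin (k + 1)) (Fin (k + 1)) ℝ)) :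
    ∃ Y : GL (Fin k) ℝ, glEmbed (Nat.le_succ k) Y = X := by
  have e1 := hX.blockEmbed_lowerBlock
  have e2 := hX.inv.blockEmbed_lowerBlock
  refine ⟨⟨lowerBlock X, lowerBlock (X⁻¹ : GL (Fin (k + 1)) ℝ), ?_, ?_⟩, Units.ext e1⟩
  · apply blockEmbed_injective (Nat.le_succ k)
    rw [map_mul, e1, e2, map_one]
    exact X.mul_inv
  · apply blockEmbed_injective (Nat.le_succ k)
    rw [map_mul, e1, e2, map_one]
    exact X.inv_mul

/-- A basis adapted to the splitting of `ℝᵏ⁺¹` given by a vector and a covector. -/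
theorem exists_adapted_basis {c l : Fin (k + 1) → ℝ} (h : c ⬝ᵥ l ≠ 0) :
    ∃ b : GL (Fin (k + 1)) ℝ,
      (b : Matrix (Fin (k + 1)) (Fin (k + 1)) ℝ) *ᵥ Pi.single 0 1 = l ∧
      c ᵥ* (b : Matrix (Fin (k + 1)) (Fin (k + 1)) ℝ) = (c ⬝ᵥ l) • Pi.single 0 1 := by
  let f : (Fin (k + 1) → ℝ) →ₗ[ℝ] ℝ := dotProductBilin ℝ ℝ c
  have hf : ∀ v, f v = c ⬝ᵥ v := fun v ↦ rfl
  have hf0 : f ≠ 0 := fun h0 ↦ h (by rw [← hf, h0, LinearMap.zero_apply])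
  have hker : Module.finrank ℝ (LinearMap.ker f) = k := by
    have h1 := LinearMap.finrank_range_add_finrank_ker f
    rw [LinearMap.range_eq_top.2 (LinearMap.surjective hf0), finrank_top] at h1
    simp at h1
    omega
  let v : Fin k → LinearMap.ker f := Module.finBasisOfFinrankEq ℝ _ hker
  have hv : LinearIndependent ℝ (fun i ↦ (v i : Fin (k + 1) → ℝ)) :=
    (Module.finBasisOfFinrankEq ℝ _ hker).linearIndependent.map' (LinearMap.ker f).subtype
      (Submodule.ker_subtype _)
  have hli : LinearIndependent ℝ (Fin.cons l (fun i ↦ (v i : Fin (k + 1) → ℝ)) :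
      Fin (k + 1) → Fin (k + 1) → ℝ) := by
    refine linearIndependent_finCons.2 ⟨hv, fun hl ↦ h ?_⟩
    have : Submodule.span ℝ (range fun i ↦ (v i : Fin (k + 1) → ℝ)) ≤ LinearMap.ker f :=
      Submodule.span_le.2 (range_subset_iff.2 fun i ↦ (v i).2)
    exact this hl
  -- The columns are l followed by a basis of the kernel of c; they are independent since c · l ≠ 0
  -- keeps l out of that kernel.
  set B : Matrix (Fin (k + 1)) (Fin (k + 1)) ℝ :=
    (Matrix.of (Fin.cons l (fun i ↦ (v i : Fin (k + 1) → ℝ))))ᵀ with hB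
  have hu : IsUnit B := by
    rw [hB, Matrix.isUnit_transpose]
    exact Matrix.linearIndependent_rows_iff_isUnit.1 hli
  refine ⟨hu.unit, ?_, ?_⟩
  · rw [IsUnit.unit_spec, mulVec_single_one]
    rfl
  · rw [IsUnit.unit_spec]
    ext j
    change c ⬝ᵥ (fun i ↦ B i j) = _
    cases j using Fin.cases with
    | zero => simp [hB]
    | succ j =>
      have : c ⬝ᵥ (v j : Fin (k + 1) → ℝ) = 0 := (v j).2
      simpa [hB] using this

end Splitting

/-! ### Reduction of cocycles to a smaller linear group -/

section Reduction

open Matrix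

universe u

variable {M : Type u} [TopologicalSpace M] {n k : ℕ}

theorem H1.map_map {l m : ℕ} (f : GL (Fin l) ℝ →* GL (Fin m) ℝ) (g : GL (Fin m) ℝ →* GL (Fin n) ℝ)
    (c : H1 M l) : H1.map g (H1.map f c) = H1.map (g.comp f) c := by
  obtain ⟨c, rfl⟩ := Quotient.exists_rep c
  rfl

theorem H1.map_id (c : H1 M n) : H1.map (MonoidHom.id _) c = c := by
  obtain ⟨c, rfl⟩ := Quotient.exists_rep c
  rfl

theorem H1.inImage_self (σ : H1 M n) : H1.InImage n σ :=
  ⟨le_rfl, σ, by rw [glEmbed_self, H1.map_id]⟩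

theorem H1.inImage_sInf (σ : H1 M n) : H1.InImage (sInf {m | H1.InImage m σ}) σ :=
  Nat.sInf_mem (s := {m | H1.InImage m σ}) ⟨n, σ.inImage_self⟩

/-- The least size is at most n, so truncated subtraction loses nothing. -/
theorem H1.sub_rank (σ : H1 M n) : n - σ.rank = sInf {m | H1.InImage m σ} := by
  have : sInf {m | H1.InImage m σ} ≤ n := Nat.sInf_le σ.inImage_self
  rw [H1.rank]
  omega

/-- A cocycle with values in `GL(k + 1, ℝ)` that preserves a vector and a covector which pair
nontrivially is cohomologous to a cocycle with values in `GL(k, ℝ)`. -/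
theorem exists_map_eq_of_fixed (a : CocycleOnCover M (k + 1))
    (c l : ∀ α, LocallyConstant (a.cover.U α) (Fin (k + 1) → ℝ))
    (hne : ∀ α x, c α x ⬝ᵥ l α x ≠ 0)
    (hc : ∀ α β x (hα : x ∈ a.cover.U α) (hβ : x ∈ a.cover.U β),
      c α ⟨x, hα⟩ ᵥ* (a.val α β ⟨x, hα, hβ⟩ : Matrix (Fin (k + 1)) (Fin (k + 1)) ℝ) = c β ⟨x, hβ⟩)
    (hl : ∀ α β x (hα : x ∈ a.cover.U α) (hβ : x ∈ a.cover.U β),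
      (a.val α β ⟨x, hα, hβ⟩ : Matrix (Fin (k + 1)) (Fin (k + 1)) ℝ) *ᵥ l β ⟨x, hβ⟩ = l α ⟨x, hα⟩) :
    ∃ a' : H1 M k, H1.map (glEmbed (Nat.le_succ k)) a' = Quotient.mk (cocycleSetoid M (k + 1)) a := by
  classical
  -- The adapted basis is chosen as a function of the pair of values (c, l) alone, so composing it
  -- with locally constant data is again locally constant.
  let B : (Fin (k + 1) → ℝ) × (Fin (k + 1) → ℝ) → GL (Fin (k + 1)) ℝ := fun p ↦
    if h : p.1 ⬝ᵥ p.2 ≠ 0 then (exists_adapted_basis h).choose else 1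
  have hB : ∀ c l : Fin (k + 1) → ℝ, c ⬝ᵥ l ≠ 0 →
      (B (c, l) : Matrix (Fin (k + 1)) (Fin (k + 1)) ℝ) *ᵥ Pi.single 0 1 = l ∧
      c ᵥ* (B (c, l) : Matrix (Fin (k + 1)) (Fin (k + 1)) ℝ) = (c ⬝ᵥ l) • Pi.single 0 1 := by
    intro c l h
    have : B (c, l) = (exists_adapted_basis h).choose := dif_pos h
    rw [this]
    exact (exists_adapted_basis h).choose_spec
  let b : Cochain0 a.cover (k + 1) := fun α ↦
    ⟨fun x ↦ B (c α x, l α x), fun s ↦ by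
      rw [show (fun x ↦ B (c α x, l α x)) = B ∘ fun x ↦ (c α x, l α x) from rfl, preimage_comp]
      exact ((c α).isLocallyConstant.prodMk (l α).isLocallyConstant) _⟩
  -- On columns: b_β takes e₀ to l_β, the cocycle takes l_β to l_α, and b_α⁻¹ brings it back to e₀.
  -- On rows the same holds with c, up to the factor c · l, which agrees over α and β by invariance.
  have hfix : ∀ α β x (hα : x ∈ a.cover.U α) (hβ : x ∈ a.cover.U β),
      FixesFirst (((b α ⟨x, hα⟩)⁻¹ * a.val α β ⟨x, hα, hβ⟩ * b β ⟨x, hβ⟩ :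
        GL (Fin (k + 1)) ℝ) : Matrix (Fin (k + 1)) (Fin (k + 1)) ℝ) := by
    intro α β x hα hβ
    obtain ⟨p1, p2⟩ := hB _ _ (hne α ⟨x, hα⟩)
    obtain ⟨q1, q2⟩ := hB _ _ (hne β ⟨x, hβ⟩)
    have e : c α ⟨x, hα⟩ ⬝ᵥ l α ⟨x, hα⟩ = c β ⟨x, hβ⟩ ⬝ᵥ l β ⟨x, hβ⟩ := by
      rw [← hl α β x hα hβ, ← hc α β x hα hβ, dotProduct_mulVec]
    have hinv : (((b α ⟨x, hα⟩)⁻¹ : GL (Fin (k + 1)) ℝ) : Matrix (Fin (k + 1)) (Fin (k + 1)) ℝ) *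
        (b α ⟨x, hα⟩ : Matrix (Fin (k + 1)) (Fin (k + 1)) ℝ) = 1 := (b α ⟨x, hα⟩).inv_mul
    have hinv' : (b α ⟨x, hα⟩ : Matrix (Fin (k + 1)) (Fin (k + 1)) ℝ) *
      (((b α ⟨x, hα⟩)⁻¹ : GL (Fin (k + 1)) ℝ) : Matrix (Fin (k + 1)) (Fin (k + 1)) ℝ) = 1 :=
        (b α ⟨x, hα⟩).mul_inv
    change (b α ⟨x, hα⟩ : Matrix (Fin (k + 1)) (Fin (k + 1)) ℝ) *ᵥ Pi.single 0 1 = _ at p1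
    change _ ᵥ* (b α ⟨x, hα⟩ : Matrix (Fin (k + 1)) (Fin (k + 1)) ℝ) = _ at p2
    change (b β ⟨x, hβ⟩ : Matrix (Fin (k + 1)) (Fin (k + 1)) ℝ) *ᵥ Pi.single 0 1 = _ at q1
    change _ ᵥ* (b β ⟨x, hβ⟩ : Matrix (Fin (k + 1)) (Fin (k + 1)) ℝ) = _ at q2
    rw [Units.val_mul, Units.val_mul]
    constructor
    · rw [← mulVec_mulVec, ← mulVec_mulVec, q1, hl α β x hα hβ, ← p1, mulVec_mulVec, hinv,
        one_mulVec]
    · have p3 : (Pi.single 0 1 : Fin (k + 1) → ℝ) ᵥ*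
          (((b α ⟨x, hα⟩)⁻¹ : GL (Fin (k + 1)) ℝ) : Matrix (Fin (k + 1)) (Fin (k + 1)) ℝ) =
          (c α ⟨x, hα⟩ ⬝ᵥ l α ⟨x, hα⟩)⁻¹ • c α ⟨x, hα⟩ := by
        have := congrArg (fun w ↦ w ᵥ*
          (((b α ⟨x, hα⟩)⁻¹ : GL (Fin (k + 1)) ℝ) : Matrix (Fin (k + 1)) (Fin (k + 1)) ℝ)) p2
        simp only [vecMul_vecMul, hinv', vecMul_one, smul_vecMul] at this
        rw [eq_inv_smul_iff₀ (hne α ⟨x, hα⟩)]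
        exact this.symm
      rw [← vecMul_vecMul, ← vecMul_vecMul, p3, smul_vecMul, smul_vecMul, hc α β x hα hβ, q2, e,
        smul_smul, inv_mul_cancel₀ (hne β ⟨x, hβ⟩), one_smul]
  -- Any set-theoretic left inverse of the embedding will do: local constancy survives composition
  -- with an arbitrary map, and the cocycle identity is checked after embedding.
  let S : GL (Fin (k + 1)) ℝ → GL (Fin k) ℝ := Function.invFun (glEmbed (Nat.le_succ k))
  have hS : ∀ X : GL (Fin (k + 1)) ℝ, FixesFirst (X : Matrix (Fin (k + 1)) (Fin (k + 1)) ℝ) →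
      glEmbed (Nat.le_succ k) (S X) = X := fun X hX ↦ Function.invFun_eq (exists_glEmbed_eq hX)
  let r : ∀ α β, LocallyConstant ↥(a.cover.U α ⊓ a.cover.U β) (GL (Fin (k + 1)) ℝ) := fun α β ↦
    ((b α)⁻¹).comap ⟨fun x ↦ ⟨x.1, x.2.1⟩, continuous_subtype_val.subtype_mk _⟩ * a.val α β *
      (b β).comap ⟨fun x ↦ ⟨x.1, x.2.2⟩, continuous_subtype_val.subtype_mk _⟩
  have hr : ∀ α β x (hα : x ∈ a.cover.U α) (hβ : x ∈ a.cover.U β), r α β ⟨x, hα, hβ⟩ =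
      (b α ⟨x, hα⟩)⁻¹ * a.val α β ⟨x, hα, hβ⟩ * b β ⟨x, hβ⟩ := fun α β x hα hβ ↦ rfl
  let a' : Cochain1 a.cover k := fun α β ↦ (r α β).map S
  have ha' : ∀ α β x (hα : x ∈ a.cover.U α) (hβ : x ∈ a.cover.U β),
      glEmbed (Nat.le_succ k) (a' α β ⟨x, hα, hβ⟩) =
        (b α ⟨x, hα⟩)⁻¹ * a.val α β ⟨x, hα, hβ⟩ * b β ⟨x, hβ⟩ := fun α β x hα hβ ↦
    hS _ (hfix α β x hα hβ)
  have hcoc : IsCocycle a' := by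
    intro α β γ x hα hβ hγ
    apply glEmbed_injective (Nat.le_succ k)
    rw [map_mul, map_mul, map_inv, ha' α γ x hα hγ, ha' α β x hα hβ, ha' β γ x hβ hγ, map_one,
      ← a.isCocycle.mul_eq α β γ x hα hβ hγ]
    group
  refine ⟨Quotient.mk (cocycleSetoid M k) ⟨a.cover, a', hcoc⟩, ?_⟩
  refine Quotient.sound ?_
  refine sameClass_symm ⟨a.cover, id, id, fun _ ↦ le_rfl, fun _ ↦ le_rfl, b, fun α β x hα hβ ↦ ?_⟩
  exact ha' α β x hα hβ

end Reduction

/-! ### Parallel frames and their transition cocycles -/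

section ParallelFields

universe u v

variable {E : Type v} [NormedAddCommGroup E] [NormedSpace ℝ E] [FiniteDimensional ℝ E]
  {M : Type u} [TopologicalSpace M] [ChartedSpace E M] [IsManifold 𝓘(ℝ, E) ∞ M] [T2Space M]
  {cov : CovariantDerivative 𝓘(ℝ, E) E (TangentSpace 𝓘(ℝ, E) : M → Type _)} {n : ℕ}

omit [T2Space M] [IsManifold 𝓘(ℝ, E) ∞ M] in
theorem surjective_of_injective_tangent {a b : M}
    {T : TangentSpace 𝓘(ℝ, E) a →ₗ[ℝ] TangentSpace 𝓘(ℝ, E) b} (hT : Function.Injective T) :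
    Function.Surjective T := by
  have h1 : FiniteDimensional ℝ (TangentSpace 𝓘(ℝ, E) a) := inferInstanceAs (FiniteDimensional ℝ E)
  have h2 : FiniteDimensional ℝ (TangentSpace 𝓘(ℝ, E) b) := inferInstanceAs (FiniteDimensional ℝ E)
  exact (LinearMap.injective_iff_surjective_of_finrank_eq_finrank (f := T) rfl).1 hT

omit [T2Space M] in
/-- A locally constant combination of parallel fields is parallel. -/
theorem IsParallelOn.locallyConstant_sum {ι : Type*} [Fintype ι] {U : Opens M}
    {h : ι → Π x : M, BilinAt E x} (hh : ∀ i, IsParallelOn cov (h i) U)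
    (c : LocallyConstant U (ι → ℝ)) {s : Π x : M, BilinAt E x}
    (hs : ∀ x (hx : x ∈ U), s x = ∑ i, c ⟨x, hx⟩ i • h i x) : IsParallelOn cov s U := by
  intro x hx
  obtain ⟨N, hN, hxN, hc⟩ := c.isLocallyConstant.exists_open ⟨x, hx⟩
  have hNo : IsOpen (Subtype.val '' N) := U.isOpen.isOpenMap_subtype_val N hN
  have hNU : (Subtype.val '' N : Set M) ⊆ U := by
    rintro _ ⟨y, -, rfl⟩
    exact y.2
  have h1 : IsParallelOn cov (fun y ↦ ∑ i, c ⟨x, hx⟩ i • h i y) (Subtype.val '' N) :=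
    IsParallelOn.sum _ fun i _ ↦ ((hh i).mono hNU).smul _
  refine h1.congr hNo ?_ x ⟨⟨x, hx⟩, hxN, rfl⟩
  rintro _ ⟨y, hy, rfl⟩
  rw [hs y y.2, show c ⟨y, y.2⟩ = c ⟨x, hx⟩ from hc y hy]

/-- The coefficients of a parallel field with respect to a parallel frame are locally constant. -/
theorem IsParallelOn.isLocallyConstant_coeff
    (hsmooth : CovariantDerivative.ContMDiffCovariantDerivative cov ∞) {ι : Type*} [Fintype ι]
    {U : Opens M} {h : ι → Π x : M, BilinAt E x} (hh : ∀ i, IsParallelOn cov (h i) U)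
    (hli : ∀ x ∈ U, LinearIndependent ℝ fun i ↦ h i x)
    {s : Π x : M, BilinAt E x} (hs : IsParallelOn cov s U) {c : U → ι → ℝ}
    (hc : ∀ x : U, s x = ∑ i, c x i • h i x) : IsLocallyConstant c := by
  rw [IsLocallyConstant.iff_exists_open]
  rintro ⟨x, hx⟩
  obtain ⟨N, hN, hxN, hNU, hT⟩ := exists_local_transport hsmooth U.isOpen hx
  refine ⟨Subtype.val ⁻¹' N, hN.preimage continuous_subtype_val, hxN, ?_⟩
  rintro ⟨y, hy⟩ hyN
  obtain ⟨T, hTi, hT⟩ := hT x hxN y hyN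
  have hTs := surjective_of_injective_tangent hTi
  -- The coefficients are frozen at x. The difference is parallel and vanishes at x, so transport
  -- makes it vanish at y, and independence of the frame at y identifies the coefficients.
  have hp : IsParallelOn cov (fun y ↦ (∑ i, c ⟨x, hx⟩ i • h i y) + (-1 : ℝ) • s y) N :=
    (IsParallelOn.sum _ fun i _ ↦ ((hh i).mono hNU).smul _).add ((hs.mono hNU).smul _)
  have h0 : (∑ i, c ⟨x, hx⟩ i • h i x) + (-1 : ℝ) • s x = 0 := by
    rw [hc ⟨x, hx⟩, neg_one_smul, add_neg_cancel]
  have h1 : (∑ i, c ⟨x, hx⟩ i • h i y) + (-1 : ℝ) • s y = 0 := by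
    ext u w
    obtain ⟨u, rfl⟩ := hTs u
    obtain ⟨w, rfl⟩ := hTs w
    rw [hT _ hp u w, h0]
    rfl
  rw [neg_one_smul, ← sub_eq_add_neg, sub_eq_zero, hc ⟨y, hy⟩] at h1
  exact (funext ((Fintype.linearIndependent_iffₛ.1 (hli y hy)) _ _ h1)).symm

theorem IsLocallyConstant.of_comp_injective {X A B : Type*} [TopologicalSpace X] {f : X → A}
    {g : A → B} (hg : Function.Injective g) (h : IsLocallyConstant (g ∘ f)) :
    IsLocallyConstant f := by
  rw [IsLocallyConstant.iff_exists_open] at h ⊢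
  intro x
  obtain ⟨N, hN, hx, h⟩ := h x
  exact ⟨N, hN, hx, fun y hy ↦ hg (h y hy)⟩

variable (cov) in
/-- A parallel frame of the maximal flat subbundle over `U`. -/
structure IsParallelFrame (h : Fin n → Π x : M, BilinAt E x) (U : Opens M) : Prop where
  parallel : ∀ i, IsParallelOn cov (h i) U
  basis : ∀ x ∈ U, IsFibreBasis (maximalFlat cov) h x

omit [T2Space M] in
theorem IsParallelFrame.mem_maximalFlat {h : Fin n → Π x : M, BilinAt E x} {U : Opens M}
    (hh : IsParallelFrame cov h U) {x : M} (hx : x ∈ U) (i : Fin n) :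
    h i x ∈ maximalFlat cov x := by
  rw [← (hh.basis x hx).2]
  exact Submodule.subset_span ⟨i, rfl⟩

omit [T2Space M] in
theorem IsParallelFrame.mono {h : Fin n → Π x : M, BilinAt E x} {U V : Opens M}
    (hh : IsParallelFrame cov h U) (hVU : V ≤ U) : IsParallelFrame cov h V :=
  ⟨fun i ↦ (hh.parallel i).mono hVU, fun x hx ↦ hh.basis x (hVU hx)⟩

/-- A parallel field with values in the maximal flat subbundle has locally constant coefficients
with respect to a parallel frame. -/
theorem IsParallelFrame.exists_coeff
    (hsmooth : CovariantDerivative.ContMDiffCovariantDerivative cov ∞)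
    {h : Fin n → Π x : M, BilinAt E x} {U : Opens M} (hh : IsParallelFrame cov h U)
    {s : Π x : M, BilinAt E x} (hs : IsParallelOn cov s U)
    (hm : ∀ x ∈ U, s x ∈ maximalFlat cov x) :
    ∃ c : LocallyConstant U (Fin n → ℝ), ∀ x : U, s x = ∑ i, c x i • h i x := by
  choose c hc using fun x : U ↦ ((hh.basis x x.2).mem_iff (s x)).1 (hm x x.2)
  exact ⟨⟨c, IsParallelOn.isLocallyConstant_coeff hsmooth hh.parallel
    (fun x hx ↦ (hh.basis x hx).1) hs fun x ↦ (hc x).symm⟩, fun x ↦ (hc x).symm⟩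

/-- Two parallel frames are related by a locally constant matrix. -/
theorem IsParallelFrame.exists_transition
    (hsmooth : CovariantDerivative.ContMDiffCovariantDerivative cov ∞)
    {h h' : Fin n → Π x : M, BilinAt E x} {U : Opens M} (hh : IsParallelFrame cov h U)
    (hh' : IsParallelFrame cov h' U) :
    ∃ b : LocallyConstant U (GL (Fin n) ℝ), ∀ (x : U) (i : Fin n),
      h i x = ∑ j, (b x : Matrix (Fin n) (Fin n) ℝ) i j • h' j x := by
  choose c hc using fun i ↦ hh'.exists_coeff hsmooth (hh.parallel i)
    fun x hx ↦ hh.mem_maximalFlat hx i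
  choose c' hc' using fun i ↦ hh.exists_coeff hsmooth (hh'.parallel i)
    fun x hx ↦ hh'.mem_maximalFlat hx i
  have hinv : ∀ {h h' : Fin n → Π x : M, BilinAt E x} {c c' : Fin n → U → Fin n → ℝ},
      (∀ x : U, LinearIndependent ℝ fun i ↦ h i x) →
      (∀ i (x : U), h i x = ∑ j, c i x j • h' j x) →
      (∀ i (x : U), h' i x = ∑ j, c' i x j • h j x) → ∀ x : U,
      (Matrix.of fun i j ↦ c i x j) * (Matrix.of fun i j ↦ c' i x j) = 1 := by
    intro h h' c c' hli hc hc' x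
    ext i j
    have h1 := hc i x
    simp_rw [hc', Finset.smul_sum, smul_smul] at h1
    rw [Finset.sum_comm] at h1
    simp_rw [← Finset.sum_smul] at h1
    have h2 : ∑ j, (1 : Matrix (Fin n) (Fin n) ℝ) i j • h j x = h i x := by
      simp [Matrix.one_apply]
    exact (Fintype.linearIndependent_iffₛ.1 (hli x) _ _ (h2.trans h1) j).symm
  let b : U → GL (Fin n) ℝ := fun x ↦ ⟨Matrix.of fun i j ↦ c i x j, Matrix.of fun i j ↦ c' i x j,
    hinv (c := fun i ↦ c i) (c' := fun i ↦ c' i) (fun x ↦ (hh.basis x x.2).1) hc hc' x,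
    hinv (c := fun i ↦ c' i) (c' := fun i ↦ c i) (fun x ↦ (hh'.basis x x.2).1) hc' hc x⟩
  refine ⟨⟨b, ?_⟩, fun x i ↦ hc i x⟩
  refine IsLocallyConstant.of_comp_injective (g := fun A : GL (Fin n) ℝ ↦
    (A : Matrix (Fin n) (Fin n) ℝ)) (fun A B h ↦ Units.ext h) ?_
  rw [IsLocallyConstant.iff_eventually_eq]
  intro x
  have : ∀ i, ∀ᶠ y in 𝓝 x, c i y = c i x := fun i ↦
    (IsLocallyConstant.iff_eventually_eq _).1 (c i).isLocallyConstant x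
  filter_upwards [Filter.eventually_all.2 this] with y hy
  ext i j
  exact congrFun (hy i) j

theorem Matrix.sum_mul_smul {ι V : Type*} [Fintype ι] [AddCommGroup V] [Module ℝ V]
    (A B : Matrix ι ι ℝ) (v : ι → V) (i : ι) :
    ∑ j, (A * B) i j • v j = ∑ j, A i j • ∑ l, B j l • v l := by
  simp only [Finset.smul_sum, smul_smul]
  rw [Finset.sum_comm]
  simp only [← Finset.sum_smul, ← Matrix.mul_apply]

namespace ParallelFrames

omit [T2Space M] in
theorem isParallelFrame (F : ParallelFrames cov n) (α : F.cover.ι) :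
    IsParallelFrame cov (F.h α) (F.cover.U α) :=
  ⟨fun i x hx ↦ ⟨(F.isSection α i).smooth.diffFormAt (F.cover.U α).isOpen hx, F.parallel α i x hx⟩,
    F.basis α⟩

/-- A cover with parallel frames determines the transition cocycle. -/
theorem exists_of_frames (hsmooth : CovariantDerivative.ContMDiffCovariantDerivative cov ∞)
    (𝒰 : OpenCover M) (h : 𝒰.ι → Fin n → Π x : M, BilinAt E x)
    (hh : ∀ α, IsParallelFrame cov (h α) (𝒰.U α)) : Nonempty (ParallelFrames cov n) := by
  choose t ht using fun α β ↦ IsParallelFrame.exists_transition hsmooth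
    ((hh α).mono (inf_le_left : 𝒰.U α ⊓ 𝒰.U β ≤ _)) ((hh β).mono inf_le_right)
  exact ⟨
    { cover := 𝒰
      h := h
      isSection := fun α i ↦ ⟨(𝒰.U α).isOpen,
        ((hh α).parallel i).smoothFormOn hsmooth (𝒰.U α).isOpen,
        fun x hx ↦ (hh α).mem_maximalFlat hx i⟩
      parallel := fun α i x hx ↦ ((hh α).parallel i x hx).2
      basis := fun α ↦ (hh α).basis
      t := t
      transition := fun α β x hα hβ i ↦ ht α β ⟨x, hα, hβ⟩ i }⟩

theorem nonempty (hsmooth : CovariantDerivative.ContMDiffCovariantDerivative cov ∞)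
    (hreg : IsRegularOfRank cov n) : Nonempty (ParallelFrames cov n) := by
  choose U h hx hs hp hb using exists_local_parallel_frame hsmooth hreg
  exact exists_of_frames hsmooth ⟨M, U, fun x ↦ ⟨x, hx x⟩⟩ h fun α ↦ ⟨hp α, hb α⟩

/-- The class does not depend on the frames. -/
theorem cohomologyClass_eq (hsmooth : CovariantDerivative.ContMDiffCovariantDerivative cov ∞)
    (F F' : ParallelFrames cov n) : F.cohomologyClass = F'.cohomologyClass := by
  refine Quotient.sound ?_
  let 𝒱 : OpenCover M :=
    { ι := F.cover.ι × F'.cover.ι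
      U := fun α ↦ F.cover.U α.1 ⊓ F'.cover.U α.2
      covers := fun x ↦ by
        obtain ⟨α, hα⟩ := F.cover.covers x
        obtain ⟨β, hβ⟩ := F'.cover.covers x
        exact ⟨(α, β), hα, hβ⟩ }
  -- The 0-cochain is the matrix relating the two frames on each intersection.
  choose b hb using fun α : 𝒱.ι ↦ IsParallelFrame.exists_transition hsmooth
    ((F.isParallelFrame α.1).mono (inf_le_left : 𝒱.U α ≤ _))
    ((F'.isParallelFrame α.2).mono inf_le_right)
  refine ⟨𝒱, Prod.fst, Prod.snd, fun _ ↦ inf_le_left, fun _ ↦ inf_le_right, b, ?_⟩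
  intro α β x hα hβ
  rw [mul_assoc, eq_inv_mul_iff_mul_eq]
  refine Units.ext ?_
  change (b α ⟨x, hα⟩ : Matrix (Fin n) (Fin n) ℝ) *
      (F'.t α.2 β.2 ⟨x, hα.2, hβ.2⟩ : Matrix (Fin n) (Fin n) ℝ) =
    (F.t α.1 β.1 ⟨x, hα.1, hβ.1⟩ : Matrix (Fin n) (Fin n) ℝ) *
      (b β ⟨x, hβ⟩ : Matrix (Fin n) (Fin n) ℝ)
  ext i j
  have h1 := hb α ⟨x, hα⟩ i
  simp only [F'.transition α.2 β.2 x hα.2 hβ.2, Finset.smul_sum, smul_smul] at h1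
  have h2 := F.transition α.1 β.1 x hα.1 hβ.1 i
  simp only [hb β ⟨x, hβ⟩, Finset.smul_sum, smul_smul] at h2
  have h3 := h1.symm.trans h2
  rw [Finset.sum_comm, Finset.sum_comm (s := Finset.univ) (t := Finset.univ)
    (f := fun a b' ↦ (_ * (b β ⟨x, hβ⟩ : Matrix (Fin n) (Fin n) ℝ) a b') • F'.h β.2 b' x)] at h3
  simp only [← Finset.sum_smul] at h3
  exact Fintype.linearIndependent_iffₛ.1 (F'.basis β.2 x hβ.2).1 _ _ h3 j

/-- If the class comes from `GL(k, ℝ)`, there are frames with transition cocycle in `GL(k, ℝ)`. -/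
theorem exists_hasRankForm (hsmooth : CovariantDerivative.ContMDiffCovariantDerivative cov ∞)
    (F : ParallelFrames cov n) {k : ℕ} (hk : k ≤ n) (c : H1 M k)
    (hc : H1.map (glEmbed hk) c = F.cohomologyClass) :
    ∃ (F' : ParallelFrames cov n) (a : Cochain1 F'.cover k), F'.t = a.map (glEmbed hk) := by
  classical
  obtain ⟨c, rfl⟩ := Quotient.exists_rep c
  obtain ⟨𝒱, ρ, ρ', hρ, hρ', b, hb⟩ := Quotient.exact hc.symm
  change ∀ α, 𝒱.U α ≤ F.cover.U (ρ α) at hρ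
  change Cochain0 𝒱 n at b
  -- The new frames are b_α⁻¹ applied to the old, so their transition matrices are b_α⁻¹ t_αβ b_β,
  -- which is the given embedded cocycle. The value 0 off the cover member plays no role.
  let h : 𝒱.ι → Fin n → Π x : M, BilinAt E x := fun α i x ↦ if hx : x ∈ 𝒱.U α then
    ∑ j, ((b α ⟨x, hx⟩)⁻¹ : GL (Fin n) ℝ).1 i j • F.h (ρ α) j x else 0
  have hh : ∀ α i x (hx : x ∈ 𝒱.U α), h α i x =
      ∑ j, ((b α ⟨x, hx⟩)⁻¹ : GL (Fin n) ℝ).1 i j • F.h (ρ α) j x := fun α i x hx ↦ dif_pos hx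
  have hback : ∀ α i x (hx : x ∈ 𝒱.U α), F.h (ρ α) i x =
      ∑ j, (b α ⟨x, hx⟩).1 i j • h α j x := by
    intro α i x hx
    simp only [hh α _ x hx]
    rw [← Matrix.sum_mul_smul]
    rw [show (b α ⟨x, hx⟩).1 * ((b α ⟨x, hx⟩)⁻¹ : GL (Fin n) ℝ).1 = 1 from
      (b α ⟨x, hx⟩).mul_inv]
    simp [Matrix.one_apply]
  have hbasis : ∀ α, ∀ x ∈ 𝒱.U α, IsFibreBasis (maximalFlat cov) (h α) x := by
    intro α x hx
    have hF := F.basis (ρ α) x (hρ α hx)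
    have hspan : Submodule.span ℝ (range fun i ↦ h α i x) =
        Submodule.span ℝ (range fun i ↦ F.h (ρ α) i x) := by
      apply le_antisymm
      · refine Submodule.span_le.2 (range_subset_iff.2 fun i ↦ ?_)
        rw [hh α i x hx]
        exact Submodule.sum_mem _ fun j _ ↦ Submodule.smul_mem _ _ (Submodule.subset_span ⟨j, rfl⟩)
      · refine Submodule.span_le.2 (range_subset_iff.2 fun i ↦ ?_)
        rw [hback α i x hx]
        exact Submodule.sum_mem _ fun j _ ↦ Submodule.smul_mem _ _ (Submodule.subset_span ⟨j, rfl⟩)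
    refine ⟨?_, by rw [hspan, hF.2]⟩
    rw [linearIndependent_iff_card_eq_finrank_span, Set.finrank, hspan]
    exact linearIndependent_iff_card_eq_finrank_span.1 hF.1
  have hpar : ∀ α i, IsParallelOn cov (h α i) (𝒱.U α) := fun α i ↦
    IsParallelOn.locallyConstant_sum
      (fun j ↦ ((F.isParallelFrame (ρ α)).parallel j).mono (hρ α))
      ((b α).map fun A ↦ (A⁻¹ : GL (Fin n) ℝ).1 i) fun x hx ↦ hh α i x hx
  let a : Cochain1 𝒱 k := c.val.restrict hρ'
  refine ⟨
    { cover := 𝒱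
      h := h
      isSection := fun α i ↦ ⟨(𝒱.U α).isOpen, (hpar α i).smoothFormOn hsmooth (𝒱.U α).isOpen,
        fun x hx ↦ by
          rw [← (hbasis α x hx).2]
          exact Submodule.subset_span ⟨i, rfl⟩⟩
      parallel := fun α i x hx ↦ (hpar α i x hx).2
      basis := hbasis
      t := a.map (glEmbed hk)
      transition := fun α β x hα hβ i ↦ ?_ }, a, rfl⟩
  have e : glEmbed hk (a α β ⟨x, hα, hβ⟩) = (b α ⟨x, hα⟩)⁻¹ *
      F.t (ρ α) (ρ β) ⟨x, hρ α hα, hρ β hβ⟩ * b β ⟨x, hβ⟩ := hb α β x hα hβ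
  change h α i x = ∑ j, (glEmbed hk (a α β ⟨x, hα, hβ⟩)).1 i j • h β j x
  rw [e, hh α i x hα]
  rw [Units.val_mul, Units.val_mul, Matrix.sum_mul_smul, Matrix.sum_mul_smul]
  simp only [← hback β _ x hβ, ← F.transition (ρ α) (ρ β) x (hρ α hα) (hρ β hβ)]

end ParallelFrames

end ParallelFields

/-! ### The scalar product that a metric induces on forms -/

section PositiveForms

open Matrix

open scoped MatrixOrder Norms.L2Operator in
-- Writing G⁻¹ = BᵀB with B invertible, the trace is the squared Frobenius norm of B Q Bᵀ.
theorem Matrix.PosDef.trace_inv_mul_sq_pos {ι : Type*} [Fintype ι] [DecidableEq ι]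
    {G Q : Matrix ι ι ℝ} (hG : G.PosDef) (hQ : Qᵀ = Q) (hne : Q ≠ 0) :
    0 < trace (G⁻¹ * Q * (G⁻¹ * Q)) := by
  obtain ⟨B, hB, e⟩ := CStarAlgebra.isStrictlyPositive_iff_eq_star_mul_self.mp
    hG.inv.isStrictlyPositive
  rw [star_eq_conjTranspose, conjTranspose_eq_transpose_of_trivial] at e
  have hS : trace (G⁻¹ * Q * (G⁻¹ * Q)) = trace ((B * Q * Bᵀ)ᴴ * (B * Q * Bᵀ)) := by
    rw [conjTranspose_eq_transpose_of_trivial, transpose_mul, transpose_mul, transpose_transpose,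
      hQ, e, show Bᵀ * B * Q * (Bᵀ * B * Q) = Bᵀ * (B * Q * (Bᵀ * B * Q)) by
        simp only [Matrix.mul_assoc], trace_mul_comm]
    simp only [Matrix.mul_assoc]
  rw [hS]
  refine lt_of_le_of_ne (posSemidef_conjTranspose_mul_self _).trace_nonneg (Ne.symm ?_)
  rw [Ne, trace_conjTranspose_mul_self_eq_zero_iff]
  intro h
  apply hne
  have hBt : IsUnit Bᵀ := (isUnit_transpose B).2 hB
  rw [hBt.mul_left_eq_zero] at h
  exact hB.mul_right_eq_zero.1 h

/-- A positive definite form on a finite-dimensional space bounds the norm. -/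
theorem isVonNBounded_of_pos {E : Type*} [NormedAddCommGroup E] [NormedSpace ℝ E]
    [FiniteDimensional ℝ E] (w : E →L[ℝ] E →L[ℝ] ℝ) (hw : ∀ v, v ≠ 0 → 0 < w v v) :
    Bornology.IsVonNBounded ℝ {v : E | w v v < 1} := by
  rw [NormedSpace.isVonNBounded_iff, isBounded_iff_forall_norm_le]
  rcases subsingleton_or_nontrivial E with hE | hE
  · exact ⟨0, fun v _ ↦ by rw [Subsingleton.elim v 0, norm_zero]⟩
  have := FiniteDimensional.proper_real E
  obtain ⟨u, hu, hmin⟩ := (isCompact_sphere (0 : E) 1).exists_isMinOn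
    (NormedSpace.sphere_nonempty.2 zero_le_one)
    (f := fun v ↦ w v v) (by fun_prop)
  have hu1 : ‖u‖ = 1 := by simpa using hu
  have hu0 : u ≠ 0 := by
    rintro rfl
    simp at hu1
  have hpos := hw u hu0
  refine ⟨1 + (w u u)⁻¹, fun v hv ↦ ?_⟩
  rcases eq_or_ne v 0 with rfl | hv0
  · rw [norm_zero]
    positivity
  have hn : 0 < ‖v‖ := norm_pos_iff.2 hv0
  have h1 : w u u ≤ w (‖v‖⁻¹ • v) (‖v‖⁻¹ • v) := hmin (by
    rw [mem_sphere_zero_iff_norm, norm_smul, norm_inv, norm_norm, inv_mul_cancel₀ hn.ne'])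
  simp only [map_smul, _root_.smul_apply, smul_eq_mul] at h1
  have h2 : w u u * ‖v‖ ^ 2 < 1 := by
    refine lt_of_le_of_lt ?_ (show w v v < 1 from hv)
    calc w u u * ‖v‖ ^ 2 ≤ (‖v‖⁻¹ * (‖v‖⁻¹ * w v v)) * ‖v‖ ^ 2 := by gcongr
      _ = w v v := by field_simp
  have h3 : ‖v‖ ^ 2 < (w u u)⁻¹ := by
    rwa [lt_inv_comm₀ (by positivity) hpos, ← one_div, lt_div_iff₀ (by positivity)]
  -- With m the minimum of w on the unit sphere, 2‖v‖ ≤ 1 + ‖v‖² < 1 + 1/m.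
  nlinarith [sq_nonneg (‖v‖ - 1)]

variable {E : Type*} [NormedAddCommGroup E] [NormedSpace ℝ E] [FiniteDimensional ℝ E]
  {M : Type*} [TopologicalSpace M] [ChartedSpace E M]

variable (E) in
/-- A basis of the tangent space. -/
def tangentBasis (x : M) :
    Module.Basis (Fin (Module.finrank ℝ E)) ℝ (TangentSpace 𝓘(ℝ, E) x) :=
  Module.finBasis ℝ E

/-- The Gram matrix of a form. -/
def formMatrix (x : M) : BilinAt E x →ₗ[ℝ]
    Matrix (Fin (Module.finrank ℝ E)) (Fin (Module.finrank ℝ E)) ℝ where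
  toFun w := Matrix.of fun i j ↦ w (tangentBasis E x i) (tangentBasis E x j)
  map_add' _ _ := rfl
  map_smul' _ _ := rfl

theorem formMatrix_apply {x : M} (w : BilinAt E x) (i j : Fin (Module.finrank ℝ E)) :
    formMatrix x w i j = w (tangentBasis E x i) (tangentBasis E x j) := rfl

omit [FiniteDimensional ℝ E] in
theorem form_sum_sum {x : M} (w : BilinAt E x) {ι : Type*} [Fintype ι] (c d : ι → ℝ)
    (e : ι → TangentSpace 𝓘(ℝ, E) x) :
    w (∑ i, c i • e i) (∑ j, d j • e j) = ∑ i, ∑ j, c i * w (e i) (e j) * d j := by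
  rw [map_sum w, _root_.sum_apply]
  refine Finset.sum_congr rfl fun i _ ↦ ?_
  rw [map_sum]
  refine Finset.sum_congr rfl fun j _ ↦ ?_
  rw [map_smul, map_smul, _root_.smul_apply, smul_eq_mul, smul_eq_mul]
  ring

theorem formMatrix_injective (x : M) : Function.Injective (formMatrix (E := E) x) := by
  intro w w' h
  ext u v
  rw [← (tangentBasis E x).sum_repr u, ← (tangentBasis E x).sum_repr v, form_sum_sum, form_sum_sum]
  simp only [← formMatrix_apply, h]

theorem IsSymmForm.transpose_formMatrix {x : M} {w : BilinAt E x} (hw : IsSymmForm w) :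
    (formMatrix x w)ᵀ = formMatrix x w := by
  ext i j
  exact hw _ _

theorem IsPosDefForm.posDef_formMatrix {x : M} {w : BilinAt E x} (hw : IsPosDefForm w)
    (hs : IsSymmForm w) : (formMatrix x w).PosDef := by
  rw [posDef_iff_dotProduct_mulVec]
  refine ⟨?_, fun c hc ↦ ?_⟩
  · rw [IsHermitian, conjTranspose_eq_transpose_of_trivial, hs.transpose_formMatrix]
  have h0 : ∑ i, c i • tangentBasis E x i ≠ 0 := fun h ↦
    hc (funext (Fintype.linearIndependent_iff.1 (tangentBasis E x).linearIndependent c h))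
  have := hw _ h0
  rw [form_sum_sum] at this
  refine this.trans_eq ?_
  simp only [dotProduct, mulVec, star_trivial, formMatrix_apply, Finset.mul_sum, mul_assoc]

/-- The scalar product `tr (g⁻¹ q g⁻¹ w)` induced on forms by the form `g`. -/
def formPairing {x : M} (g q : BilinAt E x) : BilinAt E x →ₗ[ℝ] ℝ :=
  Matrix.traceLinearMap _ ℝ ℝ ∘ₗ
    LinearMap.mulLeft ℝ ((formMatrix x g)⁻¹ * formMatrix x q * (formMatrix x g)⁻¹) ∘ₗ formMatrix x

theorem formPairing_apply {x : M} (g q w : BilinAt E x) : formPairing g q w =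
    trace ((formMatrix x g)⁻¹ * formMatrix x q * ((formMatrix x g)⁻¹ * formMatrix x w)) := by
  rw [← Matrix.mul_assoc]
  rfl

theorem formPairing_self_pos {x : M} {g q : BilinAt E x} (hg : IsPosDefForm g) (hgs : IsSymmForm g)
    (hq : IsSymmForm q) (hne : q ≠ 0) : 0 < formPairing g q q := by
  rw [formPairing_apply]
  refine (hg.posDef_formMatrix hgs).trace_inv_mul_sq_pos hq.transpose_formMatrix fun h ↦ hne ?_
  exact formMatrix_injective x (h.trans (map_zero _).symm)

theorem formMatrix_transport {a b : M}
    (T : TangentSpace 𝓘(ℝ, E) a →ₗ[ℝ] TangentSpace 𝓘(ℝ, E) b) :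
    ∃ P : Matrix (Fin (Module.finrank ℝ E)) (Fin (Module.finrank ℝ E)) ℝ,
      ∀ (w : BilinAt E a) (w' : BilinAt E b), (∀ u v, w' (T u) (T v) = w u v) →
        formMatrix a w = Pᵀ * formMatrix b w' * P := by
  refine ⟨LinearMap.toMatrix (tangentBasis E a) (tangentBasis E b) T, fun w w' h ↦ ?_⟩
  ext i j
  rw [formMatrix_apply, ← h, ← (tangentBasis E b).sum_repr (T (tangentBasis E a i)),
    ← (tangentBasis E b).sum_repr (T (tangentBasis E a j)), form_sum_sum, Finset.sum_comm]
  simp only [Matrix.mul_apply, transpose_apply, LinearMap.toMatrix_apply, Finset.sum_mul,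
    formMatrix_apply]

/-- The pairing is invariant under parallel transport. -/
theorem formPairing_transport {a b : M} {T : TangentSpace 𝓘(ℝ, E) a →ₗ[ℝ] TangentSpace 𝓘(ℝ, E) b}
    {g q w : BilinAt E a} {g' q' w' : BilinAt E b} (hg : IsPosDefForm g) (hgs : IsSymmForm g)
    (hgT : ∀ u v, g' (T u) (T v) = g u v) (hqT : ∀ u v, q' (T u) (T v) = q u v)
    (hwT : ∀ u v, w' (T u) (T v) = w u v) : formPairing g q w = formPairing g' q' w' := by
  obtain ⟨P, hP⟩ := formMatrix_transport T
  have hG := (hg.posDef_formMatrix hgs).det_pos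
  rw [formPairing_apply, formPairing_apply, hP g g' hgT, hP q q' hqT, hP w w' hwT]
  rw [hP g g' hgT, det_mul, det_mul, det_transpose] at hG
  -- T is not assumed invertible; this follows because the Gram matrix of g, which is Pᵀ (Gram
  -- matrix of g') P, has positive determinant.
  have hPd : IsUnit P.det := isUnit_iff_ne_zero.2 fun h ↦ by simp [h] at hG
  have hPd' : IsUnit Pᵀ.det := by rwa [det_transpose]
  rw [Matrix.mul_inv_rev, Matrix.mul_inv_rev]
  -- Under a change of basis G⁻¹X is conjugated by P, so the trace is unchanged.
  have key : ∀ X : Matrix (Fin (Module.finrank ℝ E)) (Fin (Module.finrank ℝ E)) ℝ,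
      P⁻¹ * ((formMatrix b g')⁻¹ * Pᵀ⁻¹) * (Pᵀ * X * P) =
        P⁻¹ * ((formMatrix b g')⁻¹ * X) * P := by
    intro X
    simp only [Matrix.mul_assoc]
    rw [nonsing_inv_mul_cancel_left _ _ hPd']
  rw [key, key, Matrix.mul_assoc, Matrix.mul_assoc, trace_mul_comm]
  simp only [Matrix.mul_assoc]
  rw [mul_nonsing_inv_cancel_left _ _ hPd, mul_nonsing_inv _ hPd, Matrix.mul_one]

end PositiveForms

/-! ### Parallel metrics and the subbundle W_∇ -/

section Metric

universe u v

variable {E : Type v} [NormedAddCommGroup E] [NormedSpace ℝ E] [FiniteDimensional ℝ E]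
  {M : Type u} [TopologicalSpace M] [ChartedSpace E M] [IsManifold 𝓘(ℝ, E) ∞ M] [T2Space M]
  {cov : CovariantDerivative 𝓘(ℝ, E) E (TangentSpace 𝓘(ℝ, E) : M → Type _)} {n : ℕ}

/-- A parallel field that is positive definite at one point is so everywhere. -/
theorem IsParallelOn.isPosDefForm [PreconnectedSpace M]
    (hsmooth : CovariantDerivative.ContMDiffCovariantDerivative cov ∞)
    {g : Π x : M, BilinAt E x} (hg : IsParallelOn cov g univ) {x : M} (hx : IsPosDefForm (g x))
    (y : M) : IsPosDefForm (g y) := by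
  have hloc : IsLocallyConstant fun y ↦ IsPosDefForm (g y) := by
    rw [IsLocallyConstant.iff_exists_open]
    intro y
    obtain ⟨N, hN, hyN, -, hT⟩ := exists_local_transport hsmooth isOpen_univ (mem_univ y)
    have h : ∀ a ∈ N, ∀ b ∈ N, IsPosDefForm (g a) → IsPosDefForm (g b) := by
      intro a ha b hb hpos v hv
      obtain ⟨T, hTi, hT⟩ := hT a ha b hb
      obtain ⟨v, rfl⟩ := surjective_of_injective_tangent hTi v
      rw [hT g (hg.mono (subset_univ _))]
      refine hpos v ?_
      rintro rfl
      exact hv (map_zero T)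
    exact ⟨N, hN, hyN, fun z hz ↦ propext ⟨h z hz y hyN, h y hyN z hz⟩⟩
  exact (hloc.apply_eq_of_preconnectedSpace x y).mp hx

/-- A parallel symmetric field that is positive definite somewhere is a parallel Riemannian
metric. -/
theorem isMetricConnection_of_isParallelOn [PreconnectedSpace M]
    (hsmooth : CovariantDerivative.ContMDiffCovariantDerivative cov ∞)
    {g : Π x : M, BilinAt E x} (hg : IsParallelOn cov g univ) (hs : ∀ x, IsSymmForm (g x))
    {x : M} (hx : IsPosDefForm (g x)) : IsMetricConnection cov := by
  have hpos := hg.isPosDefForm hsmooth hx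
  exact ⟨
    { inner := g
      symm := hs
      pos := hpos
      isVonNBounded := fun y ↦ isVonNBounded_of_pos (E := E) (g y) (hpos y)
      contMDiff := contMDiffOn_univ.1 (hg.smoothFormOn hsmooth isOpen_univ) },
    fun y ↦ (hg y (mem_univ y)).2⟩

namespace ParallelFrames

variable (F : ParallelFrames cov n) {k : ℕ} {hk : k ≤ n} {a : Cochain1 F.cover k}

omit [T2Space M] in
/-- The members of the frames fixed by the transition cocycle agree on overlaps. -/
theorem h_eq_of_lt (ht : F.t = a.map (glEmbed hk)) {α β : F.cover.ι} {x : M}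
    (hα : x ∈ F.cover.U α) (hβ : x ∈ F.cover.U β) {i : Fin n} (hi : i.val < n - k) :
    F.h α i x = F.h β i x := by
  rw [F.transition α β x hα hβ i, ht]
  change ∑ j, blockEmbed hk (a α β ⟨x, hα, hβ⟩).1 i j • F.h β j x = _
  have : ∀ j, blockEmbed hk (a α β ⟨x, hα, hβ⟩).1 i j = if i = j then 1 else 0 := fun j ↦ by
    rw [blockEmbed_apply, dif_neg (by omega)]
  simp [this]

omit [T2Space M] in
/-- The other members of the frames are related by the given cocycle. -/
theorem h_inr_eq (ht : F.t = a.map (glEmbed hk)) {α β : F.cover.ι} {x : M}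
    (hα : x ∈ F.cover.U α) (hβ : x ∈ F.cover.U β) (i : Fin k) :
    F.h α (blockEquiv hk (Sum.inr i)) x =
      ∑ j, (a α β ⟨x, hα, hβ⟩).1 i j • F.h β (blockEquiv hk (Sum.inr j)) x := by
  rw [F.transition α β x hα hβ, ht, ← (blockEquiv hk).sum_comp, Fintype.sum_sum_type]
  change ∑ j, blockEmbed hk (a α β ⟨x, hα, hβ⟩).1 _ _ • _ +
    ∑ j, blockEmbed hk (a α β ⟨x, hα, hβ⟩).1 _ _ • _ = _
  simp [blockEmbed_blockEquiv]

omit [T2Space M] in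
theorem isCocycle_of_map (ht : F.t = a.map (glEmbed hk)) : IsCocycle a := by
  intro α β γ x hα hβ hγ
  have := F.isCocycle α β γ x hα hβ hγ
  rw [ht] at this
  apply glEmbed_injective hk
  rw [map_mul, map_mul, map_inv, map_one]
  exact this

omit [T2Space M] in
theorem cohomologyClass_eq_map (ht : F.t = a.map (glEmbed hk)) : F.cohomologyClass =
    H1.map (glEmbed hk) (Quotient.mk (cocycleSetoid M k) ⟨F.cover, a, F.isCocycle_of_map ht⟩) :=
  Quotient.sound ⟨F.cover, id, id, fun _ ↦ le_rfl, fun _ ↦ le_rfl, fun _ ↦ 1,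
    fun α β x hα hβ ↦ by
      change glEmbed hk (a α β ⟨x, hα, hβ⟩) = 1⁻¹ * F.t α β ⟨x, hα, hβ⟩ * 1
      rw [ht, inv_one, one_mul, mul_one]
      rfl⟩

/-- Every form in the subbundle generated by the fixed members of the frames extends to a global
parallel field. -/
theorem exists_isParallelOn_of_mem_subbundle
    (hsmooth : CovariantDerivative.ContMDiffCovariantDerivative cov ∞)
    (ht : F.t = a.map (glEmbed hk)) {x : M} {w : BilinAt E x} (hw : w ∈ F.subbundle (n - k) x) :
    ∃ g : Π x : M, BilinAt E x, IsParallelOn cov g univ ∧ (∀ y, g y ∈ maximalFlat cov y) ∧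
      g x = w := by
  have hlin := isLinearSubset_maximalFlat hsmooth
  induction hw using Submodule.span_induction with
  | mem w hw =>
    obtain ⟨α, hα, i, hi, rfl⟩ := hw
    choose β hβ using F.cover.covers
    -- The chosen index β y may jump, but the fixed members agree on overlaps, so near y the field
    -- equals the member over the single set with index β y.
    refine ⟨fun y ↦ F.h (β y) i y, fun y _ ↦ ?_, fun y ↦ (F.isSection (β y) i).mem y (hβ y),
      F.h_eq_of_lt ht (hβ x) hα hi⟩
    exact ((F.isParallelFrame (β y)).parallel i).congr (F.cover.U (β y)).isOpen
      (fun z hz ↦ F.h_eq_of_lt ht hz (hβ z) hi) y (hβ y)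
  | zero => exact ⟨fun _ ↦ 0, isParallelOn_zero, hlin.zero, rfl⟩
  | add w w' _ _ h h' =>
    obtain ⟨g, hg, hm, rfl⟩ := h
    obtain ⟨g', hg', hm', rfl⟩ := h'
    exact ⟨_, hg.add hg', fun y ↦ hlin.add y _ (hm y) _ (hm' y), rfl⟩
  | smul c w _ h =>
    obtain ⟨g, hg, hm, rfl⟩ := h
    exact ⟨_, hg.smul c, fun y ↦ hlin.smul y c _ (hm y), rfl⟩

theorem isMetricConnection_of_mem_subbundle [PreconnectedSpace M]
    (hsmooth : CovariantDerivative.ContMDiffCovariantDerivative cov ∞)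
    (ht : F.t = a.map (glEmbed hk)) {x : M} {w : BilinAt E x} (hw : w ∈ F.subbundle (n - k) x)
    (hpos : IsPosDefForm w) : IsMetricConnection cov := by
  obtain ⟨g, hg, hm, rfl⟩ := F.exists_isParallelOn_of_mem_subbundle hsmooth ht hw
  exact isMetricConnection_of_isParallelOn hsmooth hg
    (fun y ↦ (mem_flatForms_of_mem_maximalFlat (hm y)).1) hpos

/-- If the splitting of the frames is optimal, a parallel metric takes values in the subbundle
generated by the fixed members of the frames. -/
theorem exists_mem_subbundle_of_isParallelOn [Nonempty M]
    (hsmooth : CovariantDerivative.ContMDiffCovariantDerivative cov ∞)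
    (ht : F.t = a.map (glEmbed hk)) (hmin : ∀ l, H1.InImage l F.cohomologyClass → k ≤ l)
    {g : Π x : M, BilinAt E x} (hg : IsParallelOn cov g univ) (hs : ∀ x, IsSymmForm (g x))
    (hpos : ∀ x, IsPosDefForm (g x)) : ∃ x, g x ∈ F.subbundle (n - k) x := by
  by_contra! hnot
  have hlin := isLinearSubset_maximalFlat hsmooth
  choose γ hγ using fun α ↦ (F.isParallelFrame α).exists_coeff hsmooth (hg.mono (subset_univ _))
    fun x _ ↦ hg.mem_maximalFlat hsmooth isOpen_univ (fun y _ ↦ hs y) (mem_univ x)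
  let e : F.cover.ι → Fin k → Π x : M, BilinAt E x := fun α j ↦ F.h α (blockEquiv hk (Sum.inr j))
  let c : ∀ α, LocallyConstant (F.cover.U α) (Fin k → ℝ) := fun α ↦
    (γ α).map fun v j ↦ v (blockEquiv hk (Sum.inr j))
  have hepar : ∀ α j, IsParallelOn cov (e α j) (F.cover.U α) := fun α j ↦
    (F.isParallelFrame α).parallel _
  have he : ∀ α β x (hα : x ∈ F.cover.U α) (hβ : x ∈ F.cover.U β) i,
      e α i x = ∑ j, (a α β ⟨x, hα, hβ⟩).1 i j • e β j x := fun α β x hα hβ i ↦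
    F.h_inr_eq ht hα hβ i
  -- Comparing coefficients of g in two frames: the transition matrix is block diagonal, so the last
  -- k coefficients transform among themselves.
  have hc : ∀ α β x (hα : x ∈ F.cover.U α) (hβ : x ∈ F.cover.U β),
      Matrix.vecMul (c α ⟨x, hα⟩) (a α β ⟨x, hα, hβ⟩).1 = c β ⟨x, hβ⟩ := by
    intro α β x hα hβ
    have h1 := (hγ α ⟨x, hα⟩).symm.trans (hγ β ⟨x, hβ⟩)
    simp only [F.transition α β x hα hβ, Finset.smul_sum, smul_smul] at h1
    rw [Finset.sum_comm] at h1
    simp only [← Finset.sum_smul] at h1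
    have h2 := Fintype.linearIndependent_iffₛ.1 (F.basis β x hβ).1 _ _ h1
    ext j
    have h3 := h2 (blockEquiv hk (Sum.inr j))
    rw [ht, ← (blockEquiv hk).sum_comp, Fintype.sum_sum_type] at h3
    change ∑ i, γ α ⟨x, hα⟩ _ * blockEmbed hk (a α β ⟨x, hα, hβ⟩).1 _ _ +
      ∑ i, γ α ⟨x, hα⟩ _ * blockEmbed hk (a α β ⟨x, hα, hβ⟩).1 _ _ = _ at h3
    simp only [blockEmbed_blockEquiv, Matrix.fromBlocks_apply₁₂, Matrix.zero_apply, mul_zero,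
      Finset.sum_const_zero, zero_add, Matrix.fromBlocks_apply₂₂] at h3
    exact h3
  choose β hβ using F.cover.covers
  -- The component of g along the last k frame members, independent of the frame by `hc`. It
  -- vanishes at x exactly if g(x) lies in the subbundle, so it is nowhere zero under the present
  -- assumption.
  let q : Π x : M, BilinAt E x := fun x ↦ ∑ j, c (β x) ⟨x, hβ x⟩ j • e (β x) j x
  have hq : ∀ α x (hα : x ∈ F.cover.U α), q x = ∑ j, c α ⟨x, hα⟩ j • e α j x := by
    intro α x hα
    simp only [he α (β x) x hα (hβ x), Finset.smul_sum, smul_smul]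
    rw [Finset.sum_comm]
    simp only [← Finset.sum_smul]
    simp only [q, ← hc α (β x) x hα (hβ x)]
    rfl
  have hqpar : IsParallelOn cov q univ := fun x _ ↦
    IsParallelOn.locallyConstant_sum (hepar (β x)) (c (β x)) (hq (β x)) x (hβ x)
  have hqsymm : ∀ x, IsSymmForm (q x) := fun x ↦ by
    refine (mem_flatForms_of_mem_maximalFlat (cov := cov) ?_).1
    change q x ∈ (hlin.fibre x : Set (BilinAt E x))
    exact Submodule.sum_mem _ fun j _ ↦ Submodule.smul_mem _ _
      ((F.isSection (β x) _).mem x (hβ x))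
  have hqne : ∀ x, q x ≠ 0 := by
    intro x h0
    apply hnot x
    have h1 := hγ (β x) ⟨x, hβ x⟩
    rw [← (blockEquiv hk).sum_comp, Fintype.sum_sum_type] at h1
    change g x = _ + q x at h1
    rw [h1, h0, add_zero]
    exact Submodule.sum_mem _ fun j _ ↦ Submodule.smul_mem _ _
      (Submodule.subset_span ⟨β x, hβ x, _, by rw [blockEquiv_inl_val]; exact j.2, rfl⟩)
  -- The scalar products of q with the last k frame members, which are locally constant because g, q
  -- and the members are parallel and the pairing is invariant under transport. They supply the
  -- invariant complement that q alone would not.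
  let l : ∀ α, LocallyConstant (F.cover.U α) (Fin k → ℝ) := fun α ↦
    ⟨fun x j ↦ formPairing (g x.1) (q x.1) (e α j x.1), by
      rw [IsLocallyConstant.iff_exists_open]
      rintro ⟨x, hx⟩
      obtain ⟨N, hN, hxN, hNU, hT⟩ := exists_local_transport hsmooth (F.cover.U α).isOpen hx
      refine ⟨Subtype.val ⁻¹' N, hN.preimage continuous_subtype_val, hxN, ?_⟩
      rintro ⟨y, hy⟩ hyN
      obtain ⟨T, -, hT⟩ := hT y hyN x hxN
      ext j
      exact formPairing_transport (hpos y) (hs y) (hT g (hg.mono (subset_univ _)))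
        (hT q (hqpar.mono (subset_univ _))) (hT _ ((hepar α j).mono hNU))⟩
  have hl : ∀ α β x (hα : x ∈ F.cover.U α) (hβ : x ∈ F.cover.U β),
      Matrix.mulVec (a α β ⟨x, hα, hβ⟩).1 (l β ⟨x, hβ⟩) = l α ⟨x, hα⟩ := by
    intro α β x hα hβ
    ext i
    change _ = formPairing (g x) (q x) (e α i x)
    rw [he α β x hα hβ, map_sum]
    simp only [map_smul, smul_eq_mul]
    rfl
  -- c · l is the squared length of q for the scalar product given by g.
  have hne : ∀ α x, dotProduct (c α x) (l α x) ≠ 0 := by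
    rintro α ⟨x, hx⟩
    have := formPairing_self_pos (hpos x) (hs x) (hqsymm x) (hqne x)
    rw [hq α x hx, map_sum, ← hq α x hx] at this
    simp only [map_smul, smul_eq_mul] at this
    exact this.ne'
  cases k with
  | zero =>
    -- For k = 0 the field q is an empty sum, yet it is nonzero at every point.
    obtain ⟨x⟩ := ‹Nonempty M›
    exact hqne x (Finset.sum_eq_zero fun j _ ↦ j.elim0)
  | succ k =>
    obtain ⟨a', ha'⟩ := exists_map_eq_of_fixed ⟨F.cover, a, F.isCocycle_of_map ht⟩ c l hne hc hl
    have := hmin k ⟨(Nat.le_succ k).trans hk, a', by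
      rw [F.cohomologyClass_eq_map ht, ← ha', H1.map_map, glEmbed_comp]⟩
    omega

end ParallelFrames

end Metric

end

theorem theorem4 {E : Type*} [NormedAddCommGroup E] [NormedSpace ℝ E]
    [FiniteDimensional ℝ E]
    {M : Type*} [TopologicalSpace M] [T2Space M] [SecondCountableTopology M] [ConnectedSpace M]
    [ChartedSpace E M] [IsManifold 𝓘(ℝ, E) ∞ M]
    (cov : CovariantDerivative 𝓘(ℝ, E) E (TangentSpace 𝓘(ℝ, E) : M → Type _))
    (hsmooth : CovariantDerivative.ContMDiffCovariantDerivative cov ∞)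
    (n : ℕ) (hreg : IsRegularOfRank cov n) :
    ∃ τ : H1 M n,
      (∀ F : ParallelFrames cov n, F.cohomologyClass = τ) ∧
      (∃ F : ParallelFrames cov n, F.HasRankForm τ.rank) ∧
      ∀ F : ParallelFrames cov n, F.HasRankForm τ.rank →
        (IsMetricConnection cov ↔
          ∃ (x : M) (w : BilinAt E x), w ∈ F.subbundle τ.rank x ∧ IsPosDefForm w) := by
  obtain ⟨F₀⟩ := ParallelFrames.nonempty hsmooth hreg
  have hcl : ∀ F : ParallelFrames cov n, F.cohomologyClass = F₀.cohomologyClass := fun F ↦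
    F.cohomologyClass_eq hsmooth F₀
  have hrank : F₀.cohomologyClass.rank ≤ n := Nat.sub_le _ _
  have hsub := H1.sub_rank F₀.cohomologyClass
  refine ⟨F₀.cohomologyClass, hcl, ?_, ?_⟩
  · have : H1.InImage (n - F₀.cohomologyClass.rank) F₀.cohomologyClass := by
      rw [hsub]
      exact H1.inImage_sInf _
    obtain ⟨hk, c, hc⟩ := this
    exact F₀.exists_hasRankForm hsmooth hk c hc
  rintro F ⟨a, ht⟩
  -- The lemmas count the fixed members as n - k, where k = n - rank is the block size.
  have hm : n - (n - F₀.cohomologyClass.rank) = F₀.cohomologyClass.rank := Nat.sub_sub_self hrank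
  constructor
  · rintro ⟨g, hg⟩
    -- Smoothness of g is needed here, since `covForm` also vanishes by default where a field is not
    -- differentiable.
    have hpar : IsParallelOn cov g.inner univ := fun x hx ↦
      ⟨SmoothFormOn.diffFormAt isOpen_univ (contMDiffOn_univ.2 g.contMDiff) hx, hg x⟩
    obtain ⟨x, hx⟩ := F.exists_mem_subbundle_of_isParallelOn hsmooth ht
      (fun l hl ↦ by
        rw [hsub]
        rw [hcl] at hl
        exact Nat.sInf_le hl) hpar g.symm g.pos
    rw [hm] at hx
    exact ⟨x, g.inner x, hx, g.pos x⟩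
  · rintro ⟨x, w, hw, hpos⟩
    rw [← hm] at hw
    exact F.isMetricConnection_of_mem_subbundle hsmooth ht hw hpos
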